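/- Let $(V,\omega)$ be a real symplectic vector space of dimension $2n$, $\Lambda$ its grassmannian of lagrangian subspaces, $L_0\in\Lambda$, and $\Sigma=\{L\in\Lambda : L\cap L_0\neq 0\}$ the Maslov cycle of $L_0$. Let $Q\in\Lambda$ be a lagrangian complement of $L_0$. For a real vector space $R$, let $|R|^{\alpha}$ be the complex line of $\alpha$-densities on $R$, and let $\mathcal D'(Q,|Q|^{1/2})$ be the topological dual of the space of compactly supported smooth half-densities on $Q$. For $u=q+l\in V$ with $q\in Q$, $l\in L_0$, let $\sigma(u)=-i\,\partial_q+\omega(\cdot,l)$ act on $\mathcal D'(Q,|Q|^{1/2})$, where $\partial_q$ is the Lie derivative along the constant vector field $q$ and $\omega(\cdot,l)$ acts by multiplication with the linear function $x\mapsto\omega(x,l)$ on $Q$. For $L\in\Lambda$ let $$E_L=\{\theta\in\mathcal D'(Q,|Q|^{1/2}) : \sigma(u)\theta=0 \text{ for all } u\in L\}$$ be the space of pure symplectic spinors of $L$. A local section $L\mapsto\theta_L\in E_L$ is called smooth if $L\mapsto\theta_L(g)$ is smooth for every compactly supported smooth half-density $g$ on $Q$. **Theorem.** 1. Every $E_L$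 is one-dimensional, and near every point of $\Lambda$ there is a nowhere vanishing smooth local section; thus the $E_L$ form a complex line bundle $E\to\Lambda$. 2. If $L\notin\Sigma$, every $\theta\in E_L$ is a smooth half-density on $Q$, and $\theta\mapsto\theta(0)\in|Q|^{1/2}\cong|V/L_0|^{1/2}$ is a well-defined linear map on $E_L$. Thus evaluation at $0$ defines a section $\phi$ of $E^*\otimes|V/L_0|^{1/2}$ over $\Lambda\setminus\Sigma$. 3. $\Sigma$ has measure zero in $\Lambda$. Every section of $E^*\otimes|V/L_0|^{1/2}$ over $\Lambda$ (with no regularity required on $\Sigma$) that equals $\phi$ on $\Lambda\setminus\Sigma$ is locally integrable: in every chart of $\Lambda$ and every smooth local frame of $E$ it is a locally $L^1$ function. 4. Integration against this locally $L^1$ section consequently defines a distributional section of $E^*\otimes|V/L_0|^{1/2}$ over $\Lambda$ extending $\phi$. It is singular everywhere on $\Sigma$: it does not coincide with a smooth section in any neighbourhood of any point of $\Sigma$. -/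

import Mathlib

open MeasureTheory Module
open scoped Distributions

noncomputable section

/-! ### Densities on a vector space -/

section Densities

variable {R R' : Type*} [AddCommGroup R] [Module ℝ R] [AddCommGroup R'] [Module ℝ R']

/-- The `α`-densities on a real vector space `R` of dimension `n`, as functions of a basis `b` of
`R` (that is, of the nonzero element `b₁ ∧ ⋯ ∧ bₙ` of the top exterior power) which are
homogeneous of degree `α`. -/
def densitySubmodule (n : ℕ) (α : ℝ) (R : Type*) [AddCommGroup R] [Module ℝ R] :
    Submodule ℂ (Basis (Fin n) ℝ R → ℂ) where
  carrier := {s | ∀ b b' : Basis (Fin n) ℝ R, s b' = ((|b.det b'| ^ α : ℝ) : ℂ) * s b}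
  zero_mem' := fun b b' => by simp
  add_mem' := fun {s t} hs ht b b' => by
    simp only [Pi.add_apply, hs b b', ht b b', mul_add]
  smul_mem' := fun c s hs b b' => by
    simp only [Pi.smul_apply, hs b b', smul_eq_mul]; ring

/-- The complex line `|R|^α` of `α`-densities on the `n`-dimensional real vector space `R`. -/
def Density (n : ℕ) (α : ℝ) (R : Type*) [AddCommGroup R] [Module ℝ R] : Type _ :=
  densitySubmodule n α R

namespace Density

variable {n : ℕ} {α : ℝ}

instance : AddCommGroup (Density n α R) := inferInstanceAs (AddCommGroup (densitySubmodule n α R))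

instance : Module ℂ (Density n α R) := inferInstanceAs (Module ℂ (densitySubmodule n α R))

instance : CoeFun (Density n α R) (fun _ => Basis (Fin n) ℝ R → ℂ) := ⟨fun s => s.1⟩

open Classical in
/-- Evaluation of densities at some chosen basis; it only serves to norm the line `|R|^α`. -/
def evalSome (n : ℕ) (α : ℝ) (R : Type*) [AddCommGroup R] [Module ℝ R] :
    Density n α R →ₗ[ℂ] ℂ where
  toFun s := if h : Nonempty (Basis (Fin n) ℝ R) then s h.some else 0
  map_add' s t := by
    split_ifs with h
    · rfl
    · simp
  map_smul' c s := by
    split_ifs with h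
    · rfl
    · simp

theorem evalSome_injective : Function.Injective (evalSome n α R) := by
  intro s t hst
  refine Subtype.ext (funext fun b => ?_)
  have h : Nonempty (Basis (Fin n) ℝ R) := ⟨b⟩
  have h2 : s.1 h.some = t.1 h.some := by simpa [evalSome, h] using hst
  rw [s.2 h.some b, t.2 h.some b, h2]

/-- A norm on the line `|R|^α` (all norms on it are equivalent). -/
instance : NormedAddCommGroup (Density n α R) :=
  NormedAddCommGroup.induced (Density n α R) ℂ (evalSome n α R) evalSome_injective

instance : NormedSpace ℂ (Density n α R) :=
  NormedSpace.induced ℂ (Density n α R) ℂ (evalSome n α R)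

/-- The isomorphism `|R|^α ≅ |R'|^α` induced by a linear isomorphism `R ≅ R'`. -/
def map (e : R ≃ₗ[ℝ] R') : Density n α R →ₗ[ℂ] Density n α R' where
  toFun s := ⟨fun b' => s.1 (b'.map e.symm), fun b b' => by
    have h := s.2 (b.map e.symm) (b'.map e.symm)
    rw [Basis.det_map] at h
    simpa [Function.comp_def] using h⟩
  map_add' s t := rfl
  map_smul' c s := rfl

end Density

end Densities

/-! ### The lagrangian grassmannian and its canonical charts -/

section LagrangianGrassmannian

variable {V : Type*} [AddCommGroup V] [Module ℝ V]

/-- The set `Λ(V)` of lagrangian subspaces: those equal to their own `ω`-orthogonal. -/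
def LagGr (ω : LinearMap.BilinForm ℝ V) : Type _ :=
  {L : Submodule ℝ V // ω.orthogonal L = L}

/-- The Maslov cycle `Σ` of `L₀`. -/
def maslovCycle {ω : LinearMap.BilinForm ℝ V} (L₀ : LagGr ω) : Set (LagGr ω) :=
  {L | L.1 ⊓ L₀.1 ≠ ⊥}

/-- Canonical (symplectic) bases `(e₁, …, eₙ, f₁, …, fₙ)` of `V`. -/
structure SymplecticBasis (ω : LinearMap.BilinForm ℝ V) (n : ℕ) where
  basis : Basis (Fin n ⊕ Fin n) ℝ V
  ee : ∀ i j, ω (basis (.inl i)) (basis (.inl j)) = 0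
  ff : ∀ i j, ω (basis (.inr i)) (basis (.inr j)) = 0
  ef : ∀ i j, ω (basis (.inl i)) (basis (.inr j)) = if i = j then 1 else 0
  fe : ∀ i j, ω (basis (.inr i)) (basis (.inl j)) = if i = j then -1 else 0

/-- Real symmetric `n × n` matrices `A`, given by the entries `A s(i, j)` indexed by unordered
pairs; this is a coordinate space of dimension `n (n + 1) / 2`, with its Lebesgue measure. -/
abbrev SymMat (n : ℕ) : Type := Sym2 (Fin n) → ℝ

variable {ω : LinearMap.BilinForm ℝ V} {n : ℕ}

/-- The vectors `e_i + ∑ j, A_ij f_j`. -/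
def graphVec (β : SymplecticBasis ω n) (A : SymMat n) (i : Fin n) : V :=
  β.basis (.inl i) + ∑ j, A s(i, j) • β.basis (.inr j)

theorem graphVec_pairing (β : SymplecticBasis ω n) (A : SymMat n) (i : Fin n) (v : V) :
    ω (graphVec β A i) v =
      β.basis.repr v (.inr i) - ∑ j, A s(i, j) * β.basis.repr v (.inl j) := by
  have key : ∀ c : Fin n ⊕ Fin n → ℝ, ω (graphVec β A i) (∑ k, c k • β.basis k) =
      c (.inr i) - ∑ j, A s(i, j) * c (.inl j) := by
    intro c
    simp [graphVec, β.ee, β.ff, β.ef, β.fe, Fintype.sum_sum_type, sub_eq_add_neg, add_comm,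
      mul_comm]
  have h := key (β.basis.repr v)
  rwa [β.basis.sum_repr v] at h

theorem graph_lagrangian (β : SymplecticBasis ω n) (A : SymMat n) :
    ω.orthogonal (Submodule.span ℝ (Set.range (graphVec β A))) =
      Submodule.span ℝ (Set.range (graphVec β A)) := by
  have hr : ∀ k i, β.basis.repr (graphVec β A k) (.inr i) = A s(k, i) := by
    intro k i
    simp [graphVec, Finsupp.single_apply]
  have hl : ∀ k i, β.basis.repr (graphVec β A k) (.inl i) = if k = i then 1 else 0 := by
    intro k i
    simp [graphVec, Finsupp.single_apply]
  apply le_antisymm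
  · intro v hv
    have h : ∀ i, β.basis.repr v (.inr i) = ∑ j, A s(i, j) * β.basis.repr v (.inl j) := by
      intro i
      have := hv _ (Submodule.subset_span ⟨i, rfl⟩)
      change ω (graphVec β A i) v = 0 at this
      rw [graphVec_pairing] at this
      linarith
    have hv' : v = ∑ i, β.basis.repr v (.inl i) • graphVec β A i := by
      apply β.basis.repr.injective
      ext (i | i)
      · simp [hl, Finsupp.finsetSum_apply]
      · simp only [map_sum, map_smul, Finsupp.finsetSum_apply, Finsupp.smul_apply, hr, h i,
          smul_eq_mul]
        exact Finset.sum_congr rfl fun j _ => by rw [Sym2.eq_swap, mul_comm]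
    rw [hv']
    exact Submodule.sum_mem _ fun i _ =>
      Submodule.smul_mem _ _ (Submodule.subset_span ⟨i, rfl⟩)
  · rw [Submodule.span_le]
    rintro _ ⟨k, rfl⟩ w hw
    change ω w (graphVec β A k) = 0
    induction hw using Submodule.span_induction with
    | mem x hx =>
      obtain ⟨i, rfl⟩ := hx
      rw [graphVec_pairing]
      simp [hr, hl, Sym2.eq_swap]
    | zero => simp
    | add x y _ _ hx hy => simp [hx, hy]
    | smul c x _ hx => simp [hx]

/-- The coordinate parametrization of `Λ(V)` attached to a canonical basis: `A` is sent to the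
graph of `e_i ↦ ∑ j, A_ij f_j`, a lagrangian subspace transversal to the span of the `f_j`.  These
maps, for all canonical bases, are the inverses of the charts of the manifold `Λ(V)`. -/
def lagChart (β : SymplecticBasis ω n) (A : SymMat n) : LagGr ω :=
  ⟨Submodule.span ℝ (Set.range (graphVec β A)), graph_lagrangian β A⟩

/-- The chart inverse to `lagChart β` (with junk values outside the range of `lagChart β`). -/
def lagCoord (β : SymplecticBasis ω n) : LagGr ω → SymMat n :=
  Function.invFun (lagChart β)

/-- The Jacobian `|det|` of the coordinate change from the chart of `β` to that of `β'`. -/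
def lagJacobian (β β' : SymplecticBasis ω n) (A : SymMat n) : ℝ :=
  |(fderiv ℝ (fun A => lagCoord β' (lagChart β A)) A).det|

end LagrangianGrassmannian

/-! ### Half-densities on `Q`, the Schrödinger representation, pure symplectic spinors -/

section Spinors

variable {V : Type*} [NormedAddCommGroup V] [NormedSpace ℝ V] [FiniteDimensional ℝ V]

/-- Compactly supported smooth half-densities on the `n`-dimensional vector space `Q`. -/
abbrev TestHalfDensity (n : ℕ) (Q : Submodule ℝ V) : Type _ :=
  𝓓((⊤ : TopologicalSpace.Opens Q), Density n (1 / 2) Q)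

/-- Distributional half-densities on `Q`: the topological dual of the test half-densities. -/
abbrev DistHalfDensity (n : ℕ) (Q : Submodule ℝ V) : Type _ :=
  TestHalfDensity n Q →L[ℂ] ℂ

/-- The distributional half-density `θ` is the half-density `h`, i.e. `θ g = ∫_Q h g`. The integral
of the density `h g` over `Q` is computed with respect to a basis of `Q`. -/
def IsRepresentedBy [MeasurableSpace V] [BorelSpace V] {n : ℕ} {Q : Submodule ℝ V}
    (θ : DistHalfDensity n Q) (h : Q → Density n (1 / 2) Q) : Prop :=
  ∀ (b : Basis (Fin n) ℝ Q) (g : TestHalfDensity n Q),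
    θ g = ∫ x : Q, (h x) b * (g x) b ∂b.addHaar

variable {ω : LinearMap.BilinForm ℝ V} {n : ℕ}

/-- Multiplication of test half-densities on `Q` by the linear function `x ↦ ω(x, l)`. -/
def mulLinear (ω : LinearMap.BilinForm ℝ V) (n : ℕ) (Q : Submodule ℝ V) (l : V) :
    TestHalfDensity n Q →ₗ[ℂ] TestHalfDensity n Q where
  toFun g :=
    { toFun := fun x => ω x l • g x
      contDiff' := by
        have h : ContDiff ℝ (⊤ : ℕ∞) (fun x : Q => ω x l) :=
          ((LinearMap.flip ω l).comp Q.subtype).toContinuousLinearMap.contDiff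
        exact h.smul g.contDiff
      hasCompactSupport' := g.hasCompactSupport.smul_left
      tsupport_subset' := fun _ _ => trivial }
  map_add' f g := by
    ext x : 1
    change ω x l • (f x + g x) = ω x l • f x + ω x l • g x
    rw [smul_add]
  map_smul' c f := by
    ext x : 1
    change ω x l • (c • f x) = c • (ω x l • f x)
    rw [smul_comm]

/-- The transpose, acting on test half-densities, of the Schrödinger operator `σ(u)`. Write
`u = q + l` with `q ∈ Q` and `l ∈ L₀`. Then `σ(u) = -i ∂_q + ω(·, l)`, whose transpose is
`i ∂_q + ω(·, l)`. -/
def schrodingerTranspose {L₀ Q : LagGr ω} (hQ : IsCompl Q.1 L₀.1) (n : ℕ) (u : V) :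
    TestHalfDensity n Q.1 →ₗ[ℂ] TestHalfDensity n Q.1 :=
  Complex.I • (TestFunction.lineDerivCLM ℂ (Q.1.projectionOnto L₀.1 hQ u) :
      TestHalfDensity n Q.1 →L[ℂ] TestHalfDensity n Q.1).toLinearMap +
    mulLinear ω n Q.1 (L₀.1.projectionOnto Q.1 hQ.symm u : V)

/-- The fibre `E_L` of pure symplectic spinors: the distributional half-densities `θ` on `Q` with
`σ(u) θ = 0` for all `u ∈ L`. -/
def pureSpinors {L₀ Q : LagGr ω} (hQ : IsCompl Q.1 L₀.1) (n : ℕ) (L : LagGr ω) :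
    Submodule ℂ (DistHalfDensity n Q.1) where
  carrier := {θ | ∀ u ∈ L.1, ∀ g, θ (schrodingerTranspose hQ n u g) = 0}
  zero_mem' := fun u _ g => rfl
  add_mem' := fun {θ η} hθ hη u hu g => by
    simp only [_root_.add_apply, hθ u hu g, hη u hu g, add_zero]
  smul_mem' := fun c θ hθ u hu g => by
    simp only [_root_.smul_apply, hθ u hu g, smul_zero]

/-- A local smooth frame of the line bundle `E → Λ`, written in a canonical chart of `Λ`: a nowhere
vanishing section `e` of `E` over an open set of coordinates `U`, which is smooth as a map to the
distributional half-densities, in the sense that all pairings with a test half-density are smooth.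
(The values of `e` outside `U` are irrelevant.) -/
structure SpinorFrame {L₀ Q : LagGr ω} (hQ : IsCompl Q.1 L₀.1) (n : ℕ) where
  β : SymplecticBasis ω n
  U : TopologicalSpace.Opens (SymMat n)
  e : ∀ A : SymMat n, pureSpinors hQ n (lagChart β A)
  ne_zero : ∀ A ∈ U, e A ≠ 0
  smooth : ∀ g : TestHalfDensity n Q.1,
    ContDiffOn ℝ (⊤ : ℕ∞) (fun A => (e A : DistHalfDensity n Q.1) g) U

/-- The value line `|V / L₀|^{1/2}`. -/
abbrev ValueLine (L₀ : LagGr ω) (n : ℕ) : Type _ := Density n (1 / 2) (V ⧸ L₀.1)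

/-- The identification `|Q|^{1/2} ≅ |V / L₀|^{1/2}`. -/
def toValueLine {L₀ Q : LagGr ω} (hQ : IsCompl Q.1 L₀.1) (n : ℕ) :
    Density n (1 / 2) Q.1 →ₗ[ℂ] ValueLine L₀ n :=
  Density.map (Submodule.quotientEquivOfIsCompl L₀.1 Q.1 hQ.symm).symm

/-- `v` is the value `θ(0)`: `θ` is a smooth half-density `h`, and `v` is `h(0)`, seen in
`|V / L₀|^{1/2}`. -/
def HasValueAtZero [MeasurableSpace V] [BorelSpace V] {L₀ Q : LagGr ω} (hQ : IsCompl Q.1 L₀.1)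
    (θ : DistHalfDensity n Q.1) (v : ValueLine L₀ n) : Prop :=
  ∃ h : Q.1 → Density n (1 / 2) Q.1, ContDiff ℝ (⊤ : ℕ∞) h ∧ IsRepresentedBy θ h ∧
    toValueLine hQ n (h 0) = v

/-- Arbitrary (set-theoretic) sections of `E* ⊗ |V / L₀|^{1/2}` over `Λ`. -/
abbrev DualSpinorSection {L₀ Q : LagGr ω} (hQ : IsCompl Q.1 L₀.1) (n : ℕ) : Type _ :=
  ∀ L : LagGr ω, pureSpinors hQ n L →ₗ[ℂ] ValueLine L₀ n

/-- The section `φ` is the evaluation `θ ↦ θ(0)` over the complement of the Maslov cycle (and is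
arbitrary over the Maslov cycle). -/
def IsEvaluationOffMaslov [MeasurableSpace V] [BorelSpace V] {L₀ Q : LagGr ω}
    {hQ : IsCompl Q.1 L₀.1} (φ : DualSpinorSection hQ n) : Prop :=
  ∀ L ∉ maslovCycle L₀, ∀ θ : pureSpinors hQ n L, HasValueAtZero hQ θ.1 (φ L θ)

/-- The section `φ` of `E* ⊗ |V / L₀|^{1/2}` written in a local frame. -/
def localRep {L₀ Q : LagGr ω} {hQ : IsCompl Q.1 L₀.1} (φ : DualSpinorSection hQ n)
    (τ : SpinorFrame hQ n) (A : SymMat n) : ValueLine L₀ n :=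
  φ (lagChart τ.β A) (τ.e A)

/-- Local integrability of a section of `E* ⊗ |V / L₀|^{1/2}`, in all charts and local frames. -/
def IsLocallyL1 {L₀ Q : LagGr ω} {hQ : IsCompl Q.1 L₀.1} (φ : DualSpinorSection hQ n) : Prop :=
  ∀ τ : SpinorFrame hQ n, LocallyIntegrableOn (localRep φ τ) τ.U volume

/-- The compactly supported sections `f ⊗ e ⊗ |dA|` and `f' ⊗ e' ⊗ |dA'|` of `E ⊗ |Λ|`, given in
two local frames, are equal. -/
def SameTestSection {L₀ Q : LagGr ω} {hQ : IsCompl Q.1 L₀.1} (τ τ' : SpinorFrame hQ n)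
    (f : 𝓓(τ.U, ℂ)) (f' : 𝓓(τ'.U, ℂ)) : Prop :=
  tsupport f ⊆ {A | lagChart τ.β A ∈ lagChart τ'.β '' τ'.U} ∧
  tsupport f' ⊆ {A' | lagChart τ'.β A' ∈ lagChart τ.β '' τ.U} ∧
  ∀ A ∈ τ.U, ∀ A' ∈ τ'.U, lagChart τ.β A = lagChart τ'.β A' →
    f A • (τ.e A : DistHalfDensity n Q.1) =
      ((lagJacobian τ.β τ'.β A : ℂ) * f' A') • (τ'.e A' : DistHalfDensity n Q.1)

/-- Distributional sections of `E* ⊗ |V / L₀|^{1/2}` over `Λ`: continuous linear functionals, with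
values in `|V / L₀|^{1/2}`, of the smooth sections of `E ⊗ |Λ|` with compact support in the domain
of a local frame; that is, distributions in all local trivializations, which transform correctly
under changes of chart and of frame. -/
structure DistSection {L₀ Q : LagGr ω} (hQ : IsCompl Q.1 L₀.1) (n : ℕ) where
  toFun : ∀ τ : SpinorFrame hQ n, 𝓓(τ.U, ℂ) →L[ℂ] ValueLine L₀ n
  compat : ∀ (τ τ' : SpinorFrame hQ n) (f : 𝓓(τ.U, ℂ)) (f' : 𝓓(τ'.U, ℂ)),
    SameTestSection τ τ' f f' → toFun τ f = toFun τ' f'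

/-- The distributional section `Φ` is integration against the section `φ`. -/
def DistSection.IsGivenBy {L₀ Q : LagGr ω} {hQ : IsCompl Q.1 L₀.1} (Φ : DistSection hQ n)
    (φ : DualSpinorSection hQ n) : Prop :=
  ∀ (τ : SpinorFrame hQ n) (f : 𝓓(τ.U, ℂ)),
    IntegrableOn (fun A => f A • localRep φ τ A) τ.U volume ∧
    Φ.toFun τ f = ∫ A in τ.U, f A • localRep φ τ A

/-- The set of the points of `Λ` near which `Φ` is not a smooth section. -/
def DistSection.singularSupport {L₀ Q : LagGr ω} {hQ : IsCompl Q.1 L₀.1}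
    (Φ : DistSection hQ n) : Set (LagGr ω) :=
  {L | ¬ ∃ τ : SpinorFrame hQ n, L ∈ lagChart τ.β '' τ.U ∧
    ∃ h : SymMat n → ValueLine L₀ n, ContDiffOn ℝ (⊤ : ℕ∞) h τ.U ∧
      ∀ f : 𝓓(τ.U, ℂ), Φ.toFun τ f = ∫ A in τ.U, f A • h A}

end Spinors

end

/-!
The coordinates on `Q` given by a basis, and the isomorphism of `V` with `ℝⁿ × ℝⁿ` which they
induce (`phaseCoord`), turn the equations of `E_L` into `θ (i ∂_q h + ⟨p, x⟩ h) = 0` for `(q, p)`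
in a lagrangian subspace `W` of `ℝⁿ × ℝⁿ`.

**Uniqueness.** Let `R` be the projection of `W` to the first factor. Then `W` is spanned by
`0 × Rᗮ` and by the graph over `R` of a symmetric map `S` (`IsLagrangianPair.exists_symmetric`).
Multiplication by `exp (i ⟨S x, x⟩ / 2)` transforms the equations into `x_i θ = 0` for some
coordinates and `∂_j θ = 0` for the others. A test function can be modified one coordinate at a
time by functions which are killed by all solutions, until it is a multiple of a fixed function
(`KilledBy.eliminate`, `KilledBy.exists_eq_mul`). Hence the space of solutions has dimension at
most one, and all linear functionals which solve the equations are continuous.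

**Existence and smoothness.** Let `gaussWave q p` be the translate of the Gaussian
`exp (-|x|² / 2)` by the Heisenberg operator of `(q, p)`, and average the pairings of a test
function with `gaussWave q p` over `(q, p) ∈ W` (`heisenbergAverage`). The operators `σ(u)`,
`u ∈ W`, act on these translates as derivatives along `W`, so that the average solves the equations
(`IsTest.heisenbergAverage_schrodinger`). Writing the test function as a Gaussian times a Fourier
integral of a Schwartz function `ρ` turns the average into an absolutely convergent integral of
`ρ ξ` times a Gaussian in `(q, p)`, wherever `W` lies (`wavePairing_eq`). All derivatives with
respect to the entries of the matrix `A` of `W` in a canonical chart are dominated, and the average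
is smooth in `A` (`IsTest.contDiff_heisenbergAverage`). It is not zero: on test functions
approximating `exp (-|x|² / 2)` it tends to a positive multiple of the mass of a Gaussian over `W`
(`exists_heisenbergAverage_ne_zero`). Thus the averages form a smooth frame of `E` over each
canonical chart (`exists_averageSpinor`).

**Evaluation.** Parametrize `W` by `t ↦ (q t, p t)`. Off the Maslov cycle `q` is invertible, and
the average is the function `c exp (-i ⟨p q⁻¹ x, x⟩ / 2)` (`heisenbergAverage_eq`), whose value at
`0` is the amplitude `c`. Pairing with `exp (-|x|² / 2)` gives the exact relation
`|c|² |det q| = π ^ (n / 2) ∫ exp (-(|p t|² + |q t|²) / 4) dt` (`norm_phaseConst_sq`), where the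
right side is bounded above, and locally bounded below by a positive constant. The Maslov cycle is
`det q = 0`, and `|c|` is comparable to `|det q| ^ (-1/2)`.

**Integrability.** For suitable indices `i ∈ T`, the `f_i`, `i ∈ T`, and the `e_i`, `i ∉ T`, of the
canonical basis span a complement of `L₀` (`exists_det_rowVec_ne_zero`). The polynomial `det q` is
affine in each diagonal entry of `A`; taking the coefficients of `A_ii`, `i ∈ T`, one after the
other ends with a nonzero constant. Since the integral of `|α a + β| ^ (-1/2)` over a bounded
interval is at most a constant times `|α| ^ (-1/2)`, the function `|det q| ^ (-1/2)` is locally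
integrable (`lintegral_maslovDet_rpow_ne_top`). In particular the Maslov cycle has measure zero.

**The distributional section.** The pairings with a locally integrable section are compatible with
changes of charts and frames by the change of variables formula (`integral_localRep_eq`). The
section is not almost everywhere equal to a continuous one near a point of the Maslov cycle,
because `|c|` blows up there, and the complement of the cycle is dense (`not_ae_eq_continuousOn`).
-/

/-! ### Division and integration of test functions -/

/-- Integrals over a line of a smooth compactly supported integrand, with a locally integrable
weight `w`, depend smoothly on parameters; this is the smoothness of convolutions with a
parameter, evaluated at `0`. -/
theorem contDiffOn_integral_of_compact {P : Type*} [NormedAddCommGroup P] [NormedSpace ℝ P]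
    {F : P → ℝ → ℂ} (hF : ContDiff ℝ (⊤ : ℕ∞) (Function.uncurry F)) {w : ℝ → ℝ}
    (hw : LocallyIntegrable w) {s : Set P} (hs : IsOpen s) {k : Set ℝ} (hk : IsCompact k)
    (h0 : ∀ p t, p ∈ s → t ∉ k → F p t = 0) :
    ContDiffOn ℝ (⊤ : ℕ∞) (fun p => ∫ t, w t • F p t) s := by
  have h := contDiffOn_convolution_right_with_param_comp (μ := volume) (n := ⊤)
    (ContinuousLinearMap.lsmul ℝ ℝ (E := ℂ)) (v := fun _ : P => (0 : ℝ)) (s := s)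
    contDiffOn_const (f := w) (g := fun p t => F p (-t)) (k := -k) hs hk.neg
    (fun p x hp hx => h0 p (-x) hp (by simpa using hx)) hw
    (by
      refine ContDiff.contDiffOn ?_
      exact hF.comp (contDiff_fst.prodMk contDiff_snd.neg))
  simpa [convolution] using h

theorem contDiff_integral_zero_one {P : Type*} [NormedAddCommGroup P] [NormedSpace ℝ P]
    {F : P → ℝ → ℂ} (hF : ContDiff ℝ (⊤ : ℕ∞) (Function.uncurry F)) :
    ContDiff ℝ (⊤ : ℕ∞) (fun p => ∫ t in (0 : ℝ)..1, F p t) := by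
  let χ : ContDiffBump (0 : ℝ) := ⟨1, 2, one_pos, one_lt_two⟩
  have h := contDiffOn_integral_of_compact (F := fun p t => (χ t) • F p t)
    (w := Set.indicator (Set.Ioc 0 1) 1) (s := Set.univ) (k := Metric.closedBall 0 2)
    ((χ.contDiff.comp contDiff_snd).smul hF) ?_ isOpen_univ (isCompact_closedBall _ _) ?_
  · rw [contDiffOn_univ] at h
    convert h using 2 with p
    rw [intervalIntegral.integral_of_le zero_le_one, ← integral_indicator measurableSet_Ioc]
    congr 1
    ext t
    by_cases ht : t ∈ Set.Ioc (0 : ℝ) 1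
    · have : χ t = 1 := χ.one_of_mem_closedBall (by
        rw [mem_closedBall_zero_iff, Real.norm_eq_abs, abs_le]
        exact ⟨by linarith [ht.1], ht.2⟩)
      simp [ht, this]
    · simp [ht]
  · exact (locallyIntegrable_const (1 : ℝ)).indicator measurableSet_Ioc
  · intro p t _ ht
    have : χ t = 0 := χ.zero_of_le_dist (by
      simpa using (not_le.1 (fun h => ht (by simpa using h))).le)
    simp [this]

section

variable {E : Type*} [NormedAddCommGroup E] [NormedSpace ℝ E]

/-- Smooth functions with compact support. -/
def IsTest (f : E → ℂ) : Prop := ContDiff ℝ (⊤ : ℕ∞) f ∧ HasCompactSupport f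

/-- Hadamard's lemma: a test function vanishing on a hyperplane is divisible by its equation. -/
theorem IsTest.exists_eq_mul {f : E → ℂ} (hf : IsTest f) (l : E →L[ℝ] ℝ) (v : E) (hv : l v = 1)
    (h0 : ∀ x, l x = 0 → f x = 0) : ∃ h : E → ℂ, IsTest h ∧ ∀ x, f x = l x * h x := by
  have hd : ContDiff ℝ (⊤ : ℕ∞) (fun x => fderiv ℝ f x v) :=
    (hf.1.fderiv_right (by simp)).clm_apply contDiff_const
  -- Integrate the derivative of `f` along the segment from the projection of `x` to the hyperplane,
  -- in the direction `v`, to `x`.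
  let h : E → ℂ := fun x => ∫ t in (0 : ℝ)..1, fderiv ℝ f (x - ((1 - t) * l x) • v) v
  have hsm : ContDiff ℝ (⊤ : ℕ∞) h := by
    apply contDiff_integral_zero_one (F := fun x t => fderiv ℝ f (x - ((1 - t) * l x) • v) v)
    exact hd.comp (contDiff_fst.sub ((((contDiff_const.sub contDiff_snd).mul
      (l.contDiff.comp contDiff_fst))).smul contDiff_const))
  have hmul : ∀ x, f x = l x * h x := by
    intro x
    have hder : ∀ t : ℝ, HasDerivAt (fun t : ℝ => f (x - ((1 - t) * l x) • v))
        (l x • fderiv ℝ f (x - ((1 - t) * l x) • v) v) t := by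
      intro t
      have h1 : HasDerivAt (fun t : ℝ => x - ((1 - t) * l x) • v) (l x • v) t := by
        have := (((hasDerivAt_id t).const_sub 1).mul_const (l x)).smul_const v |>.const_sub x
        simpa using this
      have h2 := ((hf.1.differentiable (by simp)) (x - ((1 - t) * l x) • v)).hasFDerivAt
      have h3 := h2.comp_hasDerivAt t h1
      simpa [Function.comp_def] using! h3
    have hc : Continuous fun t : ℝ => l x • fderiv ℝ f (x - ((1 - t) * l x) • v) v := by
      have : Continuous fun t : ℝ => x - ((1 - t) * l x) • v := by fun_prop
      exact (hd.continuous.comp this).const_smul (l x)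
    have := intervalIntegral.integral_eq_sub_of_hasDerivAt (a := 0) (b := 1)
      (fun t _ => hder t) (hc.intervalIntegrable _ _)
    rw [intervalIntegral.integral_smul] at this
    have hz : f (x - ((1 - 0) * l x) • v) = 0 := h0 _ (by simp [hv])
    rw [hz] at this
    simpa [h] using this.symm
  refine ⟨h, ⟨hsm, ?_⟩, hmul⟩
  refine HasCompactSupport.intro hf.2 fun x hx => ?_
  by_cases hl : l x = 0
  · have h1 : fderiv ℝ f x = 0 := by
      by_contra hne
      exact hx (tsupport_fderiv_subset ℝ (subset_tsupport _ hne))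
    simp [h, hl, h1]
  · have h1 : f x = 0 := image_eq_zero_of_notMem_tsupport hx
    have h2 := hmul x
    rw [h1] at h2
    exact (mul_eq_zero.1 h2.symm).resolve_left (by exact_mod_cast hl)

/-- A test function whose integrals along all lines of direction `v` vanish is the derivative along
`v` of a test function. -/
theorem IsTest.exists_eq_fderiv [FiniteDimensional ℝ E] {f : E → ℂ} (hf : IsTest f) (v : E)
    (hv : v ≠ 0) (h0 : ∀ x, ∫ t : ℝ, f (x + t • v) = 0) :
    ∃ h : E → ℂ, IsTest h ∧ ∀ x, f x = fderiv ℝ h x v := by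
  obtain ⟨r, hr⟩ := hf.2.isCompact.isBounded.subset_closedBall (0 : E)
  have hf0 : ∀ x, r < ‖x‖ → f x = 0 := fun x hx =>
    image_eq_zero_of_notMem_tsupport fun h => by
      have := hr h; simp at this; linarith
  have hvn : 0 < ‖v‖ := norm_pos_iff.2 hv
  have hline : ∀ x (t : ℝ), (r + ‖x‖) / ‖v‖ < |t| → f (x + t • v) = 0 := by
    intro x t ht
    apply hf0
    rw [div_lt_iff₀ hvn] at ht
    have := norm_sub_norm_le (t • v) (-x)
    rw [norm_smul, Real.norm_eq_abs, norm_neg, sub_neg_eq_add, add_comm] at this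
    linarith
  have hcont : ∀ x, Continuous fun t : ℝ => f (x + t • v) := fun x =>
    hf.1.continuous.comp (by fun_prop)
  have hint : ∀ x, Integrable fun t : ℝ => f (x + t • v) := by
    intro x
    refine (hcont x).integrable_of_hasCompactSupport ?_
    refine HasCompactSupport.intro (isCompact_closedBall (0 : ℝ) ((r + ‖x‖) / ‖v‖)) fun t ht => ?_
    exact hline x t (by simpa using ht)
  -- The primitive of `f` along the lines of direction `v`, vanishing far in the direction `-v`.
  let h : E → ℂ := fun x => ∫ t in Set.Iic (0 : ℝ), f (x + t • v)
  have hform : h = fun x => ∫ t : ℝ, (Set.indicator (Set.Iic (0 : ℝ)) (1 : ℝ → ℝ) t) •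
      f (x + t • v) := by
    ext x
    simp only [h]
    rw [← integral_indicator measurableSet_Iic]
    congr 1
    ext t
    by_cases ht : t ∈ Set.Iic (0 : ℝ) <;> simp [ht]
  have hsm : ContDiff ℝ (⊤ : ℕ∞) h := by
    rw [contDiff_iff_contDiffAt]
    intro x₀
    have := contDiffOn_integral_of_compact (F := fun x t => f (x + t • v))
      (w := Set.indicator (Set.Iic (0 : ℝ)) 1) (s := Metric.ball 0 (‖x₀‖ + 1))
      (k := Metric.closedBall 0 ((r + (‖x₀‖ + 1)) / ‖v‖))
      (hf.1.comp (contDiff_fst.add (contDiff_snd.smul contDiff_const))) ?_ Metric.isOpen_ball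
      (isCompact_closedBall _ _) ?_
    · rw [hform]
      exact this.contDiffAt (Metric.isOpen_ball.mem_nhds (by simp))
    · exact (locallyIntegrable_const (1 : ℝ)).indicator measurableSet_Iic
    · intro x t hx ht
      refine hline x t (lt_of_le_of_lt ?_ (by simpa using ht))
      have : ‖x‖ < ‖x₀‖ + 1 := by simpa using hx
      gcongr
  have hshift : ∀ x (s : ℝ), h (x + s • v) = ∫ t in Set.Iic s, f (x + t • v) := by
    intro x s
    have := integral_add_right_eq_self (μ := volume)
      (Set.indicator (Set.Iic s) fun t : ℝ => f (x + t • v)) s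
    rw [integral_indicator measurableSet_Iic] at this
    rw [← this]
    simp only [h]
    rw [← integral_indicator measurableSet_Iic]
    congr 1
    ext t
    by_cases ht : t ≤ 0
    · simp [ht, add_smul, add_assoc, add_comm]
    · simp [ht]
  refine ⟨h, ⟨hsm, ?_⟩, fun x => ?_⟩
  · refine HasCompactSupport.intro (isCompact_closedBall (0 : E) r) fun x hx => ?_
    -- If `h x ≠ 0`, then `f` does not vanish identically on either of the half-lines from `x`,
    -- since its integral along the whole line is zero; hence `x` lies between two points of the
    -- ball.
    by_contra hne
    apply hx
    have h1 : ∃ t ≤ (0 : ℝ), f (x + t • v) ≠ 0 := by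
      by_contra! hc
      exact hne (setIntegral_eq_zero_of_forall_eq_zero hc)
    have h2 : ∃ t > (0 : ℝ), f (x + t • v) ≠ 0 := by
      by_contra! hc
      have e1 := integral_add_compl (measurableSet_Iic (a := (0 : ℝ))) (hint x)
      rw [h0 x, Set.compl_Iic, setIntegral_eq_zero_of_forall_eq_zero (t := Set.Ioi 0)
        (fun t ht => hc t ht), add_zero] at e1
      exact hne e1
    obtain ⟨t, ht, ht'⟩ := h1
    obtain ⟨u, hu, hu'⟩ := h2
    have m1 : x + t • v ∈ Metric.closedBall (0 : E) r := by
      by_contra hh; exact ht' (hf0 _ (by simpa using hh))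
    have m2 : x + u • v ∈ Metric.closedBall (0 : E) r := by
      by_contra hh; exact hu' (hf0 _ (by simpa using hh))
    have hut : 0 < u - t := by linarith
    have := (convex_closedBall (0 : E) r) m1 m2 (a := u / (u - t)) (b := -t / (u - t))
      (by positivity) (div_nonneg (by linarith) hut.le) (by field_simp; ring)
    convert this using 1
    have e1 : u / (u - t) + -t / (u - t) = 1 := by field_simp; ring
    have e2 : u / (u - t) * t + -t / (u - t) * u = 0 := by field_simp; ring
    calc x = (u / (u - t) + -t / (u - t)) • x + (u / (u - t) * t + -t / (u - t) * u) • v := by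
            rw [e1, e2]; simp
      _ = _ := by module
  · have h1 : HasDerivAt (fun s : ℝ => h (x + s • v)) (f x) 0 := by
      have e : (fun s : ℝ => h (x + s • v)) =
          fun s => (∫ t in Set.Iic (0 : ℝ), f (x + t • v)) + ∫ t in (0 : ℝ)..s, f (x + t • v) := by
        ext s
        rw [hshift, ← intervalIntegral.integral_Iic_sub_Iic (hint x).integrableOn
          (hint x).integrableOn]
        ring
      rw [e]
      have := (intervalIntegral.integral_hasDerivAt_right
        ((hcont x).intervalIntegrable 0 0) ((hcont x).stronglyMeasurableAtFilter _ _)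
        (hcont x).continuousAt).const_add (∫ t in Set.Iic (0 : ℝ), f (x + t • v))
      simpa using this
    have h2 := ((hsm.differentiable (by simp)) x).hasFDerivAt.hasLineDerivAt v
    exact h1.unique h2

end

/-! ### Functionals killed by coordinates and by derivatives -/

section

variable {E : Type*} [NormedAddCommGroup E] [NormedSpace ℝ E]
  {ι : Type*} [Fintype ι] (e : Basis ι ℝ E)

/-- Linear functionals killed, on test functions, by the coordinates `x_i`, `i ∈ I`, and by the
derivatives `∂_j`, `j ∉ I`, with respect to the basis `e`. -/
structure KilledBy (I : Set ι) (θ : (E → ℂ) →ₗ[ℂ] ℂ) : Prop where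
  coord : ∀ i ∈ I, ∀ h, IsTest h → θ (fun x => (e.repr x i : ℂ) * h x) = 0
  deriv : ∀ j ∉ I, ∀ h, IsTest h → θ (fun x => fderiv ℝ h x (e j)) = 0

theorem contDiff_repr (i : ι) : ContDiff ℝ (⊤ : ℕ∞) fun x : E => e.repr x i := by
  have : FiniteDimensional ℝ E := Module.Basis.finiteDimensional_of_finite e
  exact (e.coord i).toContinuousLinearMap.contDiff

theorem isCompact_box (R : ℝ) : IsCompact {x : E | ∀ i, |e.repr x i| ≤ R} := by
  have : FiniteDimensional ℝ E := Module.Basis.finiteDimensional_of_finite e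
  have h1 : IsCompact (Set.pi Set.univ fun _ : ι => Set.Icc (-R) R) :=
    isCompact_univ_pi fun _ => isCompact_Icc
  have h2 := h1.image e.equivFunL.symm.continuous
  convert h2 using 1
  ext x
  constructor
  · intro hx
    exact ⟨e.equivFunL x, fun i _ => abs_le.1 (hx i), by simp⟩
  · rintro ⟨y, hy, rfl⟩ i
    have : e.repr (e.equivFunL.symm y) i = y i := by
      change e.equivFun (e.equivFun.symm y) i = y i
      rw [LinearEquiv.apply_symm_apply]
    rw [this]
    exact abs_le.2 (hy i trivial)

/-- Elimination of one coordinate. The function `m` does not depend on the coordinates in `S`, and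
multiplies the fixed functions `ψ i` of these coordinates; its dependence on `x_j` is replaced by
`ψ j`, without changing the values of the functionals. -/
theorem KilledBy.eliminate [DecidableEq ι] {I : Set ι} {ψ : ι → ℝ → ℂ}
    (hψ : ∀ i, ContDiff ℝ (⊤ : ℕ∞) (ψ i))
    (hsupp : ∀ i t, 1 < |t| → ψ i t = 0) (hI : ∀ i ∈ I, ψ i 0 = 1)
    (hJ : ∀ i ∉ I, ∫ t, ψ i t = 1) (S : Finset ι) (j : ι) (hj : j ∉ S) {R M : ℝ} (hR : 0 ≤ R)
    (hM : 0 ≤ M) {m : E → ℂ} (hm : ContDiff ℝ (⊤ : ℕ∞) m)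
    (hinv : ∀ i ∈ S, ∀ x (t : ℝ), m (x + t • e i) = m x)
    (hms : ∀ x, m x ≠ 0 → ∀ i ∉ S, |e.repr x i| ≤ R) (hmb : ∀ x, ‖m x‖ ≤ M) :
    ∃ m' : E → ℂ, ContDiff ℝ (⊤ : ℕ∞) m' ∧
      (∀ i ∈ insert j S, ∀ x (t : ℝ), m' (x + t • e i) = m' x) ∧
      (∀ x, m' x ≠ 0 → ∀ i ∉ insert j S, |e.repr x i| ≤ R) ∧
      (∀ x, ‖m' x‖ ≤ (1 + 2 * R) * M) ∧
      ∀ θ : (E → ℂ) →ₗ[ℂ] ℂ, KilledBy e I θ →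
        θ (fun x => (∏ i ∈ S, ψ i (e.repr x i)) * m x) =
          θ (fun x => (∏ i ∈ insert j S, ψ i (e.repr x i)) * m' x) := by
  have : FiniteDimensional ℝ E := Module.Basis.finiteDimensional_of_finite e
  have hrep : ∀ x (t : ℝ) i k, e.repr (x + t • e i) k = e.repr x k + if k = i then t else 0 := by
    intro x t i k
    by_cases h : k = i
    · simp [h]
    · simp [h]
  have htest : ∀ (S : Finset ι) (m : E → ℂ), ContDiff ℝ (⊤ : ℕ∞) m →
      (∀ x, m x ≠ 0 → ∀ i ∉ S, |e.repr x i| ≤ R) →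
      IsTest (fun x => (∏ i ∈ S, ψ i (e.repr x i)) * m x) := by
    intro S m hm hms
    refine ⟨(contDiff_prod fun i _ => (hψ i).comp (contDiff_repr e i)).mul hm, ?_⟩
    refine HasCompactSupport.intro (isCompact_box e (max 1 R)) fun x hx => ?_
    simp only [Set.mem_ofPred_eq, not_forall, not_le, max_lt_iff] at hx
    obtain ⟨i, hi1, hi2⟩ := hx
    by_cases hiS : i ∈ S
    · rw [Finset.prod_eq_zero hiS (hsupp i _ hi1), zero_mul]
    · by_cases h0 : m x = 0
      · rw [h0, mul_zero]
      · exact absurd (hms x h0 i hiS) (not_le.2 hi2)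
  have hsub : ∀ {f g : E → ℂ} (θ : (E → ℂ) →ₗ[ℂ] ℂ), θ (fun x => f x - g x) = 0 → θ f = θ g := by
    intro f g θ h
    have : (fun x => f x - g x) = f - g := rfl
    rw [this, map_sub, sub_eq_zero] at h
    exact h
  by_cases hjI : j ∈ I
  -- A coordinate in `I`: the functionals only see the restriction of `m` to `x_j = 0`.
  · have hm's : ContDiff ℝ (⊤ : ℕ∞) fun x => m (x - e.repr x j • e j) :=
      hm.comp (contDiff_id.sub ((contDiff_repr e j).smul contDiff_const))
    have hm'b : ∀ x, m (x - e.repr x j • e j) ≠ 0 → ∀ i ∉ insert j S, |e.repr x i| ≤ R := by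
      intro x hx i hi
      rw [Finset.mem_insert, not_or] at hi
      have := hms _ hx i hi.2
      rw [sub_eq_add_neg, ← neg_smul, hrep] at this
      simpa [hi.1] using this
    refine ⟨fun x => m (x - e.repr x j • e j), hm's, ?_, hm'b, ?_, ?_⟩
    · intro i hi x t
      by_cases hij : i = j
      · subst hij
        simp only [hrep, if_pos]
        congr 1
        module
      · have hiS : i ∈ S := (Finset.mem_insert.1 hi).resolve_left hij
        beta_reduce
        rw [← hinv i hiS (x - e.repr x j • e j) t]
        simp only [hrep, if_neg (Ne.symm hij), add_zero]
        congr 1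
        abel
    · intro x
      refine (hmb _).trans ?_
      nlinarith
    · intro θ hθ
      apply hsub
      have ht : IsTest fun x => (∏ i ∈ S, ψ i (e.repr x i)) * m x -
          (∏ i ∈ insert j S, ψ i (e.repr x i)) * m (x - e.repr x j • e j) :=
        ⟨(htest S m hm hms).1.sub (htest _ _ hm's hm'b).1,
          (htest S m hm hms).2.sub (htest _ _ hm's hm'b).2⟩
      obtain ⟨h, hh, heq⟩ := ht.exists_eq_mul (e.coord j).toContinuousLinearMap (e j) (by simp)
        (by
          intro x hx
          have hx' : e.repr x j = 0 := hx
          rw [Finset.prod_insert hj, hx', hI j hjI]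
          simp)
      rw [funext heq]
      exact hθ.coord j hjI h hh
  -- A coordinate outside `I`: the functionals only see the integral of `m` over `x_j`.
  · have hm0 : ∀ x (t : ℝ), R < |e.repr x j + t| → m (x + t • e j) = 0 := by
      intro x t ht
      by_contra h
      have := hms _ h j hj
      rw [hrep] at this
      simp only [if_pos] at this
      linarith
    let m' : E → ℂ := fun x => ∫ t : ℝ, m (x + t • e j)
    have hinv' : ∀ x (t : ℝ), m' (x + t • e j) = m' x := by
      intro x t
      simp only [m']
      rw [← integral_add_left_eq_self (fun s : ℝ => m (x + s • e j)) t]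
      congr 1
      ext s
      congr 1
      module
    have hm's : ContDiff ℝ (⊤ : ℕ∞) m' := by
      rw [contDiff_iff_contDiffAt]
      intro x₀
      have hop : IsOpen {x : E | |e.repr x j| < |e.repr x₀ j| + 1} :=
        isOpen_lt (continuous_abs.comp (contDiff_repr e j).continuous) continuous_const
      have := contDiffOn_integral_of_compact (F := fun x t => m (x + t • e j)) (w := fun _ => 1)
        (hm.comp (contDiff_fst.add (contDiff_snd.smul contDiff_const))) (locallyIntegrable_const 1)
        hop (isCompact_closedBall (0 : ℝ) (R + (|e.repr x₀ j| + 1))) (by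
          intro x t hx ht
          apply hm0
          have hx' : |e.repr x j| < |e.repr x₀ j| + 1 := hx
          have ht' : R + (|e.repr x₀ j| + 1) < |t| := by simpa using ht
          have := abs_sub_abs_le_abs_sub t (-e.repr x j)
          rw [abs_neg, sub_neg_eq_add, add_comm t] at this
          linarith)
      simp only [one_smul] at this
      exact this.contDiffAt (hop.mem_nhds (by simp))
    have hm'b : ∀ x, m' x ≠ 0 → ∀ i ∉ insert j S, |e.repr x i| ≤ R := by
      intro x hx i hi
      rw [Finset.mem_insert, not_or] at hi
      by_contra hlt
      apply hx
      have : ∀ t : ℝ, m (x + t • e j) = 0 := by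
        intro t
        by_contra h
        have := hms _ h i hi.2
        rw [hrep] at this
        simp only [if_neg hi.1, add_zero] at this
        exact hlt this
      simp [m', this]
    refine ⟨m', hm's, ?_, hm'b, ?_, ?_⟩
    · intro i hi x t
      by_cases hij : i = j
      · subst hij; exact hinv' x t
      · have hiS : i ∈ S := (Finset.mem_insert.1 hi).resolve_left hij
        simp only [m']
        congr 1
        ext s
        rw [← hinv i hiS (x + s • e j) t]
        congr 1
        abel
    · intro x
      have h1 : m' x = ∫ t in Set.Icc (-e.repr x j - R) (-e.repr x j + R), m (x + t • e j) := by
        rw [setIntegral_eq_integral_of_forall_compl_eq_zero]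
        intro t ht
        apply hm0
        by_contra hle
        rw [not_lt, abs_le] at hle
        exact ht ⟨by linarith [hle.1], by linarith [hle.2]⟩
      rw [h1]
      refine (norm_setIntegral_le_of_norm_le_const (by simp) fun t _ => hmb _).trans ?_
      rw [Real.volume_real_Icc_of_le (by linarith)]
      nlinarith
    · intro θ hθ
      apply hsub
      have ht : IsTest fun x => (∏ i ∈ S, ψ i (e.repr x i)) * m x -
          (∏ i ∈ insert j S, ψ i (e.repr x i)) * m' x :=
        ⟨(htest S m hm hms).1.sub (htest _ _ hm's hm'b).1,
          (htest S m hm hms).2.sub (htest _ _ hm's hm'b).2⟩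
      obtain ⟨h, hh, heq⟩ := ht.exists_eq_fderiv (e j) (e.ne_zero j) (by
        intro x
        have hP : ∀ t : ℝ, ∏ i ∈ S, ψ i (e.repr (x + t • e j) i) = ∏ i ∈ S, ψ i (e.repr x i) := by
          intro t
          refine Finset.prod_congr rfl fun i hi => ?_
          rw [hrep, if_neg (ne_of_mem_of_not_mem hi hj), add_zero]
        have e1 : ∀ t : ℝ, (∏ i ∈ S, ψ i (e.repr (x + t • e j) i)) * m (x + t • e j) -
            (∏ i ∈ insert j S, ψ i (e.repr (x + t • e j) i)) * m' (x + t • e j) =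
            (∏ i ∈ S, ψ i (e.repr x i)) * m (x + t • e j) -
            ((∏ i ∈ S, ψ i (e.repr x i)) * m' x) * ψ j (e.repr x j + t) := by
          intro t
          rw [Finset.prod_insert hj, hP, hinv', hrep, if_pos rfl]
          ring
        simp_rw [e1]
        rw [integral_sub, integral_const_mul, integral_const_mul,
          integral_add_left_eq_self (fun t => ψ j t), hJ j hjI]
        · simp [m']
        · refine Integrable.const_mul (Continuous.integrable_of_hasCompactSupport
            (hm.continuous.comp (by fun_prop)) ?_) _
          refine HasCompactSupport.intro (isCompact_closedBall (-e.repr x j) R) fun t ht => ?_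
          apply hm0
          simpa [Real.dist_eq, add_comm] using ht
        · refine Integrable.const_mul (Continuous.integrable_of_hasCompactSupport
            ((hψ j).continuous.comp (by fun_prop)) ?_) _
          refine HasCompactSupport.intro (isCompact_closedBall (-e.repr x j) 1) fun t ht => ?_
          apply hsupp
          simpa [Real.dist_eq, add_comm] using ht)
      rw [funext heq]
      exact hθ.deriv j hjI h hh

/-- The functionals killed by the coordinates in `I` and the derivatives outside `I` form a space of
dimension at most one, and are bounded by the supremum norm on functions of fixed support. -/
theorem KilledBy.exists_eq_mul (I : Set ι) : ∃ g₀ : E → ℂ, IsTest g₀ ∧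
    ∀ R : ℝ, ∃ C : ℝ, 0 ≤ C ∧ ∀ f : E → ℂ, ContDiff ℝ (⊤ : ℕ∞) f →
      (∀ x, f x ≠ 0 → ∀ i, |e.repr x i| ≤ R) → ∀ M : ℝ, 0 ≤ M → (∀ x, ‖f x‖ ≤ M) →
      ∃ c : ℂ, ‖c‖ ≤ C * M ∧ ∀ θ : (E → ℂ) →ₗ[ℂ] ℂ, KilledBy e I θ → θ f = c * θ g₀ := by
  classical
  have : FiniteDimensional ℝ E := Module.Basis.finiteDimensional_of_finite e
  let χ : ContDiffBump (0 : ℝ) := ⟨1 / 2, 1, by norm_num, by norm_num⟩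
  let ψ : ι → ℝ → ℂ := fun i t => if i ∈ I then (χ t : ℂ) else (χ.normed volume t : ℂ)
  have hψ : ∀ i, ContDiff ℝ (⊤ : ℕ∞) (ψ i) := by
    intro i
    by_cases hi : i ∈ I
    · simp only [ψ, if_pos hi]
      exact Complex.ofRealCLM.contDiff.comp χ.contDiff
    · simp only [ψ, if_neg hi]
      exact Complex.ofRealCLM.contDiff.comp χ.contDiff_normed
  have hsupp : ∀ i t, 1 < |t| → ψ i t = 0 := by
    intro i t ht
    have h0 : χ t = 0 := χ.zero_of_le_dist (by simpa using ht.le)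
    simp [ψ, h0, ContDiffBump.normed_def]
  have hI : ∀ i ∈ I, ψ i 0 = 1 := by
    intro i hi
    have : χ 0 = 1 := χ.one_of_mem_closedBall (by simp [χ])
    simp [ψ, hi, this]
  have hJ : ∀ i ∉ I, ∫ t, ψ i t = 1 := by
    intro i hi
    simp only [ψ, if_neg hi]
    rw [integral_complex_ofReal, χ.integral_normed, Complex.ofReal_one]
  have hg₀ : IsTest fun x => ∏ i, ψ i (e.repr x i) := by
    refine ⟨contDiff_prod fun i _ => (hψ i).comp (contDiff_repr e i), ?_⟩
    refine HasCompactSupport.intro (isCompact_box e 1) fun x hx => ?_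
    simp only [Set.mem_ofPred_eq, not_forall, not_le] at hx
    obtain ⟨i, hi⟩ := hx
    exact Finset.prod_eq_zero (Finset.mem_univ i) (hsupp i _ hi)
  refine ⟨_, hg₀, fun R => ⟨(1 + 2 * |R|) ^ Fintype.card ι, by positivity, ?_⟩⟩
  intro f hf hfs M hM hfb
  have key : ∀ S : Finset ι, ∃ m : E → ℂ, ContDiff ℝ (⊤ : ℕ∞) m ∧
      (∀ i ∈ S, ∀ x (t : ℝ), m (x + t • e i) = m x) ∧
      (∀ x, m x ≠ 0 → ∀ i ∉ S, |e.repr x i| ≤ |R|) ∧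
      (∀ x, ‖m x‖ ≤ (1 + 2 * |R|) ^ S.card * M) ∧
      ∀ θ : (E → ℂ) →ₗ[ℂ] ℂ, KilledBy e I θ →
        θ f = θ (fun x => (∏ i ∈ S, ψ i (e.repr x i)) * m x) := by
    intro S
    induction S using Finset.induction_on with
    | empty =>
      exact ⟨f, hf, by simp, fun x hx i _ => (hfs x hx i).trans (le_abs_self R), by simpa using hfb,
        fun θ _ => by simp⟩
    | insert j S hj ih =>
      obtain ⟨m, h1, h2, h3, h4, h5⟩ := ih
      obtain ⟨m', h1', h2', h3', h4', h5'⟩ := KilledBy.eliminate e hψ hsupp hI hJ S j hj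
        (abs_nonneg R) (by positivity) h1 h2 h3 h4
      refine ⟨m', h1', h2', h3', fun x => (h4' x).trans_eq ?_, fun θ hθ => (h5 θ hθ).trans ?_⟩
      · rw [Finset.card_insert_of_notMem hj]; ring
      · exact h5' θ hθ
  obtain ⟨m, -, h2, -, h4, h5⟩ := key Finset.univ
  have hconst : ∀ x, m x = m 0 := by
    have : ∀ (S : Finset ι) (c : ι → ℝ), m (∑ i ∈ S, c i • e i) = m 0 := by
      intro S c
      induction S using Finset.induction_on with
      | empty => simp
      | insert j S hj ih => rw [Finset.sum_insert hj, add_comm, h2 j (Finset.mem_univ _), ih]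
    intro x
    rw [← this Finset.univ (e.repr x), e.sum_repr]
  refine ⟨m 0, by simpa using h4 0, fun θ hθ => ?_⟩
  rw [h5 θ hθ, ← smul_eq_mul, ← map_smul]
  congr 1
  ext x
  simp [hconst x, mul_comm]

end

/-! ### Smooth dependence of integrals on parameters -/

section

variable {P T G : Type*} [NormedAddCommGroup P] [NormedSpace ℝ P] [NormedAddCommGroup T]
  [NormedSpace ℝ T] [NormedAddCommGroup G] [NormedSpace ℝ G]

theorem iteratedFDeriv_partial {F : P × T → G} (hF : ContDiff ℝ (⊤ : ℕ∞) F) (k : ℕ) (x : P)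
    (t : T) : iteratedFDeriv ℝ k (fun y => F (y, t)) x =
      (iteratedFDeriv ℝ k F (x, t)).compContinuousLinearMap
        fun _ => ContinuousLinearMap.inl ℝ P T := by
  have h1 : (fun y => F (y, t)) = (fun z => F (z + (0, t))) ∘ ContinuousLinearMap.inl ℝ P T := by
    ext y; simp
  have h2 : ContDiff ℝ (⊤ : ℕ∞) fun z => F (z + (0, t)) :=
    hF.comp (contDiff_id.add contDiff_const)
  rw [h1, ContinuousLinearMap.iteratedFDeriv_comp_right _ h2 x
    (by exact_mod_cast le_top), iteratedFDeriv_comp_add_right]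
  simp

theorem continuous_iteratedFDeriv_partial {F : P × T → G} (hF : ContDiff ℝ (⊤ : ℕ∞) F) (k : ℕ) :
    Continuous fun z : P × T => iteratedFDeriv ℝ k (fun y => F (y, z.2)) z.1 := by
  simp_rw [iteratedFDeriv_partial hF]
  exact (ContinuousMultilinearMap.compContinuousLinearMapL
    fun _ => ContinuousLinearMap.inl ℝ P T).continuous.comp
      (hF.continuous_iteratedFDeriv (by exact_mod_cast le_top))

/-- Differentiation under the integral sign to all orders: a smooth integrand all of whose
derivatives in the parameter are locally dominated has a smooth integral. -/
theorem contDiff_integral_of_dominated [FiniteDimensional ℝ T] [MeasurableSpace T] [BorelSpace T]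
    {μ : Measure T} {F : P × T → G} (hF : ContDiff ℝ (⊤ : ℕ∞) F)
    (hb : ∀ (k : ℕ) (x₀ : P), ∃ s ∈ nhds x₀, ∃ b : T → ℝ, Integrable b μ ∧
      ∀ x ∈ s, ∀ t, ‖iteratedFDeriv ℝ k (fun y => F (y, t)) x‖ ≤ b t) :
    ContDiff ℝ (⊤ : ℕ∞) fun x => ∫ t, F (x, t) ∂μ := by
  by_cases hG : CompleteSpace G
  swap
  · have : (fun x => ∫ t, F (x, t) ∂μ) = fun _ => 0 := by ext x; simp [integral, hG]
    rw [this]; exact contDiff_const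
  have := FiniteDimensional.proper ℝ T
  have hmeas : ∀ k x, AEStronglyMeasurable (fun t => iteratedFDeriv ℝ k (fun y => F (y, t)) x) μ :=
    fun k x => ((continuous_iteratedFDeriv_partial hF k).comp
      (Continuous.prodMk_right x)).aestronglyMeasurable
  have hint : ∀ k x, Integrable (fun t => iteratedFDeriv ℝ k (fun y => F (y, t)) x) μ := by
    intro k x
    obtain ⟨s, hs, b, hbi, hbb⟩ := hb k x
    exact hbi.mono' (hmeas k x) (Filter.Eventually.of_forall (hbb x (mem_of_mem_nhds hs)))
  have hs : ∀ t, ContDiff ℝ (⊤ : ℕ∞) fun y => F (y, t) := fun t =>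
    hF.comp (contDiff_id.prodMk contDiff_const)
  have hder : ∀ k x, HasFDerivAt (fun y => ∫ t, iteratedFDeriv ℝ k (fun y => F (y, t)) y ∂μ)
      (∫ t, iteratedFDeriv ℝ (k + 1) (fun y => F (y, t)) x ∂μ).curryLeft x := by
    intro k x
    obtain ⟨s, hs', b, hbi, hbb⟩ := hb (k + 1) x
    have e : ∀ y t, fderiv ℝ (iteratedFDeriv ℝ k fun y => F (y, t)) y =
        (continuousMultilinearCurryLeftEquiv ℝ (fun _ : Fin (k + 1) => P) G)
          (iteratedFDeriv ℝ (k + 1) (fun y => F (y, t)) y) := by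
      intro y t
      rw [fderiv_iteratedFDeriv]
      simp
    have h := hasFDerivAt_integral_of_dominated_of_fderiv_le (𝕜 := ℝ) (μ := μ) (bound := b)
      (F := fun y t => iteratedFDeriv ℝ k (fun y => F (y, t)) y)
      (F' := fun y t => fderiv ℝ (iteratedFDeriv ℝ k fun y => F (y, t)) y) (x₀ := x) hs'
      (Filter.Eventually.of_forall fun y => hmeas k y) (hint k x) ?_ ?_ hbi ?_
    · have heq : (∫ t, iteratedFDeriv ℝ (k + 1) (fun y => F (y, t)) x ∂μ).curryLeft =
          ∫ t, fderiv ℝ (iteratedFDeriv ℝ k fun y => F (y, t)) x ∂μ := by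
        simp_rw [e]
        let L : (P [×(k + 1)]→L[ℝ] G) →L[ℝ] (P →L[ℝ] P [×k]→L[ℝ] G) :=
          (continuousMultilinearCurryLeftEquiv ℝ (fun _ : Fin (k + 1) => P)
            G).toContinuousLinearEquiv.toContinuousLinearMap
        exact (ContinuousLinearMap.integral_comp_comm (𝕜 := ℝ) (E := P [×(k + 1)]→L[ℝ] G)
          (Fₗ := P →L[ℝ] P [×k]→L[ℝ] G) L (hint (k + 1) x)).symm
      rw [heq]
      exact h
    · simp_rw [e]
      exact (LinearIsometryEquiv.continuous _).comp_aestronglyMeasurable (hmeas (k + 1) x)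
    · refine Filter.Eventually.of_forall fun t y hy => ?_
      rw [e, LinearIsometryEquiv.norm_map]
      exact hbb y hy t
    · refine Filter.Eventually.of_forall fun t y hy => ?_
      exact (((hs t).differentiable_iteratedFDeriv
        (by exact_mod_cast ENat.natCast_lt_top k)) y).hasFDerivAt
  refine HasFTaylorSeriesUpTo.contDiff
    (f' := fun x k => ∫ t, iteratedFDeriv ℝ k (fun y => F (y, t)) x ∂μ) ⟨?_, ?_, ?_⟩
  · intro x
    have := (continuousMultilinearCurryFin0 ℝ P G).toContinuousLinearEquiv.integral_comp_comm
      (fun t => iteratedFDeriv ℝ 0 (fun y => F (y, t)) x) (μ := μ)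
    simpa [continuousMultilinearCurryFin0] using! this.symm
  · intro k _ x
    exact hder k x
  · intro k _
    rw [continuous_iff_continuousAt]
    exact fun x => (hder k x).continuousAt

end

/-! ### Gaussian estimates -/

/-- The derivatives are taken over `ℝ`; all of them are `exp z` times a multilinear map of norm at
most one. -/
theorem norm_iteratedFDeriv_cexp_le (k : ℕ) (z : ℂ) :
    ‖iteratedFDeriv ℝ k Complex.exp z‖ ≤ Real.exp z.re := by
  induction k with
  | zero => simp [Complex.norm_exp]
  | succ k ih =>
    rw [← norm_iteratedFDeriv_fderiv]
    let L : ℂ →L[ℝ] (ℂ →L[ℝ] ℂ) := (ContinuousLinearMap.mul ℝ ℂ)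
    have e : fderiv ℝ Complex.exp = fun z => L (Complex.exp z) := by
      ext z : 1
      have h := ((Complex.hasDerivAt_exp z).hasFDerivAt.restrictScalars ℝ).fderiv
      rw [h]
      ext w
      simp [L, mul_comm]
    rw [e]
    have hc : ContDiffAt ℝ (⊤ : ℕ∞) Complex.exp z := Complex.contDiff_exp.contDiffAt
    have h1 : ‖L‖ ≤ 1 := ContinuousLinearMap.opNorm_mul_le ℝ ℂ
    calc _ ≤ ‖L‖ * ‖iteratedFDeriv ℝ k Complex.exp z‖ :=
          L.norm_iteratedFDeriv_comp_left hc (by exact_mod_cast le_top)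
      _ ≤ 1 * ‖iteratedFDeriv ℝ k Complex.exp z‖ := by gcongr
      _ ≤ _ := by rw [one_mul]; exact ih

/-- Bounds for the derivatives of the exponential of a quadratic form along an affine map. -/
theorem exists_norm_iteratedFDeriv_cexp_quadratic_le {P W : Type*} [NormedAddCommGroup P]
    [NormedSpace ℝ P] [NormedAddCommGroup W] [NormedSpace ℝ W] (B : W →L[ℝ] W →L[ℝ] ℂ) :
    ∃ b : ℝ, 0 ≤ b ∧ ∀ (w₀ : W) (l : P →L[ℝ] W) (k : ℕ) (x : P) (Y : ℝ), 1 ≤ Y →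
      ‖w₀ + l x‖ ≤ Y → ‖l‖ ≤ Y →
      ‖iteratedFDeriv ℝ k (fun y => Complex.exp (B (w₀ + l y) (w₀ + l y))) x‖ ≤
        k.factorial * Real.exp (B (w₀ + l x) (w₀ + l x)).re * (b * Y ^ 2) ^ k := by
  refine ⟨(‖B‖ + 1) * 2, by positivity, fun w₀ l k x Y hY hw hl => ?_⟩
  have hs : ContDiff ℝ (⊤ : ℕ∞) fun y => w₀ + l y := contDiff_const.add l.contDiff
  have hd : ∀ i, ‖iteratedFDeriv ℝ i (fun y => w₀ + l y) x‖ ≤ Y := by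
    intro i
    have hf : fderiv ℝ (fun y => w₀ + l y) = fun _ => l := by
      ext y : 1
      simp
    match i with
    | 0 => simpa using hw
    | 1 => rw [← norm_iteratedFDeriv_fderiv, hf]; simpa using hl
    | i + 2 =>
      rw [← norm_iteratedFDeriv_fderiv, hf, iteratedFDeriv_const_of_ne (by omega)]
      simp; linarith
  have h := norm_iteratedFDeriv_comp_le (g := Complex.exp)
    (f := fun y => B (w₀ + l y) (w₀ + l y)) (n := k) (N := (⊤ : ℕ∞)) Complex.contDiff_exp
    ((B.contDiff.comp hs).clm_apply hs) (by exact_mod_cast le_top) x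
    (C := Real.exp (B (w₀ + l x) (w₀ + l x)).re) (D := (‖B‖ + 1) * 2 * Y ^ 2)
    (fun i _ => norm_iteratedFDeriv_cexp_le i _) ?_
  · exact h
  · intro i hi _
    have hY2 : 1 ≤ Y ^ 2 := one_le_pow₀ hY
    calc _ ≤ ‖B‖ * ∑ j ∈ Finset.range (i + 1), (i.choose j : ℝ) *
          ‖iteratedFDeriv ℝ j (fun y => w₀ + l y) x‖ *
          ‖iteratedFDeriv ℝ (i - j) (fun y => w₀ + l y) x‖ :=
          B.norm_iteratedFDeriv_le_of_bilinear hs hs x (by exact_mod_cast le_top)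
      _ ≤ ‖B‖ * ∑ j ∈ Finset.range (i + 1), (i.choose j : ℝ) * Y * Y := by
          gcongr <;> exact hd _
      _ = ‖B‖ * 2 ^ i * Y ^ 2 := by
          rw [← Finset.sum_mul, ← Finset.sum_mul]
          have := Nat.sum_range_choose i
          have h2 : ∑ j ∈ Finset.range (i + 1), (i.choose j : ℝ) = 2 ^ i := by exact_mod_cast this
          rw [h2]; ring
      _ ≤ (‖B‖ + 1) ^ i * 2 ^ i * (Y ^ 2) ^ i := by
          have h1 : ‖B‖ ≤ (‖B‖ + 1) ^ i :=
            (by linarith : ‖B‖ ≤ ‖B‖ + 1).trans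
              (le_self_pow₀ (by linarith [norm_nonneg B]) (by omega))
          have h2 : Y ^ 2 ≤ (Y ^ 2) ^ i := le_self_pow₀ hY2 (by omega)
          gcongr
      _ = _ := by rw [mul_pow, mul_pow]

theorem exists_exp_neg_sq_le (N : ℕ) :
    ∃ C : ℝ, 0 ≤ C ∧ ∀ r : ℝ, 0 ≤ r → Real.exp (-(r ^ 2 / 4)) * (1 + r) ^ N ≤ C := by
  refine ⟨(N.factorial : ℝ) * Real.exp 2, by positivity, fun r hr => ?_⟩
  have h1 : (1 + r) ^ N ≤ N.factorial * Real.exp (1 + r) := by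
    have := Real.pow_div_factorial_le_exp (1 + r) (by positivity) N
    rw [div_le_iff₀ (by positivity)] at this
    linarith
  calc _ ≤ Real.exp (-(r ^ 2 / 4)) * (N.factorial * Real.exp (1 + r)) := by gcongr
    _ = N.factorial * Real.exp (-(r ^ 2 / 4) + (1 + r)) := by
        rw [Real.exp_add (-(r ^ 2 / 4)) (1 + r)]
        ring
    _ ≤ _ := by
        gcongr
        nlinarith [sq_nonneg (r - 2)]

/-! ### Pairing with Heisenberg translates of a Gaussian -/

section

variable {X : Type*} [NormedAddCommGroup X] [InnerProductSpace ℝ X]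

/-- The translate of the Gaussian `exp (-|x|² / 2)` by the Heisenberg operator of the vector
`(q, p)` of `X × X`. -/
noncomputable def gaussWave (q p x : X) : ℂ :=
  Complex.exp (Complex.I * (inner ℝ p x + inner ℝ p q / 2 : ℝ) - (‖x + q‖ ^ 2 / 2 : ℝ))

/-- The Fourier transform of `gaussWave q p x * exp (-|x|² / 2)` at `-η`, up to a constant. -/
noncomputable def gaussKernel (q p η : X) : ℂ :=
  Complex.exp (-((‖p + η‖ ^ 2 + ‖q‖ ^ 2) / 4 : ℝ) - Complex.I * (inner ℝ η q / 2 : ℝ))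

theorem norm_gaussWave (q p x : X) : ‖gaussWave q p x‖ = Real.exp (-(‖x + q‖ ^ 2 / 2)) := by
  rw [gaussWave, Complex.norm_exp]
  congr 1
  simp only [Complex.sub_re, Complex.mul_re, Complex.I_re, Complex.I_im, Complex.ofReal_re,
    Complex.ofReal_im]
  ring

theorem norm_gaussWave_le (q p x : X) : ‖gaussWave q p x‖ ≤ 1 := by
  rw [norm_gaussWave, Real.exp_le_one_iff]
  have := sq_nonneg ‖x + q‖
  linarith

theorem norm_gaussKernel (q p η : X) :
    ‖gaussKernel q p η‖ = Real.exp (-((‖p + η‖ ^ 2 + ‖q‖ ^ 2) / 4)) := by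
  rw [gaussKernel, Complex.norm_exp]
  congr 1
  simp only [Complex.sub_re, Complex.neg_re, Complex.mul_re, Complex.I_re, Complex.I_im,
    Complex.ofReal_re, Complex.ofReal_im]
  ring

theorem Continuous.gaussKernel {Y : Type*} [TopologicalSpace Y] {f g h : Y → X}
    (hf : Continuous f) (hg : Continuous g) (hh : Continuous h) :
    Continuous fun y => gaussKernel (f y) (g y) (h y) := by
  unfold _root_.gaussKernel
  fun_prop

theorem Continuous.gaussWave {Y : Type*} [TopologicalSpace Y] {f g h : Y → X}
    (hf : Continuous f) (hg : Continuous g) (hh : Continuous h) :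
    Continuous fun y => gaussWave (f y) (g y) (h y) := by
  unfold _root_.gaussWave
  fun_prop

theorem ContDiff.gaussKernel {Y : Type*} [NormedAddCommGroup Y] [NormedSpace ℝ Y] {f g h : Y → X}
    (hf : ContDiff ℝ (⊤ : ℕ∞) f) (hg : ContDiff ℝ (⊤ : ℕ∞) g) (hh : ContDiff ℝ (⊤ : ℕ∞) h) :
    ContDiff ℝ (⊤ : ℕ∞) fun y => gaussKernel (f y) (g y) (h y) := by
  unfold _root_.gaussKernel
  refine ContDiff.cexp (ContDiff.sub (ContDiff.neg ?_) (contDiff_const.mul ?_))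
  · exact Complex.ofRealCLM.contDiff.comp
      ((((hg.add hh).norm_sq ℝ).add (hf.norm_sq ℝ)).div_const 4)
  · exact Complex.ofRealCLM.contDiff.comp ((hh.inner ℝ hf).div_const 2)

/-- The Gaussian decay of `gaussKernel` in `(q, p)` beats polynomials, at the cost of powers of
`η`. -/
theorem exists_gaussKernel_le {c : ℝ} (hc : 0 ≤ c) (N : ℕ) : ∃ C : ℝ, 0 ≤ C ∧
    ∀ (t q p η : X), ‖t‖ ≤ c * (‖q‖ + ‖p‖) →
      ‖gaussKernel q p η‖ * (1 + ‖t‖) ^ N ≤ C * (1 + ‖η‖) ^ N := by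
  obtain ⟨C, hC, h⟩ := exists_exp_neg_sq_le N
  refine ⟨C * (1 + 2 * c) ^ N, by positivity, fun t q p η ht => ?_⟩
  rw [norm_gaussKernel]
  set r := Real.sqrt (‖p + η‖ ^ 2 + ‖q‖ ^ 2) with hr
  have hr2 : ‖p + η‖ ^ 2 + ‖q‖ ^ 2 = r ^ 2 := (Real.sq_sqrt (by positivity)).symm
  have hr0 : 0 ≤ r := Real.sqrt_nonneg _
  have hq : ‖q‖ ≤ r := Real.le_sqrt_of_sq_le (by nlinarith [sq_nonneg ‖p + η‖])
  have hp : ‖p + η‖ ≤ r := Real.le_sqrt_of_sq_le (by nlinarith [sq_nonneg ‖q‖])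
  have hp' : ‖p‖ ≤ r + ‖η‖ := by
    have := norm_sub_le (p + η) η
    rw [add_sub_cancel_right] at this
    linarith
  have h1 : 1 + ‖t‖ ≤ (1 + 2 * c) * (1 + r) * (1 + ‖η‖) := by
    have h2 : c * (‖q‖ + ‖p‖) ≤ c * (2 * r + ‖η‖) :=
      mul_le_mul_of_nonneg_left (by linarith) hc
    have := norm_nonneg η
    nlinarith [mul_nonneg hr0 this, mul_nonneg hc hr0, mul_nonneg hc this,
      mul_nonneg hc (mul_nonneg hr0 this)]
  rw [hr2]
  calc Real.exp (-(r ^ 2 / 4)) * (1 + ‖t‖) ^ N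
      ≤ Real.exp (-(r ^ 2 / 4)) * ((1 + 2 * c) * (1 + r) * (1 + ‖η‖)) ^ N := by gcongr
    _ = Real.exp (-(r ^ 2 / 4)) * (1 + r) ^ N * ((1 + 2 * c) ^ N * (1 + ‖η‖) ^ N) := by
        rw [mul_pow, mul_pow]; ring
    _ ≤ C * ((1 + 2 * c) ^ N * (1 + ‖η‖) ^ N) := by
        gcongr
        exact h r hr0
    _ = _ := by ring

open scoped SchwartzMap in
/-- The basic domination estimate for integrals over `(t, ξ)`: the factor `ρ ξ` absorbs the powers
of `ξ` lost in the Gaussian decay in `t`. -/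
theorem exists_schwartz_gaussKernel_le (ρ : 𝓢(X, ℂ)) {c : ℝ} (hc : 0 ≤ c) (m d : ℕ) :
    ∃ C : ℝ, 0 ≤ C ∧ ∀ (t q p ξ : X) (s : ℝ), ‖t‖ ≤ c * (‖q‖ + ‖p‖) → |s| ≤ 1 →
      ‖ρ ξ‖ * ‖gaussKernel q p ((2 * Real.pi * s) • ξ)‖ * (1 + ‖t‖ + ‖ξ‖) ^ m ≤
        C * (((1 + ‖t‖) ^ d)⁻¹ * ((1 + ‖ξ‖) ^ d)⁻¹) := by
  obtain ⟨C, hC, h⟩ := exists_gaussKernel_le (X := X) hc (m + d)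
  let C' := 2 ^ (m + d + m + d) * ((Finset.Iic (m + d + m + d, 0)).sup
    fun n => SchwartzMap.seminorm ℝ n.1 n.2) ρ
  have hC' : ∀ ξ, (1 + ‖ξ‖) ^ (m + d + m + d) * ‖ρ ξ‖ ≤ C' := by
    intro ξ
    have := SchwartzMap.one_add_le_sup_seminorm_apply (𝕜 := ℝ)
      (m := (m + d + m + d, 0)) le_rfl le_rfl ρ ξ
    simpa [C'] using this
  refine ⟨C * 8 ^ (m + d) * C', ?_, fun t q p ξ s ht hs => ?_⟩
  · have := (by positivity : (0 : ℝ) ≤ (1 + ‖(0 : X)‖) ^ (m + d + m + d) * ‖ρ 0‖).trans (hC' 0)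
    positivity
  have hη : 1 + ‖(2 * Real.pi * s) • ξ‖ ≤ 8 * (1 + ‖ξ‖) := by
    rw [norm_smul, Real.norm_eq_abs, abs_mul, abs_of_pos (by positivity)]
    have h3 : 2 * Real.pi * |s| ≤ 8 := by
      nlinarith [Real.pi_le_four, Real.pi_pos, abs_nonneg s]
    nlinarith [norm_nonneg ξ]
  have h1 := h t q p ((2 * Real.pi * s) • ξ) ht
  set g := ‖gaussKernel q p ((2 * Real.pi * s) • ξ)‖
  have hg : 0 ≤ g := norm_nonneg _
  have h2 : g * (1 + ‖t‖) ^ (m + d) ≤ C * (8 ^ (m + d) * (1 + ‖ξ‖) ^ (m + d)) := by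
    refine h1.trans ?_
    rw [← mul_pow]
    gcongr
  rw [← mul_inv, ← div_eq_mul_inv, le_div_iff₀ (by positivity)]
  have hsum : 1 + ‖t‖ + ‖ξ‖ ≤ (1 + ‖t‖) * (1 + ‖ξ‖) := by
    nlinarith [norm_nonneg t, norm_nonneg ξ, mul_nonneg (norm_nonneg t) (norm_nonneg ξ)]
  calc ‖ρ ξ‖ * g * (1 + ‖t‖ + ‖ξ‖) ^ m * ((1 + ‖t‖) ^ d * (1 + ‖ξ‖) ^ d)
      ≤ ‖ρ ξ‖ * g * ((1 + ‖t‖) * (1 + ‖ξ‖)) ^ m * ((1 + ‖t‖) ^ d * (1 + ‖ξ‖) ^ d) := by gcongr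
    _ = ‖ρ ξ‖ * (1 + ‖ξ‖) ^ (m + d) * (g * (1 + ‖t‖) ^ (m + d)) := by
        rw [mul_pow, pow_add, pow_add]; ring
    _ ≤ ‖ρ ξ‖ * (1 + ‖ξ‖) ^ (m + d) * (C * (8 ^ (m + d) * (1 + ‖ξ‖) ^ (m + d))) := by gcongr
    _ = C * 8 ^ (m + d) * ((1 + ‖ξ‖) ^ (m + d + m + d) * ‖ρ ξ‖) := by ring
    _ ≤ _ := by
        gcongr
        exact hC' ξ

/-- `gaussKernel` is the exponential of a quadratic form in all its variables. -/
theorem exists_gaussKernel_eq_cexp [FiniteDimensional ℝ X] :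
    ∃ B : (X × X × X) →L[ℝ] (X × X × X) →L[ℝ] ℂ, ∀ q p η : X,
      gaussKernel q p η = Complex.exp (B (q, p, η) (q, p, η)) := by
  let B : (X × X × X) →ₗ[ℝ] (X × X × X) →ₗ[ℝ] ℂ := LinearMap.mk₂ ℝ
    (fun w w' => -((inner ℝ (w.2.1 + w.2.2) (w'.2.1 + w'.2.2) + inner ℝ w.1 w'.1) / 4 : ℝ) -
      Complex.I * (inner ℝ w.2.2 w'.1 / 2 : ℝ))
    (fun w w' w'' => by simp [inner_add_left, inner_add_right]; ring)
    (fun c w w' => by simp [inner_add_left, inner_add_right, inner_smul_left]; ring)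
    (fun w w' w'' => by simp [inner_add_left, inner_add_right]; ring)
    (fun c w w' => by simp [inner_add_left, inner_add_right, inner_smul_right]; ring)
  refine ⟨LinearMap.toContinuousBilinearMap B, fun q p η => ?_⟩
  change _ = Complex.exp (-((inner ℝ (p + η) (p + η) + inner ℝ q q) / 4 : ℝ) -
      Complex.I * (inner ℝ η q / 2 : ℝ))
  rw [gaussKernel, real_inner_self_eq_norm_sq, real_inner_self_eq_norm_sq]

/-- The constant `π ^ (n / 2)`, for `n` the dimension of `X`. -/
noncomputable def gaussConst (X : Type*) [NormedAddCommGroup X] [InnerProductSpace ℝ X] : ℝ :=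
  Real.pi ^ (finrank ℝ X / 2 : ℝ)

theorem gaussConst_pos : 0 < gaussConst X := Real.rpow_pos_of_pos Real.pi_pos _

variable [FiniteDimensional ℝ X] [MeasurableSpace X] [BorelSpace X]

theorem integrable_inv_one_add_pow :
    Integrable fun z : X × X => ((1 + ‖z.1‖) ^ (finrank ℝ X + 1))⁻¹ *
      ((1 + ‖z.2‖) ^ (finrank ℝ X + 1))⁻¹ := by
  have h : Integrable fun x : X => ((1 + ‖x‖) ^ (finrank ℝ X + 1))⁻¹ := by
    have := integrable_one_add_norm (E := X) (μ := volume) (r := (finrank ℝ X + 1 : ℕ))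
      (by push_cast; linarith)
    refine this.congr (Filter.Eventually.of_forall fun x => ?_)
    simp only
    rw [Real.rpow_neg (by positivity), Real.rpow_natCast]
  exact h.mul_prod h

theorem integral_gaussWave (q p η : X) :
    ∫ x, Complex.exp (Complex.I * (inner ℝ η x : ℝ)) * ((Real.exp (-(‖x‖ ^ 2 / 2)) : ℝ) : ℂ) *
      gaussWave q p x = gaussConst X * gaussKernel q p η := by
  rw [← integral_sub_right_eq_self _ ((1 / 2 : ℝ) • q)]
  have h := GaussianFourier.integral_cexp_neg_mul_sq_norm_add (V := X) (b := 1) (by simp)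
    Complex.I (p + η)
  have e : ∀ v : X, Complex.exp (Complex.I * (inner ℝ η (v - (1 / 2 : ℝ) • q) : ℝ)) *
      ((Real.exp (-(‖v - (1 / 2 : ℝ) • q‖ ^ 2 / 2)) : ℝ) : ℂ) *
      gaussWave q p (v - (1 / 2 : ℝ) • q) =
      Complex.exp (-(‖q‖ ^ 2 / 4 : ℝ) - Complex.I * (inner ℝ η q / 2 : ℝ)) *
        Complex.exp (-1 * ‖v‖ ^ 2 + Complex.I * (inner ℝ (p + η) v : ℝ)) := by
    intro v
    rw [gaussWave, Complex.ofReal_exp, ← Complex.exp_add, ← Complex.exp_add, ← Complex.exp_add]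
    congr 1
    have h1 : ‖v - (1 / 2 : ℝ) • q‖ ^ 2 = ‖v‖ ^ 2 - inner ℝ v q + ‖q‖ ^ 2 / 4 := by
      rw [norm_sub_sq_real, inner_smul_right, norm_smul]
      norm_num
      ring
    have h2 : ‖v - (1 / 2 : ℝ) • q + q‖ ^ 2 = ‖v‖ ^ 2 + inner ℝ v q + ‖q‖ ^ 2 / 4 := by
      rw [show v - (1 / 2 : ℝ) • q + q = v + (1 / 2 : ℝ) • q by module, norm_add_sq_real,
        inner_smul_right, norm_smul]
      norm_num
      ring
    rw [h1, h2]
    simp only [inner_sub_right, inner_add_left, inner_smul_right]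
    push_cast
    ring
  simp_rw [e]
  rw [integral_const_mul, h, gaussConst, gaussKernel]
  rw [div_one, Complex.ofReal_cpow Real.pi_pos.le, mul_left_comm, ← Complex.exp_add]
  push_cast
  congr 2
  rw [Complex.I_sq]
  ring

/-- The pairing of `f` with `gaussWave q p`. -/
noncomputable def wavePairing (f : X → ℂ) (q p : X) : ℂ := ∫ x, f x * gaussWave q p x

theorem integrable_exp_neg_sq : Integrable fun x : X => Real.exp (-(‖x‖ ^ 2 / 2)) := by
  have h := GaussianFourier.integrable_cexp_neg_mul_sq_norm_add (V := X) (b := 1 / 2) (by simp)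
    0 0
  refine h.norm.congr (Filter.Eventually.of_forall fun x => ?_)
  simp only
  rw [Complex.norm_exp]
  congr 1
  have : (-(1 / 2 : ℂ) * (‖x‖ : ℂ) ^ 2 + 0 * ((inner ℝ (0 : X) x : ℝ) : ℂ)) =
    ((-(‖x‖ ^ 2 / 2) : ℝ) : ℂ) := by push_cast; ring
  rw [this, Complex.ofReal_re]

/-- For `f` the product of a Gaussian and of a Fourier integral, the pairing with `gaussWave` is an
integral of `gaussKernel`; this formula shows its decay. The factor `s` allows to rescale the
Fourier integral. -/
theorem wavePairing_eq {ρ : X → ℂ} (hρ : Integrable ρ) {f : X → ℂ} (s : ℝ)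
    (hf : ∀ x, f x = (∫ ξ, ρ ξ * Complex.exp (Complex.I * (inner ℝ ((2 * Real.pi * s) • ξ) x : ℝ)))
      * (Real.exp (-(‖x‖ ^ 2 / 2)) : ℝ)) (q p : X) :
    wavePairing f q p =
      gaussConst X * ∫ ξ, ρ ξ * gaussKernel q p ((2 * Real.pi * s) • ξ) := by
  have hint : Integrable (Function.uncurry fun (x ξ : X) =>
      ρ ξ * (Complex.exp (Complex.I * (inner ℝ ((2 * Real.pi * s) • ξ) x : ℝ)) *
        ((Real.exp (-(‖x‖ ^ 2 / 2)) : ℝ) : ℂ) * gaussWave q p x)) := by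
    have h1 := (integrable_exp_neg_sq (X := X)).mul_prod hρ.norm
    refine h1.mono' ?_ (Filter.Eventually.of_forall ?_)
    · refine (hρ.1.comp_snd).mul (Continuous.aestronglyMeasurable ?_)
      have : Continuous fun z : X × X => gaussWave q p z.1 :=
        continuous_const.gaussWave continuous_const continuous_fst
      fun_prop
    · rintro ⟨x, ξ⟩
      simp only [Function.uncurry]
      rw [norm_mul, norm_mul, norm_mul, mul_comm Complex.I, Complex.norm_exp_ofReal_mul_I, one_mul,
        Complex.norm_real, Real.norm_of_nonneg (Real.exp_nonneg _), mul_comm]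
      refine mul_le_mul_of_nonneg_right ?_ (norm_nonneg _)
      exact mul_le_of_le_one_right (Real.exp_nonneg _) (norm_gaussWave_le _ _ _)
  have e1 : wavePairing f q p = ∫ x, ∫ ξ,
      ρ ξ * (Complex.exp (Complex.I * (inner ℝ ((2 * Real.pi * s) • ξ) x : ℝ)) *
        ((Real.exp (-(‖x‖ ^ 2 / 2)) : ℝ) : ℂ) * gaussWave q p x) := by
    rw [wavePairing]
    congr 1
    ext x
    rw [hf, mul_assoc, ← integral_mul_const]
    congr 1
    ext ξ
    ring
  rw [e1, integral_integral_swap hint, ← integral_const_mul]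
  congr 1
  ext ξ
  rw [integral_const_mul, integral_gaussWave]
  ring

open scoped SchwartzMap FourierTransform in
/-- Every test function is the product of a Gaussian and of the Fourier integral of a Schwartz
function. -/
theorem IsTest.exists_schwartz {f : X → ℂ} (hf : IsTest f) : ∃ ρ : 𝓢(X, ℂ), ∀ x,
    f x = (∫ ξ, ρ ξ * Complex.exp (Complex.I * (inner ℝ ((2 * Real.pi * 1) • ξ) x : ℝ))) *
      (Real.exp (-(‖x‖ ^ 2 / 2)) : ℝ) := by
  let g : X → ℂ := fun x => f x * (Real.exp (‖x‖ ^ 2 / 2) : ℝ)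
  have hg1 : ContDiff ℝ (⊤ : ℕ∞) g :=
    hf.1.mul (Complex.ofRealCLM.contDiff.comp (((contDiff_norm_sq ℝ).div_const 2).exp))
  have hg2 : HasCompactSupport g := hf.2.mul_right
  let G : 𝓢(X, ℂ) := hg2.toSchwartzMap hg1
  refine ⟨𝓕 G, fun x => ?_⟩
  have h1 : 𝓕⁻ (𝓕 G) = G := FourierTransform.fourierInv_fourier_eq G
  have h2 : (𝓕⁻ (𝓕 G)) x = g x := by rw [h1]; rfl
  rw [SchwartzMap.fourierInv_coe, Real.fourierInv_eq'] at h2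
  have h3 : (∫ ξ, (𝓕 G) ξ * Complex.exp (Complex.I * (inner ℝ ((2 * Real.pi * 1) • ξ) x : ℝ))) =
      g x := by
    rw [← h2]
    congr 1
    ext ξ
    rw [smul_eq_mul, mul_comm, mul_comm Complex.I, inner_smul_left, mul_one]
    simp
  rw [h3]
  simp only [g]
  rw [mul_assoc, ← Complex.ofReal_mul, ← Real.exp_add]
  simp

end

/-! ### Averages over lagrangian families of Heisenberg translates -/

section

variable {X : Type*} [NormedAddCommGroup X] [InnerProductSpace ℝ X] [FiniteDimensional ℝ X]
  [MeasurableSpace X] [BorelSpace X]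

/-- The average of the pairings of `f` with the translates of a Gaussian by the vectors
`(q t, p t)` of a subspace of `X × X` parametrized by `t`. -/
noncomputable def heisenbergAverage (q p : X →L[ℝ] X) (f : X → ℂ) : ℂ :=
  ∫ t, wavePairing f (q t) (p t)

open scoped SchwartzMap in
/-- The hypothesis `hb` says that `t ↦ (q t, p t)` is injective, with a quantitative bound. -/
theorem integrable_schwartz_gaussKernel (ρ : 𝓢(X, ℂ)) {q p : X →L[ℝ] X} {c : ℝ} (hc : 0 ≤ c)
    (hb : ∀ t, ‖t‖ ≤ c * (‖q t‖ + ‖p t‖)) {s : ℝ} (hs : |s| ≤ 1) :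
    Integrable fun z : X × X => ρ z.2 * gaussKernel (q z.1) (p z.1) ((2 * Real.pi * s) • z.2) := by
  obtain ⟨C, hC, h⟩ := exists_schwartz_gaussKernel_le ρ hc 0 (finrank ℝ X + 1)
  refine ((integrable_inv_one_add_pow (X := X)).const_mul C).mono' ?_
    (Filter.Eventually.of_forall fun z => ?_)
  · refine Continuous.aestronglyMeasurable ?_
    refine (ρ.continuous.comp continuous_snd).mul (Continuous.gaussKernel ?_ ?_ ?_)
    all_goals fun_prop
  · have := h z.1 (q z.1) (p z.1) z.2 s (hb z.1) hs
    rw [pow_zero, mul_one] at this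
    rw [norm_mul]
    exact this

theorem IsTest.integrable {f : X → ℂ} (hf : IsTest f) : Integrable f :=
  hf.1.continuous.integrable_of_hasCompactSupport hf.2

theorem IsTest.integrable_wavePairing {f : X → ℂ} (hf : IsTest f) {q p : X →L[ℝ] X} {c : ℝ}
    (hc : 0 ≤ c) (hb : ∀ t, ‖t‖ ≤ c * (‖q t‖ + ‖p t‖)) :
    Integrable fun t => wavePairing f (q t) (p t) := by
  obtain ⟨ρ, hρ⟩ := hf.exists_schwartz
  simp_rw [wavePairing_eq ρ.integrable 1 hρ]
  exact ((integrable_schwartz_gaussKernel ρ hc hb (by simp)).integral_prod_left).const_mul _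

/-- The averages depend smoothly on the subspace. The bound `hb` is uniform in the parameter, and
does not involve the position of the subspaces with respect to `0 × X`: the averages are smooth also
where `q` degenerates. -/
theorem IsTest.contDiff_heisenbergAverage {P : Type*} [NormedAddCommGroup P] [NormedSpace ℝ P]
    {f : X → ℂ} (hf : IsTest f) (q₀ p₀ : X →L[ℝ] X) (q₁ p₁ : P →L[ℝ] X →L[ℝ] X) {c : ℝ}
    (hc : 0 ≤ c) (hb : ∀ A t, ‖t‖ ≤ c * (‖(q₀ + q₁ A) t‖ + ‖(p₀ + p₁ A) t‖)) :
    ContDiff ℝ (⊤ : ℕ∞) fun A => heisenbergAverage (q₀ + q₁ A) (p₀ + p₁ A) f := by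
  obtain ⟨ρ, hρ⟩ := hf.exists_schwartz
  let F : P × (X × X) → ℂ := fun z => ρ z.2.2 *
    gaussKernel ((q₀ + q₁ z.1) z.2.1) ((p₀ + p₁ z.1) z.2.1) ((2 * Real.pi * 1) • z.2.2)
  have hF : ContDiff ℝ (⊤ : ℕ∞) F := by
    have hq : ∀ (q₀ : X →L[ℝ] X) (q₁ : P →L[ℝ] X →L[ℝ] X), ContDiff ℝ (⊤ : ℕ∞)
        fun z : P × (X × X) => (q₀ + q₁ z.1) z.2.1 := fun q₀ q₁ =>
      (contDiff_const.add (q₁.contDiff.comp contDiff_fst)).clm_apply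
        (contDiff_fst.comp contDiff_snd)
    have hξ : ContDiff ℝ (⊤ : ℕ∞) fun z : P × (X × X) => z.2.2 :=
      contDiff_snd.comp contDiff_snd
    exact ((ρ.smooth _).comp hξ).mul ((hq q₀ q₁).gaussKernel (hq p₀ p₁)
      (contDiff_const.smul hξ))
  have hav : (fun A => heisenbergAverage (q₀ + q₁ A) (p₀ + p₁ A) f) =
      fun A => gaussConst X * ∫ z, F (A, z) := by
    ext A
    rw [heisenbergAverage]
    simp_rw [wavePairing_eq ρ.integrable 1 hρ]
    rw [integral_const_mul, Measure.volume_eq_prod, integral_prod _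
      (integrable_schwartz_gaussKernel ρ hc (hb A) (by simp))]
  rw [hav]
  refine contDiff_const.mul (contDiff_integral_of_dominated hF fun k A₀ => ?_)
  obtain ⟨B, hB⟩ := exists_gaussKernel_eq_cexp (X := X)
  obtain ⟨b, hb0, hbB⟩ := exists_norm_iteratedFDeriv_cexp_quadratic_le (P := P) B
  obtain ⟨C, hC, hest⟩ := exists_schwartz_gaussKernel_le ρ hc (2 * k) (finrank ℝ X + 1)
  let M : ℝ := ‖q₀‖ + ‖p₀‖ + (‖q₁‖ + ‖p₁‖) * (‖A₀‖ + 1) + 8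
  have hM : 8 ≤ M := by
    have : 0 ≤ ‖q₀‖ + ‖p₀‖ + (‖q₁‖ + ‖p₁‖) * (‖A₀‖ + 1) := by positivity
    linarith
  refine ⟨Metric.ball A₀ 1, Metric.ball_mem_nhds _ one_pos,
    fun z => (k.factorial * (b * M ^ 2) ^ k * C) *
      (((1 + ‖z.1‖) ^ (finrank ℝ X + 1))⁻¹ * ((1 + ‖z.2‖) ^ (finrank ℝ X + 1))⁻¹),
    (integrable_inv_one_add_pow (X := X)).const_mul _, ?_⟩
  rintro A hA ⟨t, ξ⟩
  have hA' : ‖A‖ ≤ ‖A₀‖ + 1 := by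
    have h1 := norm_sub_norm_le A A₀
    have h2 : ‖A - A₀‖ < 1 := by simpa [dist_eq_norm] using hA
    linarith
  -- The argument of the quadratic exponent is an affine function of the parameter.
  let w₀ : X × X × X := (q₀ t, p₀ t, (2 * Real.pi * 1) • ξ)
  let l : P →L[ℝ] X × X × X := (q₁.flip t).prod ((p₁.flip t).prod 0)
  have hform : (fun y => F (y, (t, ξ))) =
      fun y => ρ ξ • Complex.exp (B (w₀ + l y) (w₀ + l y)) := by
    ext y
    have : w₀ + l y = ((q₀ + q₁ y) t, (p₀ + p₁ y) t, (2 * Real.pi * 1) • ξ) := by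
      simp [w₀, l]
    rw [this, ← hB]
    rfl
  have hwA : w₀ + l A = ((q₀ + q₁ A) t, (p₀ + p₁ A) t, (2 * Real.pi * 1) • ξ) := by
    simp [w₀, l]
  have hop : ∀ (q₀ : X →L[ℝ] X) (q₁ : P →L[ℝ] X →L[ℝ] X),
      ‖(q₀ + q₁ A) t‖ ≤ (‖q₀‖ + ‖q₁‖ * (‖A₀‖ + 1)) * ‖t‖ := by
    intro q₀ q₁
    refine ((q₀ + q₁ A).le_opNorm t).trans ?_
    gcongr
    refine (norm_add_le _ _).trans ?_
    gcongr
    refine (q₁.le_opNorm A).trans ?_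
    gcongr
  have hY : 1 ≤ M * (1 + ‖t‖ + ‖ξ‖) := by nlinarith [norm_nonneg t, norm_nonneg ξ]
  have hw : ‖w₀ + l A‖ ≤ M * (1 + ‖t‖ + ‖ξ‖) := by
    rw [hwA]
    have n1 := norm_nonneg t
    have n2 := norm_nonneg ξ
    have n3 : 0 ≤ ‖q₀‖ + ‖q₁‖ * (‖A₀‖ + 1) := by positivity
    have n4 : 0 ≤ ‖p₀‖ + ‖p₁‖ * (‖A₀‖ + 1) := by positivity
    have hM' : M = (‖q₀‖ + ‖q₁‖ * (‖A₀‖ + 1)) + (‖p₀‖ + ‖p₁‖ * (‖A₀‖ + 1)) + 8 := by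
      simp only [M]; ring
    refine norm_prod_le_iff.2 ⟨?_, norm_prod_le_iff.2 ⟨?_, ?_⟩⟩
    · refine (hop q₀ q₁).trans (mul_le_mul ?_ (by linarith) n1 (by linarith))
      rw [hM']
      linarith
    · refine (hop p₀ p₁).trans (mul_le_mul ?_ (by linarith) n1 (by linarith))
      rw [hM']
      linarith
    · simp only [norm_smul, Real.norm_eq_abs]
      rw [mul_one, abs_of_pos (by positivity)]
      refine mul_le_mul ?_ (by linarith) n2 (by linarith)
      linarith [Real.pi_le_four]
  have hl : ‖l‖ ≤ M * (1 + ‖t‖ + ‖ξ‖) := by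
    have n1 := norm_nonneg t
    have n2 := norm_nonneg ξ
    refine l.opNorm_le_bound (by positivity) fun y => ?_
    have hy : ∀ q₁ : P →L[ℝ] X →L[ℝ] X, ‖q₁‖ ≤ M →
        ‖q₁ y t‖ ≤ M * (1 + ‖t‖ + ‖ξ‖) * ‖y‖ := by
      intro q₁ h
      refine ((q₁ y).le_opNorm t).trans ?_
      calc ‖q₁ y‖ * ‖t‖ ≤ (‖q₁‖ * ‖y‖) * ‖t‖ := by gcongr; exact q₁.le_opNorm y
        _ ≤ (M * ‖y‖) * (1 + ‖t‖ + ‖ξ‖) := by gcongr; linarith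
        _ = _ := by ring
    have k1 : 0 ≤ (‖q₁‖ + ‖p₁‖) * ‖A₀‖ := by positivity
    have k2 := norm_nonneg q₀
    have k3 := norm_nonneg p₀
    have k4 := norm_nonneg q₁
    have k5 := norm_nonneg p₁
    refine norm_prod_le_iff.2 ⟨hy q₁ ?_, norm_prod_le_iff.2 ⟨hy p₁ ?_, ?_⟩⟩
    · simp only [M]; linarith
    · simp only [M]; linarith
    · simp [l]; positivity
  rw [hform, iteratedFDeriv_const_smul_apply', norm_smul]
  swap
  · exact (Complex.contDiff_exp.comp ((B.contDiff.comp (contDiff_const.add l.contDiff)).clm_apply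
      (contDiff_const.add l.contDiff))).contDiffAt
  have h1 := hbB w₀ l k A _ hY hw hl
  have h2 := hest t ((q₀ + q₁ A) t) ((p₀ + p₁ A) t) ξ 1 (hb A t) (by simp)
  have h3 : ‖gaussKernel ((q₀ + q₁ A) t) ((p₀ + p₁ A) t) ((2 * Real.pi * 1) • ξ)‖ =
      Real.exp (B (w₀ + l A) (w₀ + l A)).re := by
    rw [hB, Complex.norm_exp, hwA]
  rw [h3] at h2
  calc _ ≤ ‖ρ ξ‖ * (k.factorial * Real.exp (B (w₀ + l A) (w₀ + l A)).re *
        (b * (M * (1 + ‖t‖ + ‖ξ‖)) ^ 2) ^ k) := by gcongr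
    _ = (k.factorial * (b * M ^ 2) ^ k) * (‖ρ ξ‖ *
        Real.exp (B (w₀ + l A) (w₀ + l A)).re * (1 + ‖t‖ + ‖ξ‖) ^ (2 * k)) := by
        rw [mul_pow M, ← mul_assoc b, mul_pow _ ((1 + ‖t‖ + ‖ξ‖) ^ 2) k, ← pow_mul]
        ring
    _ ≤ (k.factorial * (b * M ^ 2) ^ k) *
        (C * (((1 + ‖t‖) ^ (finrank ℝ X + 1))⁻¹ * ((1 + ‖ξ‖) ^ (finrank ℝ X + 1))⁻¹)) := by
        gcongr
    _ = _ := by ring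

end

/-! ### The differential equations of the averages -/

section

variable {X : Type*} [NormedAddCommGroup X] [InnerProductSpace ℝ X]

theorem hasDerivAt_gaussWave_line (q p x q' p' x' : X) (τ : ℝ) :
    HasDerivAt (fun τ : ℝ => gaussWave (q + τ • q') (p + τ • p') (x + τ • x'))
      ((Complex.I * (inner ℝ p' (x + τ • x') + inner ℝ (p + τ • p') x' +
        (inner ℝ p' (q + τ • q') + inner ℝ (p + τ • p') q') / 2 : ℝ) -
        (inner ℝ (x + τ • x' + (q + τ • q')) (x' + q') : ℝ)) *
        gaussWave (q + τ • q') (p + τ • p') (x + τ • x')) τ := by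
  have hl : ∀ a b : X, HasDerivAt (fun τ : ℝ => a + τ • b) b τ := fun a b => by
    simpa using ((hasDerivAt_id τ).smul_const b).const_add a
  have h1 := (hl p p').inner ℝ (hl x x')
  have h2 := (hl p p').inner ℝ (hl q q')
  have h3 : HasDerivAt (fun τ : ℝ => ‖x + τ • x' + (q + τ • q')‖ ^ 2)
      (2 * inner ℝ (x + τ • x' + (q + τ • q')) (x' + q')) τ := ((hl x x').add (hl q q')).norm_sq
  have h4 := (h1.add (h2.div_const 2)).ofReal_comp.const_mul Complex.I
  have h5 := (h3.div_const 2).ofReal_comp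
  have h6 := (h4.sub h5).cexp
  unfold gaussWave
  refine h6.congr_deriv ?_
  rw [mul_comm]
  congr 1
  push_cast
  ring

theorem differentiable_gaussWave (q p : X) : Differentiable ℝ fun x => gaussWave q p x := by
  have h : ContDiff ℝ (⊤ : ℕ∞) fun x => gaussWave q p x := by
    unfold gaussWave
    refine ContDiff.cexp (ContDiff.sub (contDiff_const.mul ?_) ?_)
    · exact Complex.ofRealCLM.contDiff.comp
        ((contDiff_const.inner ℝ contDiff_id).add contDiff_const)
    · exact Complex.ofRealCLM.contDiff.comp
        (((contDiff_id.add contDiff_const).norm_sq ℝ).div_const 2)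
  exact h.differentiable (by simp)

theorem fderiv_gaussWave (q p x v : X) : fderiv ℝ (fun x => gaussWave q p x) x v =
    (Complex.I * (inner ℝ p v : ℝ) - (inner ℝ (x + q) v : ℝ)) * gaussWave q p x := by
  have h1 : HasDerivAt (fun τ : ℝ => gaussWave q p (x + τ • v)) _ 0 :=
    (differentiable_gaussWave q p x).hasFDerivAt.hasLineDerivAt v
  have h2 := hasDerivAt_gaussWave_line q p x 0 0 v 0
  simp only [smul_zero, add_zero] at h2
  rw [h1.unique h2]
  simp

variable [FiniteDimensional ℝ X] [MeasurableSpace X] [BorelSpace X]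

/-- Along a lagrangian family of vectors `(q t, p t)`, differentiation of the pairing with the
Gaussian translates in the direction `t'` amounts, up to the factor `i`, to the application to `f`
of the transposed Schrödinger operator of `(q t', p t')`. -/
theorem IsTest.hasLineDerivAt_wavePairing {f : X → ℂ} (hf : IsTest f) {q p : X →L[ℝ] X}
    (hqp : ∀ s t, inner ℝ (p s) (q t) = inner ℝ (p t) (q s)) (t t' : X) :
    HasLineDerivAt ℝ (fun t => wavePairing f (q t) (p t))
      (Complex.I * wavePairing (fun x => Complex.I * fderiv ℝ f x (q t') +
        (inner ℝ (p t') x : ℝ) * f x) (q t) (p t)) t t' := by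
  have hcont : Continuous f := hf.1.continuous
  have hfd : Continuous fun x => fderiv ℝ f x (q t') :=
    (hf.1.continuous_fderiv (by simp)).clm_apply continuous_const
  have hfs : HasCompactSupport fun x => fderiv ℝ f x (q t') :=
    hf.2.fderiv_apply ℝ (q t')
  let w' : ℝ → X → ℂ := fun τ x => (Complex.I * (inner ℝ (p t') x +
      (inner ℝ (p t') (q t + τ • q t') + inner ℝ (p t + τ • p t') (q t')) / 2 : ℝ) -
        (inner ℝ (x + (q t + τ • q t')) (q t') : ℝ))
  have hder : ∀ x (τ : ℝ), HasDerivAt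
      (fun τ : ℝ => gaussWave (q (t + τ • t')) (p (t + τ • t')) x)
      (w' τ x * gaussWave (q (t + τ • t')) (p (t + τ • t')) x) τ := by
    intro x τ
    have := hasDerivAt_gaussWave_line (q t) (p t) x (q t') (p t') 0 τ
    simpa [w'] using this
  have hw'c : Continuous (Function.uncurry w') := by
    simp only [w', Function.uncurry_def]
    fun_prop
  obtain ⟨M, hM⟩ : ∃ M, ∀ τ ∈ Metric.closedBall (0 : ℝ) 1, ∀ x ∈ tsupport f, ‖w' τ x‖ ≤ M := by
    obtain ⟨M, hM⟩ := ((isCompact_closedBall (0 : ℝ) 1).prod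
      hf.2.isCompact).exists_bound_of_continuousOn hw'c.continuousOn
    exact ⟨M, fun τ hτ x hx => hM (τ, x) ⟨hτ, hx⟩⟩
  have hgc : ∀ s, Continuous fun x => gaussWave (q s) (p s) x := fun s =>
    continuous_const.gaussWave continuous_const continuous_id
  have hd := hasDerivAt_integral_of_dominated_loc_of_deriv_le (μ := (volume : Measure X)) (𝕜 := ℝ)
    (F := fun τ x => f x * gaussWave (q (t + τ • t')) (p (t + τ • t')) x)
    (F' := fun τ x => f x * (w' τ x * gaussWave (q (t + τ • t')) (p (t + τ • t')) x))
    (x₀ := 0) (s := Metric.ball 0 1) (bound := fun x => ‖f x‖ * M)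
    (Metric.ball_mem_nhds _ one_pos)
    (Filter.Eventually.of_forall fun τ => (hcont.mul (hgc _)).aestronglyMeasurable)
    ((hcont.mul (hgc _)).integrable_of_hasCompactSupport hf.2.mul_right)
    ((hcont.mul ((hw'c.comp (Continuous.prodMk_right 0)).mul (hgc _))).aestronglyMeasurable)
    (Filter.Eventually.of_forall fun x τ hτ => by
      by_cases hx : x ∈ tsupport f
      · rw [norm_mul, norm_mul]
        gcongr
        exact (mul_le_of_le_one_right (norm_nonneg _) (norm_gaussWave_le _ _ _)).trans
          (hM τ (Metric.ball_subset_closedBall hτ) x hx)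
      · simp [image_eq_zero_of_notMem_tsupport hx])
    (hf.integrable.norm.mul_const M)
    (Filter.Eventually.of_forall fun x τ _ => (hder x τ).const_mul (f x))
  have hval : (∫ x, f x * (w' 0 x * gaussWave (q (t + (0 : ℝ) • t')) (p (t + (0 : ℝ) • t')) x)) =
      Complex.I * wavePairing (fun x => Complex.I * fderiv ℝ f x (q t') +
        (inner ℝ (p t') x : ℝ) * f x) (q t) (p t) := by
    have hwv : Continuous fun x => fderiv ℝ (fun x => gaussWave (q t) (p t) x) x (q t') := by
      simp_rw [fderiv_gaussWave]
      have := hgc t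
      fun_prop
    have hibp := integral_mul_fderiv_eq_neg_fderiv_mul_of_integrable
      (μ := (volume : Measure X)) (f := f) (g := fun x => gaussWave (q t) (p t) x) (v := q t')
      ((hfd.mul (hgc t)).integrable_of_hasCompactSupport hfs.mul_right)
      ((hcont.mul hwv).integrable_of_hasCompactSupport hf.2.mul_right)
      ((hcont.mul (hgc t)).integrable_of_hasCompactSupport hf.2.mul_right)
      (fun x _ => (hf.1.differentiable (by simp)) x)
      (fun x _ => differentiable_gaussWave _ _ x)
    have hi1 : Integrable fun x => fderiv ℝ f x (q t') * gaussWave (q t) (p t) x :=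
      (hfd.mul (hgc t)).integrable_of_hasCompactSupport hfs.mul_right
    have hi2 : Integrable fun x => f x * ((inner ℝ (p t') x : ℝ) * gaussWave (q t) (p t) x) := by
      refine (hcont.mul (Continuous.mul ?_ (hgc t))).integrable_of_hasCompactSupport hf.2.mul_right
      fun_prop
    have hi3 : Integrable fun x => f x * fderiv ℝ (fun x => gaussWave (q t) (p t) x) x (q t') :=
      (hcont.mul hwv).integrable_of_hasCompactSupport hf.2.mul_right
    have e1 : wavePairing (fun x => Complex.I * fderiv ℝ f x (q t') +
        (inner ℝ (p t') x : ℝ) * f x) (q t) (p t) =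
        Complex.I * (∫ x, fderiv ℝ f x (q t') * gaussWave (q t) (p t) x) +
        ∫ x, f x * ((inner ℝ (p t') x : ℝ) * gaussWave (q t) (p t) x) := by
      rw [wavePairing, ← integral_const_mul, ← integral_add (hi1.const_mul _) hi2]
      congr 1
      ext x
      ring
    have hi4 : Integrable fun x =>
        -(Complex.I * (f x * fderiv ℝ (fun x => gaussWave (q t) (p t) x) x (q t'))) :=
      (hi3.const_mul Complex.I).neg
    have e2 : Complex.I * (∫ x, fderiv ℝ f x (q t') * gaussWave (q t) (p t) x) =
        ∫ x, -(Complex.I * (f x * fderiv ℝ (fun x => gaussWave (q t) (p t) x) x (q t'))) := by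
      rw [integral_neg, integral_const_mul, hibp, mul_neg, neg_neg]
    rw [e1, e2, ← integral_add hi4 hi2, ← integral_const_mul]
    congr 1
    ext x
    rw [fderiv_gaussWave]
    simp only [w', zero_smul, add_zero]
    have h3 : inner ℝ (p t') (q t) = inner ℝ (p t) (q t') := hqp _ _
    rw [h3]
    push_cast
    linear_combination ((f x * gaussWave (q t) (p t) x *
      (Complex.I * (inner ℝ (p t) (q t') : ℝ) - (inner ℝ (x + q t) (q t') : ℝ)))) * Complex.I_sq
  rw [← hval]
  exact hd.2

/-- The average over a lagrangian family is killed by the transposed Schrödinger operators of its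
members, because the integral of a derivative in `t` vanishes. -/
theorem IsTest.heisenbergAverage_schrodinger {f : X → ℂ} (hf : IsTest f) {q p : X →L[ℝ] X} {c : ℝ}
    (hc : 0 ≤ c) (hb : ∀ t, ‖t‖ ≤ c * (‖q t‖ + ‖p t‖))
    (hqp : ∀ s t, inner ℝ (p s) (q t) = inner ℝ (p t) (q s)) (t' : X) :
    heisenbergAverage q p (fun x => Complex.I * fderiv ℝ f x (q t') +
      (inner ℝ (p t') x : ℝ) * f x) = 0 := by
  have hg : IsTest fun x => Complex.I * fderiv ℝ f x (q t') + (inner ℝ (p t') x : ℝ) * f x := by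
    refine ⟨(contDiff_const.mul ((hf.1.fderiv_right (by simp)).clm_apply contDiff_const)).add
      ((Complex.ofRealCLM.contDiff.comp (contDiff_const.inner ℝ contDiff_id)).mul hf.1),
      ((hf.2.fderiv_apply ℝ (q t')).mul_left).add hf.2.mul_left⟩
  have h := integral_bilinear_hasLineDerivAt_right_eq_neg_left_of_integrable
    (μ := (volume : Measure X)) (f := fun _ : X => (1 : ℂ)) (f' := fun _ => 0)
    (g := fun t => wavePairing f (q t) (p t)) (g' := fun t => Complex.I * wavePairing
      (fun x => Complex.I * fderiv ℝ f x (q t') + (inner ℝ (p t') x : ℝ) * f x) (q t) (p t))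
    (v := t') (B := ContinuousLinearMap.mul ℝ ℂ) (by simp)
    (by simpa using (hg.integrable_wavePairing hc hb).const_mul Complex.I)
    (by simpa using hf.integrable_wavePairing hc hb)
    (fun x _ => by simpa using (hasFDerivAt_const (1 : ℂ) x).hasLineDerivAt t')
    (fun x _ => hf.hasLineDerivAt_wavePairing hqp x t')
  simp only [ContinuousLinearMap.mul_apply', one_mul, zero_mul, integral_zero, neg_zero] at h
  rw [integral_const_mul] at h
  exact (mul_eq_zero.1 h).resolve_left Complex.I_ne_zero

end

/-! ### Nonvanishing and amplitude of the averages -/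

section

variable {X : Type*} [NormedAddCommGroup X] [InnerProductSpace ℝ X] [FiniteDimensional ℝ X]
  [MeasurableSpace X] [BorelSpace X]

/-- The integral of the Gaussian `exp (-|u|² / 4)` over the lagrangian subspace `{(q t, p t)}`. -/
noncomputable def gaussMass (q p : X →L[ℝ] X) : ℝ :=
  ∫ t, Real.exp (-((‖p t‖ ^ 2 + ‖q t‖ ^ 2) / 4))

theorem integrable_gaussMass {q p : X →L[ℝ] X} {c : ℝ} (hc : 0 ≤ c)
    (hb : ∀ t, ‖t‖ ≤ c * (‖q t‖ + ‖p t‖)) :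
    Integrable fun t => Real.exp (-((‖p t‖ ^ 2 + ‖q t‖ ^ 2) / 4)) := by
  obtain ⟨C, -, h⟩ := exists_gaussKernel_le (X := X) hc (finrank ℝ X + 1)
  have hi := integrable_one_add_norm (E := X) (μ := volume) (r := (finrank ℝ X + 1 : ℕ))
      (by push_cast; linarith)
  refine (hi.const_mul C).mono' (Continuous.aestronglyMeasurable (by fun_prop))
    (Filter.Eventually.of_forall fun t => ?_)
  have h1 := h t (q t) (p t) 0 (hb t)
  rw [norm_gaussKernel] at h1
  simp only [norm_zero, add_zero, one_pow, mul_one] at h1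
  rw [Real.rpow_neg (by positivity), Real.rpow_natCast, Real.norm_of_nonneg (Real.exp_nonneg _),
    ← div_eq_mul_inv, le_div_iff₀ (by positivity)]
  exact h1

theorem gaussMass_pos {q p : X →L[ℝ] X} {c : ℝ} (hc : 0 ≤ c)
    (hb : ∀ t, ‖t‖ ≤ c * (‖q t‖ + ‖p t‖)) : 0 < gaussMass q p :=
  integral_exp_pos (integrable_gaussMass hc hb)

theorem integral_gaussKernel_zero (q p : X →L[ℝ] X) :
    ∫ t, gaussKernel (q t) (p t) 0 = (gaussMass q p : ℂ) := by
  refine Eq.trans ?_ integral_ofReal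
  congr 1
  ext t
  simp [gaussKernel]

/-- The average is nonzero: it is positive in the limit on the functions
`χ (s x) exp (-|x|² / 2)`, `s → 0`. -/
theorem exists_heisenbergAverage_ne_zero {q p : X →L[ℝ] X} {c : ℝ} (hc : 0 ≤ c)
    (hb : ∀ t, ‖t‖ ≤ c * (‖q t‖ + ‖p t‖)) : ∃ f, IsTest f ∧ heisenbergAverage q p f ≠ 0 := by
  let χ : ContDiffBump (0 : X) := ⟨1, 2, one_pos, one_lt_two⟩
  have hχ : ContDiff ℝ (⊤ : ℕ∞) fun x => (χ x : ℂ) :=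
    Complex.ofRealCLM.contDiff.comp χ.contDiff
  have hχs : HasCompactSupport fun x => (χ x : ℂ) :=
    χ.hasCompactSupport.comp_left Complex.ofReal_zero
  have hΩ : ContDiff ℝ (⊤ : ℕ∞) fun x : X => ((Real.exp (-(‖x‖ ^ 2 / 2)) : ℝ) : ℂ) :=
    Complex.ofRealCLM.contDiff.comp (((contDiff_norm_sq ℝ).div_const 2).neg.exp)
  have hΩ0 : ∀ x : X, ((Real.exp (-(‖x‖ ^ 2 / 2)) : ℝ) : ℂ) ≠ 0 := fun x =>
    Complex.ofReal_ne_zero.2 (Real.exp_ne_zero _)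
  obtain ⟨ρ, hρ⟩ := IsTest.exists_schwartz (X := X) ⟨hχ.mul hΩ, hχs.mul_right⟩
  have hρ' : ∀ x, (χ x : ℂ) =
      ∫ ξ, ρ ξ * Complex.exp (Complex.I * (inner ℝ ((2 * Real.pi * 1) • ξ) x : ℝ)) := fun x =>
    mul_right_cancel₀ (hΩ0 x) (hρ x)
  let f : ℕ → X → ℂ := fun k x => χ ((1 / ((k : ℝ) + 1)) • x) * (Real.exp (-(‖x‖ ^ 2 / 2)) : ℝ)
  have hs : ∀ k : ℕ, |1 / ((k : ℝ) + 1)| ≤ 1 := fun k => by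
    rw [abs_of_nonneg (by positivity), div_le_one (by positivity)]
    linarith [(Nat.cast_nonneg k : (0 : ℝ) ≤ k)]
  have hf : ∀ k, IsTest (f k) := fun k => by
    refine ⟨(hχ.comp (contDiff_id.const_smul (1 / ((k : ℝ) + 1)))).mul hΩ, ?_⟩
    exact HasCompactSupport.mul_right (hχs.comp_smul (by positivity))
  have hval : ∀ k, heisenbergAverage q p (f k) = gaussConst X * ∫ z : X × X, ρ z.2 *
      gaussKernel (q z.1) (p z.1) ((2 * Real.pi * (1 / ((k : ℝ) + 1))) • z.2) := by
    intro k
    rw [heisenbergAverage, Measure.volume_eq_prod,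
      integral_prod _ (integrable_schwartz_gaussKernel ρ hc hb (hs k)), ← integral_const_mul]
    congr 1
    ext t
    refine wavePairing_eq ρ.integrable _ (fun x => ?_) _ _
    simp only [f]
    rw [hρ']
    congr 2
    ext ξ
    simp only [inner_smul_left, inner_smul_right, mul_one, conj_trivial]
    ring_nf
  have hlim : Filter.Tendsto (fun k => heisenbergAverage q p (f k)) Filter.atTop
      (nhds (gaussConst X * ∫ z : X × X, ρ z.2 * gaussKernel (q z.1) (p z.1) 0)) := by
    simp_rw [hval]
    refine Filter.Tendsto.const_mul _ ?_
    obtain ⟨C, hC, h⟩ := exists_schwartz_gaussKernel_le ρ hc 0 (finrank ℝ X + 1)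
    refine tendsto_integral_of_dominated_convergence _ (fun k => ?_)
      ((integrable_inv_one_add_pow (X := X)).const_mul C)
      (fun k => Filter.Eventually.of_forall fun z => ?_) (Filter.Eventually.of_forall fun z => ?_)
    · refine Continuous.aestronglyMeasurable ?_
      refine (ρ.continuous.comp continuous_snd).mul (Continuous.gaussKernel ?_ ?_ ?_)
      all_goals fun_prop
    · have := h z.1 (q z.1) (p z.1) z.2 _ (hb z.1) (hs k)
      rw [pow_zero, mul_one] at this
      rw [norm_mul]
      exact this
    · refine Filter.Tendsto.const_mul _ ?_
      have h1 : Continuous fun η => gaussKernel (q z.1) (p z.1) η :=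
        continuous_const.gaussKernel continuous_const continuous_id
      have h2 : Filter.Tendsto (fun k : ℕ => (2 * Real.pi * (1 / ((k : ℝ) + 1))) • z.2)
          Filter.atTop (nhds 0) := by
        have := (tendsto_one_div_add_atTop_nhds_zero_nat (𝕜 := ℝ)).const_mul (2 * Real.pi)
        simpa using this.smul_const z.2
      exact (h1.tendsto 0).comp h2
  have hne : (gaussConst X * ∫ z : X × X, ρ z.2 * gaussKernel (q z.1) (p z.1) 0 : ℂ) ≠ 0 := by
    have e : ∫ z : X × X, ρ z.2 * gaussKernel (q z.1) (p z.1) 0 = gaussMass q p := by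
      have h1 := integral_prod_mul (μ := (volume : Measure X)) (ν := (volume : Measure X))
        (fun t => gaussKernel (q t) (p t) 0) ρ
      have h2 : ∫ ξ, ρ ξ = 1 := by
        have := hρ' 0
        rw [χ.one_of_mem_closedBall (by simp [χ])] at this
        simpa using this.symm
      rw [h2, integral_gaussKernel_zero, mul_one] at h1
      rw [← h1, Measure.volume_eq_prod]
      simp_rw [mul_comm]
    rw [e, ← Complex.ofReal_mul]
    exact Complex.ofReal_ne_zero.2 (mul_pos gaussConst_pos (gaussMass_pos hc hb)).ne'
  obtain ⟨k, hk⟩ := (hlim.eventually_ne hne).exists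
  exact ⟨f k, hf k, hk⟩

/-- The amplitude of the average over the subspace `{(q t, p t)}`, for `q` invertible. (The integral
does not converge absolutely if `q` is not injective, and then has the junk value `0`.) -/
noncomputable def phaseConst (q p : X →L[ℝ] X) : ℂ :=
  ∫ t, Complex.exp (Complex.I * (inner ℝ (p t) (q t) / 2 : ℝ) - (‖q t‖ ^ 2 / 2 : ℝ))

theorem integral_gaussWave_lagrangian (q : X ≃L[ℝ] X) (p : X →L[ℝ] X)
    (hqp : ∀ s t, inner ℝ (p s) (q t) = inner ℝ (p t) (q s)) (x : X) :
    ∫ t, gaussWave (q t) (p t) x =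
      phaseConst q p * Complex.exp (-(Complex.I * (inner ℝ (p (q.symm x)) x / 2 : ℝ))) := by
  rw [← integral_sub_right_eq_self _ (q.symm x), phaseConst, ← integral_mul_const]
  congr 1
  ext t
  rw [gaussWave, ← Complex.exp_add]
  congr 1
  obtain ⟨y, rfl⟩ := q.surjective x
  have h := hqp y t
  simp only [map_sub, ContinuousLinearEquiv.symm_apply_apply, ContinuousLinearEquiv.coe_coe,
    inner_sub_left, inner_sub_right, add_sub_cancel]
  rw [h]
  push_cast
  ring

theorem integral_norm_gaussWave_lagrangian (q : X ≃L[ℝ] X) (p : X →L[ℝ] X) (x : X) :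
    ∫ t, ‖gaussWave (q t) (p t) x‖ = ∫ t, Real.exp (-(‖q t‖ ^ 2 / 2)) := by
  rw [← integral_sub_right_eq_self _ (q.symm x)]
  simp [norm_gaussWave]

theorem integrable_gaussWave_lagrangian (q : X ≃L[ℝ] X) (p : X →L[ℝ] X) (x : X) :
    Integrable fun t => gaussWave (q t) (p t) x := by
  have h1 : Integrable fun t : X => Real.exp (-(‖q t‖ ^ 2 / 2)) := by
    refine (q.toHomeomorph.measurableEmbedding.integrable_map_iff (μ := volume)
      (g := fun u : X => Real.exp (-(‖u‖ ^ 2 / 2)))).1 ?_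
    have h0 : Measure.map q.toHomeomorph (volume : Measure X) = _ :=
      Measure.map_linearMap_addHaar_eq_smul_addHaar (volume : Measure X)
        (f := (q.toLinearEquiv : X →ₗ[ℝ] X)) q.toLinearEquiv.isUnit_det'.ne_zero
    rw [h0]
    exact integrable_exp_neg_sq.smul_measure ENNReal.ofReal_ne_top
  have h2 : Integrable fun t : X => Real.exp (-(‖x + q t‖ ^ 2 / 2)) := by
    have := h1.comp_add_left (q.symm x)
    simpa using this
  refine h2.mono' (Continuous.aestronglyMeasurable ?_) (Filter.Eventually.of_forall fun t => ?_)
  · exact Continuous.gaussWave (by fun_prop) (by fun_prop) continuous_const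
  · rw [norm_gaussWave]

/-- If `q` is invertible, the average is integration against an oscillating exponential, with the
phase given by the symmetric map `p q⁻¹`. -/
theorem heisenbergAverage_eq (q : X ≃L[ℝ] X) (p : X →L[ℝ] X)
    (hqp : ∀ s t, inner ℝ (p s) (q t) = inner ℝ (p t) (q s)) {f : X → ℂ} (hf : Integrable f) :
    heisenbergAverage q p f = phaseConst q p *
      ∫ x, f x * Complex.exp (-(Complex.I * (inner ℝ (p (q.symm x)) x / 2 : ℝ))) := by
  have hint : Integrable (Function.uncurry fun (x t : X) => f x * gaussWave (q t) (p t) x)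
      (volume.prod volume) := by
    have hm : AEStronglyMeasurable
        (Function.uncurry fun (x t : X) => f x * gaussWave (q t) (p t) x)
        (volume.prod volume) := by
      refine hf.aestronglyMeasurable.comp_fst.mul (Continuous.aestronglyMeasurable ?_)
      exact Continuous.gaussWave (by fun_prop) (by fun_prop) continuous_fst
    refine (integrable_prod_iff hm).2 ⟨Filter.Eventually.of_forall fun x => ?_, ?_⟩
    · exact (integrable_gaussWave_lagrangian q p x).const_mul (f x)
    · simp only [Function.uncurry_apply_pair, norm_mul, integral_const_mul,
        integral_norm_gaussWave_lagrangian]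
      exact hf.norm.mul_const _
  rw [heisenbergAverage]
  simp only [wavePairing]
  rw [← integral_const_mul]
  have := integral_integral_swap hint
  simp only [ContinuousLinearEquiv.coe_coe]
  rw [← this]
  congr 1
  ext x
  rw [integral_const_mul, integral_gaussWave_lagrangian q p hqp]
  ring

theorem integral_comp_continuousLinearEquiv (q : X ≃L[ℝ] X) (F : X → ℂ) :
    ∫ x, F x = (|LinearMap.det (q : X →ₗ[ℝ] X)| : ℝ) * ∫ y, F (q y) := by
  have hd : LinearMap.det (q : X →ₗ[ℝ] X) ≠ 0 := q.toLinearEquiv.isUnit_det'.ne_zero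
  have h1 := q.toHomeomorph.measurableEmbedding.integral_map (μ := volume) F
  have h2 : Measure.map q.toHomeomorph (volume : Measure X) = _ :=
    Measure.map_linearMap_addHaar_eq_smul_addHaar (volume : Measure X) (f := (q : X →ₗ[ℝ] X)) hd
  rw [h2, integral_smul_measure, ENNReal.toReal_ofReal (abs_nonneg _)] at h1
  change _ = ∫ y, F (q y) at h1
  rw [← h1, abs_inv, Complex.real_smul, ← mul_assoc, ← Complex.ofReal_mul,
    mul_inv_cancel₀ (abs_ne_zero.2 hd)]
  simp

/-- The pairing of the average with the Gaussian `exp (-|x|² / 2)` can be computed in two ways: as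
a multiple of the mass of a Gaussian over the lagrangian subspace, and as the amplitude times an
integral which is itself the conjugate of the amplitude, up to a determinant. -/
theorem norm_phaseConst_sq (q : X ≃L[ℝ] X) (p : X →L[ℝ] X)
    (hqp : ∀ s t, inner ℝ (p s) (q t) = inner ℝ (p t) (q s)) :
    ‖phaseConst (q : X →L[ℝ] X) p‖ ^ 2 * |LinearMap.det (q : X →ₗ[ℝ] X)| =
      gaussConst X * gaussMass (q : X →L[ℝ] X) p := by
  have h := heisenbergAverage_eq q p hqp
    (f := fun x => ((Real.exp (-(‖x‖ ^ 2 / 2)) : ℝ) : ℂ)) integrable_exp_neg_sq.ofReal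
  have h1 : heisenbergAverage (q : X →L[ℝ] X) p
      (fun x => ((Real.exp (-(‖x‖ ^ 2 / 2)) : ℝ) : ℂ)) =
        gaussConst X * gaussMass (q : X →L[ℝ] X) p := by
    rw [← integral_gaussKernel_zero, heisenbergAverage, ← integral_const_mul]
    congr 1
    ext t
    rw [← integral_gaussWave]
    simp [wavePairing]
  have h2 : ∫ x, ((Real.exp (-(‖x‖ ^ 2 / 2)) : ℝ) : ℂ) *
      Complex.exp (-(Complex.I * (inner ℝ (p (q.symm x)) x / 2 : ℝ))) =
      (|LinearMap.det (q : X →ₗ[ℝ] X)| : ℝ) * starRingEnd ℂ (phaseConst (q : X →L[ℝ] X) p) := by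
    rw [integral_comp_continuousLinearEquiv q, phaseConst, ← integral_conj]
    congr 2
    ext t
    rw [← Complex.exp_conj, Complex.ofReal_exp, ← Complex.exp_add]
    simp only [map_sub, map_mul, Complex.conj_I, Complex.conj_ofReal,
      ContinuousLinearEquiv.symm_apply_apply, ContinuousLinearEquiv.coe_coe]
    congr 1
    push_cast
    ring
  rw [h1, h2, mul_left_comm, Complex.mul_conj, Complex.normSq_eq_norm_sq] at h
  have h3 : ((gaussConst X * gaussMass (q : X →L[ℝ] X) p : ℝ) : ℂ) =
    ((|LinearMap.det (q : X →ₗ[ℝ] X)| * ‖phaseConst (q : X →L[ℝ] X) p‖ ^ 2 : ℝ) : ℂ) := by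
    push_cast at h ⊢
    exact h
  rw [mul_comm]
  exact (Complex.ofReal_injective h3).symm

end

/-! ### Uniqueness of the solutions in the standard symplectic space -/

section

variable {X : Type*} [NormedAddCommGroup X] [InnerProductSpace ℝ X] [FiniteDimensional ℝ X]

/-- The functional `θ` is a solution of the system attached to a subspace `W` of pairs `(q, p)`:
its transposed equations are `θ (i ∂_q h + ⟨p, x⟩ h) = 0`. No continuity of `θ` is assumed. -/
def SolvesSchrodinger (W : Submodule ℝ (X × X)) (θ : (X → ℂ) →ₗ[ℂ] ℂ) : Prop :=
  ∀ w ∈ W, ∀ h, IsTest h →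
    θ (fun x => Complex.I * fderiv ℝ h x w.1 + (inner ℝ w.2 x : ℝ) * h x) = 0

/-- The subspace `W` of `X × X` is lagrangian for the form `⟨p', q⟩ - ⟨p, q'⟩`. -/
def IsLagrangianPair (W : Submodule ℝ (X × X)) : Prop :=
  ∀ q p : X, (q, p) ∈ W ↔ ∀ w ∈ W, inner ℝ w.2 q = inner ℝ p w.1

/-- A lagrangian subspace projecting onto `R` contains the graph over `R` of a symmetric map, and
`0 × Rᗮ`. -/
theorem IsLagrangianPair.exists_symmetric {W : Submodule ℝ (X × X)} (hW : IsLagrangianPair W) :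
    ∃ (R : Submodule ℝ X) (S : X →L[ℝ] X), (∀ x y, inner ℝ (S x) y = inner ℝ (S y) x) ∧
      (∀ r ∈ R, (r, S r) ∈ W) ∧ ∀ p ∈ Rᗮ, (0, p) ∈ W := by
  -- Choose a linear section `σ` over `R`, and project its values to `R`; this makes it symmetric,
  -- and changes it by elements of `0 × Rᗮ`.
  let R : Submodule ℝ X := W.map (LinearMap.fst ℝ X X)
  have hperp : ∀ p ∈ Rᗮ, ((0, p) : X × X) ∈ W := fun p hp => by
    rw [hW]
    intro w hw
    rw [inner_zero_right, real_inner_comm]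
    exact ((Submodule.mem_orthogonal R p).1 hp _ ⟨w, hw, rfl⟩).symm
  let f : W →ₗ[ℝ] R := ((LinearMap.fst ℝ X X).comp W.subtype).codRestrict R
    fun w => ⟨w, w.2, rfl⟩
  have hf : LinearMap.range f = ⊤ := by
    rw [LinearMap.range_eq_top]
    rintro ⟨_, w, hw, rfl⟩
    exact ⟨⟨w, hw⟩, rfl⟩
  obtain ⟨g, hg⟩ := f.exists_rightInverse_of_surjective hf
  have hg1 : ∀ r : R, (g r : X × X).1 = r := fun r =>
    congrArg Subtype.val (LinearMap.congr_fun hg r)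
  let σ : R →L[ℝ] X :=
    ((LinearMap.snd ℝ X X).comp (W.subtype.comp g)).toContinuousLinearMap
  have hσ : ∀ r : R, ((r : X), σ r) ∈ W := fun r => by
    have h := (g r).2
    rwa [← Prod.mk.eta (p := (g r : X × X)), hg1] at h
  have hmem : ∀ r : R, ((r : X), R.starProjection (σ r)) ∈ W := fun r => by
    have h := W.sub_mem (hσ r) (hperp _ (R.sub_starProjection_mem_orthogonal (σ r)))
    simpa using h
  refine ⟨R, R.starProjection ∘L σ ∘L R.orthogonalProjectionOnto, fun x y => ?_, fun r hr => ?_,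
    hperp⟩
  · have h1 := (hW _ _).1 (hσ (R.orthogonalProjectionOnto x)) _ (hσ (R.orthogonalProjectionOnto y))
    have h2 : ∀ a b : X, inner ℝ (R.starProjection a) b = inner ℝ a (R.starProjection b) :=
      fun a b => R.inner_starProjection_left_eq_right a b
    simp only [ContinuousLinearMap.comp_apply]
    rw [h2, h2]
    exact h1.symm
  · have h1 : R.orthogonalProjectionOnto r = ⟨r, hr⟩ :=
      R.orthogonalProjectionOnto_mem_subspace_eq_self ⟨r, hr⟩
    have := hmem ⟨r, hr⟩
    simpa [h1] using this

/-- Solutions of a lagrangian system are unique up to a factor, and continuous: on functions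
supported in a fixed ball, they are all controlled by their value at one function. The phase
`exp (i ⟨S x, x⟩ / 2)` turns the equations into `x_i θ = 0` and `∂_j θ = 0`, for complementary sets
of coordinates. -/
theorem SolvesSchrodinger.exists_eq_mul {W : Submodule ℝ (X × X)} (hW : IsLagrangianPair W) :
    ∃ g₀ : X → ℂ, IsTest g₀ ∧ ∀ r : ℝ, ∃ C : ℝ, 0 ≤ C ∧ ∀ f : X → ℂ, ContDiff ℝ (⊤ : ℕ∞) f →
      (∀ x, f x ≠ 0 → ‖x‖ ≤ r) → ∀ M : ℝ, 0 ≤ M → (∀ x, ‖f x‖ ≤ M) →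
        ∃ c : ℂ, ‖c‖ ≤ C * M ∧ ∀ θ, SolvesSchrodinger W θ → θ f = c * θ g₀ := by
  obtain ⟨R, S, hS, hR, hperp⟩ := hW.exists_symmetric
  have hcompl : IsCompl R Rᗮ := R.isCompl_orthogonal
  let e := ((finBasis ℝ R).prod (finBasis ℝ Rᗮ)).map (R.prodEquivOfIsCompl Rᗮ hcompl)
  let I : Set (Fin (finrank ℝ R) ⊕ Fin (finrank ℝ Rᗮ)) := Set.range Sum.inr
  let E : X → ℂ := fun x => Complex.exp (Complex.I * (inner ℝ (S x) x / 2 : ℝ))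
  have hE : ContDiff ℝ (⊤ : ℕ∞) E := by
    refine ContDiff.cexp (contDiff_const.mul (Complex.ofRealCLM.contDiff.comp ?_))
    exact (S.contDiff.inner ℝ contDiff_id).div_const 2
  have hE1 : ∀ x, ‖E x‖ = 1 := fun x => by
    simp only [E]
    rw [mul_comm, Complex.norm_exp_ofReal_mul_I]
  have hE0 : ∀ x, E x ≠ 0 := fun x => Complex.exp_ne_zero _
  have hEd : ∀ x v, fderiv ℝ E x v = Complex.I * (inner ℝ (S v) x : ℝ) * E x := fun x v => by
    have h1 : HasFDerivAt (fun x => inner ℝ (S x) x) _ x :=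
      S.hasFDerivAt.inner ℝ (hasFDerivAt_id x)
    have h2 := ((Complex.ofRealCLM.hasFDerivAt (x := inner ℝ (S x) x * (2 : ℝ)⁻¹)).comp x
      (h1.mul_const (2 : ℝ)⁻¹)).const_mul Complex.I
    have h3 : HasFDerivAt E _ x := h2.cexp
    rw [h3.fderiv]
    simp only [E, Function.comp_def, _root_.smul_apply, ContinuousLinearMap.comp_apply,
      Complex.ofRealCLM_apply, fderivInnerCLM_apply, ContinuousLinearMap.prod_apply,
      ContinuousLinearMap.id_apply, smul_eq_mul]
    rw [hS x v, div_eq_mul_inv]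
    push_cast
    ring
  let mulE : (X → ℂ) →ₗ[ℂ] (X → ℂ) := LinearMap.mulLeft ℂ E
  have hkill : ∀ θ, SolvesSchrodinger W θ → KilledBy e I (θ.comp mulE) := by
    intro θ hθ
    constructor
    · rintro _ ⟨i, rfl⟩ h hh
      let v : X := (InnerProductSpace.toDual ℝ X).symm (e.coord (.inr i)).toContinuousLinearMap
      have hv : ∀ x, inner ℝ v x = e.repr x (.inr i) := fun x => by
        simp [v, InnerProductSpace.toDual_symm_apply]
      have hvR : v ∈ Rᗮ := (Submodule.mem_orthogonal R v).2 fun r hr => by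
        rw [real_inner_comm, hv]
        simp only [e, Basis.map_repr, LinearEquiv.trans_apply]
        rw [(R.prodEquivOfIsCompl Rᗮ hcompl).symm_apply_eq.2
          (show r = R.prodEquivOfIsCompl Rᗮ hcompl (⟨r, hr⟩, 0) by simp)]
        simp
      have := hθ _ (hperp v hvR) (fun x => E x * h x) ⟨hE.mul hh.1, hh.2.mul_left⟩
      simp only [map_zero, mul_zero, zero_add, hv] at this
      rw [LinearMap.comp_apply, ← this]
      congr 1
      ext x
      simp only [mulE, LinearMap.mulLeft_apply, Pi.mul_apply]
      ring
    · intro j hj h hh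
      obtain ⟨j, rfl⟩ : ∃ j', j = Sum.inl j' := by
        rcases j with j | j
        · exact ⟨j, rfl⟩
        · exact absurd ⟨j, rfl⟩ hj
      have hej : e (.inl j) ∈ R := by simp [e]
      have := hθ _ (hR _ hej) (fun x => E x * h x) ⟨hE.mul hh.1, hh.2.mul_left⟩
      have e1 : (fun x => Complex.I * fderiv ℝ (fun x => E x * h x) x (e (.inl j)) +
          (inner ℝ (S (e (.inl j))) x : ℝ) * (E x * h x)) =
          Complex.I • mulE fun x => fderiv ℝ h x (e (.inl j)) := by
        ext x
        rw [fderiv_fun_mul (hE.differentiable (by simp) x) (hh.1.differentiable (by simp) x)]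
        simp only [_root_.add_apply, _root_.smul_apply, smul_eq_mul, hEd,
          mulE, LinearMap.mulLeft_apply, Pi.mul_apply, Pi.smul_apply]
        linear_combination (E x * h x * (inner ℝ (S (e (.inl j))) x : ℝ)) * Complex.I_sq
      simp only [e1, map_smul] at this
      exact (smul_eq_zero.1 this).resolve_left Complex.I_ne_zero
  obtain ⟨g₀, hg₀, hU⟩ := KilledBy.exists_eq_mul e I
  refine ⟨fun x => E x * g₀ x, ⟨hE.mul hg₀.1, hg₀.2.mul_left⟩, fun r => ?_⟩
  obtain ⟨K, hK⟩ : ∃ K : ℝ, ∀ x : X, ∀ i, |e.repr x i| ≤ K * ‖x‖ := by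
    let T := e.equivFunL.toContinuousLinearMap
    refine ⟨‖T‖, fun x i => ?_⟩
    have h1 := T.le_opNorm x
    exact (norm_le_pi_norm (e.equivFunL x) i).trans h1
  obtain ⟨C, hC, h⟩ := hU (|K| * r)
  refine ⟨C, hC, fun f hf hfr M hM hfM => ?_⟩
  have hEi : ContDiff ℝ (⊤ : ℕ∞) fun x => (E x)⁻¹ := hE.inv hE0
  obtain ⟨c, hc, hcθ⟩ := h (fun x => (E x)⁻¹ * f x) (hEi.mul hf) (fun x hx i => by
      have hx' : ‖x‖ ≤ r := hfr x (right_ne_zero_of_mul hx)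
      exact (hK x i).trans (mul_le_mul (le_abs_self K) hx' (norm_nonneg _) (abs_nonneg _)))
    M hM (fun x => by simpa [hE1] using hfM x)
  refine ⟨c, hc, fun θ hθ => ?_⟩
  have h1 := hcθ _ (hkill θ hθ)
  have h2 : mulE (fun x => (E x)⁻¹ * f x) = f := by
    ext x
    simp [mulE, mul_inv_cancel_left₀ (hE0 x)]
  rwa [LinearMap.comp_apply, LinearMap.comp_apply, h2] at h1

end

/-! ### Densities on a vector space with a basis -/

section

variable {R : Type*} [AddCommGroup R] [Module ℝ R] {n : ℕ} {α : ℝ}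

namespace Density

/-- The density which takes the value `1` on the basis `b`. -/
noncomputable def ofBasis (α : ℝ) (b : Basis (Fin n) ℝ R) : Density n α R :=
  ⟨fun b' => ((|b.det b'| ^ α : ℝ) : ℂ), fun b' b'' => by
    have h : b.det b'' = b.det b' * b'.det b'' := by
      simp only [Basis.det_apply]
      rw [← Matrix.det_mul, Basis.toMatrix_mul_toMatrix]
    change ((|b.det b''| ^ α : ℝ) : ℂ) = ((|b'.det b''| ^ α : ℝ) : ℂ) * ((|b.det b'| ^ α : ℝ) : ℂ)
    rw [h, abs_mul, Real.mul_rpow (abs_nonneg _) (abs_nonneg _)]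
    push_cast
    ring⟩

theorem ofBasis_apply (b b' : Basis (Fin n) ℝ R) :
    ofBasis α b b' = ((|b.det b'| ^ α : ℝ) : ℂ) := rfl

theorem ofBasis_self (b : Basis (Fin n) ℝ R) : ofBasis α b b = 1 := by
  rw [ofBasis_apply, b.det_self]
  simp

theorem apply_basis (s : Density n α R) (b b' : Basis (Fin n) ℝ R) :
    s b' = ((|b.det b'| ^ α : ℝ) : ℂ) * s b := s.2 b b'

theorem smul_apply_basis (c : ℂ) (s : Density n α R) (b : Basis (Fin n) ℝ R) :
    (c • s) b = c * s b := rfl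

theorem ext_basis {s t : Density n α R} (b : Basis (Fin n) ℝ R) (h : s b = t b) : s = t :=
  Subtype.ext (funext fun b' => by
    rw [s.apply_basis b b', t.apply_basis b b', h])

theorem eq_smul_ofBasis (s : Density n α R) (b : Basis (Fin n) ℝ R) : s = s b • ofBasis α b :=
  ext_basis b (by rw [smul_apply_basis, ofBasis_self, mul_one])

/-- Evaluation of densities at a basis. -/
noncomputable def evalCLM (α : ℝ) (b : Basis (Fin n) ℝ R) : Density n α R →L[ℂ] ℂ :=
  LinearMap.mkContinuous ⟨⟨fun s => s b, fun _ _ => rfl⟩, fun _ _ => rfl⟩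
    ‖evalSome n α R (ofBasis α b)‖⁻¹
    (fun s => by
      have h1 : ‖s‖ = ‖s b‖ * ‖evalSome n α R (ofBasis α b)‖ := by
        conv_lhs => rw [eq_smul_ofBasis s b]
        change ‖evalSome n α R (s b • ofBasis α b)‖ = _
        rw [map_smul, norm_smul]
      have h2 : ‖evalSome n α R (ofBasis α b)‖ ≠ 0 := by
        rw [norm_ne_zero_iff]
        intro h
        have := evalSome_injective (h.trans (map_zero _).symm)
        have h3 := ofBasis_self (α := α) b
        rw [this] at h3
        exact zero_ne_one h3
      rw [h1, mul_comm, mul_assoc, mul_inv_cancel₀ h2, mul_one]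
      exact le_rfl)

theorem ofBasis_ne_zero (b : Basis (Fin n) ℝ R) : ofBasis α b ≠ 0 := fun h => by
  have h3 := ofBasis_self (α := α) b
  rw [h] at h3
  exact zero_ne_one h3

theorem map_apply_basis {R' : Type*} [AddCommGroup R'] [Module ℝ R'] (e : R ≃ₗ[ℝ] R')
    (s : Density n α R) (b : Basis (Fin n) ℝ R') : map e s b = s (b.map e.symm) := rfl

theorem map_injective {R' : Type*} [AddCommGroup R'] [Module ℝ R'] (e : R ≃ₗ[ℝ] R')
    (b : Basis (Fin n) ℝ R) : Function.Injective (map e : Density n α R →ₗ[ℂ] Density n α R') :=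
  fun s t h => ext_basis b (by
    have h1 : map e s (b.map e) = map e t (b.map e) := by rw [h]
    rw [map_apply_basis, map_apply_basis] at h1
    have h2 : (b.map e).map e.symm = b := by ext; simp
    rwa [h2] at h1)

end Density

end

/-! ### Coordinates on the symplectic space and on half-densities -/

/-- A linear functional on test functions which is bounded by the supremum norm on functions
supported in each given compact set is continuous. -/
theorem TestFunction.continuous_of_norm_le {E F : Type*} [NormedAddCommGroup E] [NormedSpace ℝ E]
    [NormedAddCommGroup F] [NormedSpace ℂ F] {Ω : TopologicalSpace.Opens E}
    (ℓ : 𝓓(Ω, F) →ₗ[ℂ] ℂ) (h : ∀ K : TopologicalSpace.Compacts E, ∃ C, 0 ≤ C ∧ ∀ g : 𝓓(Ω, F),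
      (∀ x, g x ≠ 0 → x ∈ K) → ∀ M, 0 ≤ M → (∀ x, ‖g x‖ ≤ M) → ‖ℓ g‖ ≤ C * M) :
    Continuous ℓ := by
  rw [TestFunction.continuous_iff_continuous_comp]
  intro K hK
  obtain ⟨C, hC, hb⟩ := h K
  have hb' : ∀ f : 𝓓_{K}(E, F), ‖(ℓ.comp (ofSupportedInCLM ℂ hK).toLinearMap) f‖ ≤
      C * (({0} : Finset ℕ).sup fun i => ContDiffMapSupportedIn.seminorm ℂ E F ⊤ K i) f := by
    intro f
    simp only [Finset.sup_singleton]
    refine hb _ (fun x hx => ?_) _ (apply_nonneg _ _) (fun x => ?_)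
    · by_contra hxK
      exact hx (f.zero_on_compl hxK)
    · exact ContDiffMapSupportedIn.norm_apply_le_seminorm ℂ
  exact (ContDiffMapSupportedIn.mkCLMtoNormedSpace ℂ _ (map_add (ℓ.comp
    (ofSupportedInCLM ℂ hK).toLinearMap)) (map_smul (ℓ.comp
    (ofSupportedInCLM ℂ hK).toLinearMap)) ⟨{0}, C, hC, hb'⟩).continuous

section

variable {V : Type*} [AddCommGroup V] [Module ℝ V] {ω : LinearMap.BilinForm ℝ V}

theorem LagGr.mem_iff (L : LagGr ω) (u : V) : u ∈ L.1 ↔ ∀ v ∈ L.1, ω v u = 0 := by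
  conv_lhs => rw [← L.2]
  exact LinearMap.BilinForm.mem_orthogonal_iff

theorem LagGr.isotropic (L : LagGr ω) {u v : V} (hu : u ∈ L.1) (hv : v ∈ L.1) : ω u v = 0 :=
  (L.mem_iff v).1 hv u hu

/-- The component along `Q` does not contribute to the pairing with elements of `Q`. -/
theorem omega_projection {L₀ Q : LagGr ω} (hQ : IsCompl Q.1 L₀.1) (x : Q.1) (u : V) :
    ω x (L₀.1.projectionOnto Q.1 hQ.symm u) = ω x u := by
  have h : u = (Q.1.projectionOnto L₀.1 hQ u : V) + L₀.1.projectionOnto Q.1 hQ.symm u :=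
    (Submodule.projection_add_projection_eq_self hQ u).symm
  conv_rhs => rw [h]
  rw [map_add, Q.isotropic x.2 (Q.1.projectionOnto L₀.1 hQ u).2, zero_add]

end

section

variable {V : Type*} [NormedAddCommGroup V] [NormedSpace ℝ V] [FiniteDimensional ℝ V]
  {ω : LinearMap.BilinForm ℝ V} {n : ℕ} {L₀ Q : LagGr ω}

/-- The coordinates on `Q` attached to a basis. -/
noncomputable def euclid (b : Basis (Fin n) ℝ Q.1) : Q.1 ≃L[ℝ] EuclideanSpace ℝ (Fin n) :=
  (b.equivFun.trans (WithLp.linearEquiv 2 ℝ (Fin n → ℝ)).symm).toContinuousLinearEquiv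

theorem euclid_apply (b : Basis (Fin n) ℝ Q.1) (x : Q.1) (i : Fin n) :
    euclid b x i = b.repr x i := rfl

/-- The position coordinates of a vector of `V`: the coordinates of its projection to `Q` along
`L₀`. -/
noncomputable def qCoord (hQ : IsCompl Q.1 L₀.1) (b : Basis (Fin n) ℝ Q.1) :
    V →ₗ[ℝ] EuclideanSpace ℝ (Fin n) :=
  (euclid b).toLinearMap.comp (Q.1.projectionOnto L₀.1 hQ)

/-- The momentum coordinates of a vector `u` of `V`: the linear function `ω(·, u)` on `Q`. -/
noncomputable def pCoord (b : Basis (Fin n) ℝ Q.1) : V →ₗ[ℝ] EuclideanSpace ℝ (Fin n) :=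
  (WithLp.linearEquiv 2 ℝ (Fin n → ℝ)).symm.toLinearMap.comp (LinearMap.pi fun i => ω (b i))

theorem qCoord_apply (hQ : IsCompl Q.1 L₀.1) (b : Basis (Fin n) ℝ Q.1) (u : V) :
    qCoord hQ b u = euclid b (Q.1.projectionOnto L₀.1 hQ u) := rfl

theorem inner_pCoord (b : Basis (Fin n) ℝ Q.1) (u : V) (x : Q.1) :
    inner ℝ (pCoord b u) (euclid b x) = ω x u := by
  have h : ∀ i, pCoord b u i = ω (b i) u := fun i => rfl
  rw [PiLp.inner_apply]
  have hx : (x : V) = ∑ i, b.repr x i • (b i : V) := by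
    conv_lhs => rw [← b.sum_repr x]
    simp only [Submodule.coe_sum, Submodule.coe_smul]
  rw [hx]
  simp [h, euclid_apply]

theorem inner_pCoord_sub (hω : ω.IsAlt) (hQ : IsCompl Q.1 L₀.1) (b : Basis (Fin n) ℝ Q.1)
    (u v : V) :
    inner ℝ (pCoord b v) (qCoord hQ b u) - inner ℝ (pCoord b u) (qCoord hQ b v) = ω u v := by
  rw [qCoord_apply, qCoord_apply, inner_pCoord, inner_pCoord, ← omega_projection hQ _ v,
    ← omega_projection hQ _ u]
  have h : ∀ u : V, u = (Q.1.projectionOnto L₀.1 hQ u : V) + L₀.1.projectionOnto Q.1 hQ.symm u :=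
    fun u => (Submodule.projection_add_projection_eq_self hQ u).symm
  conv_rhs => rw [h u, h v]
  simp only [map_add, LinearMap.add_apply]
  rw [Q.isotropic (Q.1.projectionOnto L₀.1 hQ u).2 (Q.1.projectionOnto L₀.1 hQ v).2,
    L₀.isotropic (L₀.1.projectionOnto Q.1 hQ.symm u).2 (L₀.1.projectionOnto Q.1 hQ.symm v).2,
    ← hω.neg_eq (L₀.1.projectionOnto Q.1 hQ.symm u : V)]
  ring

/-- The position and momentum coordinates together; this is an isomorphism of `V` with the standard
symplectic space `ℝⁿ × ℝⁿ`. -/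
noncomputable def phaseCoord (hQ : IsCompl Q.1 L₀.1) (b : Basis (Fin n) ℝ Q.1) :
    V →ₗ[ℝ] EuclideanSpace ℝ (Fin n) × EuclideanSpace ℝ (Fin n) :=
  (qCoord hQ b).prod (pCoord b)

theorem phaseCoord_injective (hω : ω.IsAlt) (hnd : ω.Nondegenerate) (hQ : IsCompl Q.1 L₀.1)
    (b : Basis (Fin n) ℝ Q.1) : Function.Injective (phaseCoord hQ b) := by
  rw [← LinearMap.ker_eq_bot, LinearMap.ker_eq_bot']
  intro u hu
  have hq : qCoord hQ b u = 0 := congrArg Prod.fst hu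
  have hp : pCoord b u = 0 := congrArg Prod.snd hu
  refine hnd.1 u fun v => ?_
  rw [← inner_pCoord_sub hω hQ b u v, hq, hp]
  simp

/-- A lagrangian subspace of `V`, in position and momentum coordinates. -/
noncomputable def LagGr.pairs (hQ : IsCompl Q.1 L₀.1) (b : Basis (Fin n) ℝ Q.1) (L : LagGr ω) :
    Submodule ℝ (EuclideanSpace ℝ (Fin n) × EuclideanSpace ℝ (Fin n)) :=
  L.1.map (phaseCoord hQ b)

theorem LagGr.isLagrangianPair (hn : finrank ℝ V = 2 * n) (hω : ω.IsAlt) (hnd : ω.Nondegenerate)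
    (hQ : IsCompl Q.1 L₀.1) (b : Basis (Fin n) ℝ Q.1) (L : LagGr ω) :
    IsLagrangianPair (LagGr.pairs hQ b L) := by
  intro q p
  have hinj := phaseCoord_injective hω hnd hQ b
  have hsurj : Function.Surjective (phaseCoord hQ b) := by
    refine (LinearMap.injective_iff_surjective_of_finrank_eq_finrank ?_).1 hinj
    rw [hn]
    simp [two_mul]
  obtain ⟨u, hu⟩ := hsurj (q, p)
  obtain ⟨rfl, rfl⟩ : qCoord hQ b u = q ∧ pCoord b u = p := Prod.mk.inj hu
  constructor
  · rintro ⟨u', hu', he⟩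
    obtain rfl := hinj (he.trans hu.symm)
    rintro _ ⟨v, hv, rfl⟩
    have := L.isotropic hu' hv
    rw [← inner_pCoord_sub hω hQ b] at this
    exact sub_eq_zero.1 this
  · intro h
    refine ⟨u, (L.mem_iff u).2 fun v hv => ?_, rfl⟩
    have := h _ ⟨v, hv, rfl⟩
    rw [← inner_pCoord_sub hω hQ b]
    exact sub_eq_zero.2 this.symm

/-- The function which expresses a test half-density on `Q` in the coordinates attached to `b`. -/
noncomputable def coordFn (b : Basis (Fin n) ℝ Q.1) :
    TestHalfDensity n Q.1 →ₗ[ℂ] (EuclideanSpace ℝ (Fin n) → ℂ) where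
  toFun g := fun x => Density.evalCLM (1 / 2) b (g ((euclid b).symm x))
  map_add' f g := by
    ext x
    exact map_add (Density.evalCLM (1 / 2) b) (f _) (g _)
  map_smul' c f := by
    ext x
    exact map_smul (Density.evalCLM (1 / 2) b) c (f _)

theorem coordFn_apply (b : Basis (Fin n) ℝ Q.1) (g : TestHalfDensity n Q.1)
    (x : EuclideanSpace ℝ (Fin n)) : coordFn b g x = g ((euclid b).symm x) b := rfl

theorem isTest_coordFn (b : Basis (Fin n) ℝ Q.1) (g : TestHalfDensity n Q.1) :
    IsTest (coordFn b g) := by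
  refine ⟨?_, ?_⟩
  · exact ((Density.evalCLM (1 / 2) b).restrictScalars ℝ).contDiff.comp
      (g.contDiff.comp (euclid b).symm.contDiff)
  · exact (g.hasCompactSupport.comp_homeomorph (euclid b).symm.toHomeomorph).comp_left
      (map_zero (Density.evalCLM (1 / 2) b))

theorem exists_coordFn_eq (b : Basis (Fin n) ℝ Q.1) {f : EuclideanSpace ℝ (Fin n) → ℂ}
    (hf : IsTest f) : ∃ g, coordFn b g = f := by
  let g : TestHalfDensity n Q.1 :=
    { toFun := fun x => f (euclid b x) • Density.ofBasis (1 / 2) b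
      contDiff' := (hf.1.comp (euclid b).contDiff).smul contDiff_const
      hasCompactSupport' := (hf.2.comp_homeomorph (euclid b).toHomeomorph).smul_right
      tsupport_subset' := fun _ _ => trivial }
  refine ⟨g, funext fun x => ?_⟩
  rw [coordFn_apply]
  change (f (euclid b ((euclid b).symm x)) • Density.ofBasis (1 / 2) b) b = _
  rw [Density.smul_apply_basis, Density.ofBasis_self, mul_one,
    ContinuousLinearEquiv.apply_symm_apply]

theorem coordFn_injective (b : Basis (Fin n) ℝ Q.1) : Function.Injective (coordFn b) := by
  intro f g h
  ext x
  refine Density.ext_basis b ?_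
  have := congrFun h (euclid b x)
  simpa [coordFn_apply] using this

/-- The transposed Schrödinger operators in coordinates. -/
theorem coordFn_schrodingerTranspose (hQ : IsCompl Q.1 L₀.1) (b : Basis (Fin n) ℝ Q.1) (u : V)
    (g : TestHalfDensity n Q.1) : coordFn b (schrodingerTranspose hQ n u g) = fun x =>
      Complex.I * fderiv ℝ (coordFn b g) x (qCoord hQ b u) +
        (inner ℝ (pCoord b u) x : ℝ) * coordFn b g x := by
  ext x
  have h1 : coordFn b (mulLinear ω n Q.1 (L₀.1.projectionOnto Q.1 hQ.symm u) g) x =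
      (inner ℝ (pCoord b u) x : ℝ) * coordFn b g x := by
    obtain ⟨y, rfl⟩ := (euclid b).surjective x
    rw [inner_pCoord, ← omega_projection hQ, coordFn_apply, coordFn_apply,
      ContinuousLinearEquiv.symm_apply_apply]
    rfl
  have h2 : coordFn b (TestFunction.lineDerivCLM ℂ (Q.1.projectionOnto L₀.1 hQ u) g) x =
      fderiv ℝ (coordFn b g) x (qCoord hQ b u) := by
    have hg : HasFDerivAt g (fderiv ℝ g ((euclid b).symm x)) ((euclid b).symm x) :=
      (g.contDiff.differentiable (by simp) _).hasFDerivAt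
    have h3 : HasFDerivAt (coordFn b g) _ x :=
      (((Density.evalCLM (1 / 2) b).restrictScalars ℝ).hasFDerivAt.comp _ hg).comp x
        (euclid b).symm.hasFDerivAt
    rw [h3.fderiv, coordFn_apply, TestFunction.lineDerivCLM_eq_fderivCLM,
      TestFunction.fderivCLM_apply, if_pos (by simp)]
    simp only [ContinuousLinearMap.comp_apply, qCoord_apply]
    change _ = Density.evalCLM (1 / 2) b (fderiv ℝ g ((euclid b).symm x)
      ((euclid b).symm (euclid b _)))
    rw [ContinuousLinearEquiv.symm_apply_apply]
    rfl
  rw [← h1, ← h2, schrodingerTranspose]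
  simp only [LinearMap.add_apply, LinearMap.smul_apply, map_add, map_smul, Pi.add_apply,
    Pi.smul_apply, smul_eq_mul]
  rfl

/-- Linear functionals, not assumed to be continuous, which solve the equations of `L` are
controlled by their value at one half-density `g₀`, uniformly on half-densities supported in a
compact set. -/
theorem exists_eq_mul_of_schrodinger (hn : finrank ℝ V = 2 * n) (hω : ω.IsAlt)
    (hnd : ω.Nondegenerate) (hQ : IsCompl Q.1 L₀.1) (b : Basis (Fin n) ℝ Q.1) (L : LagGr ω) :
    ∃ g₀ : TestHalfDensity n Q.1, ∀ K : TopologicalSpace.Compacts Q.1, ∃ C, 0 ≤ C ∧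
      ∀ g : TestHalfDensity n Q.1, (∀ x, g x ≠ 0 → x ∈ K) → ∀ M, 0 ≤ M → (∀ x, ‖g x‖ ≤ M) →
        ∃ c : ℂ, ‖c‖ ≤ C * M ∧ ∀ ℓ : TestHalfDensity n Q.1 →ₗ[ℂ] ℂ,
          (∀ u ∈ L.1, ∀ h, ℓ (schrodingerTranspose hQ n u h) = 0) → ℓ g = c * ℓ g₀ := by
  obtain ⟨f₀, hf₀, h⟩ := SolvesSchrodinger.exists_eq_mul (LagGr.isLagrangianPair hn hω hnd hQ b L)
  obtain ⟨g₀, rfl⟩ := exists_coordFn_eq b hf₀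
  obtain ⟨T, hT⟩ := (coordFn b).exists_leftInverse_of_injective
    (LinearMap.ker_eq_bot.2 (coordFn_injective b))
  have hT' : ∀ g, T (coordFn b g) = g := fun g => LinearMap.congr_fun hT g
  refine ⟨g₀, fun K => ?_⟩
  obtain ⟨r, hr⟩ : ∃ r, ∀ x ∈ K, ‖euclid b x‖ ≤ r :=
    K.isCompact.exists_bound_of_continuousOn (euclid b).continuous.continuousOn
  obtain ⟨C, hC, hC'⟩ := h r
  refine ⟨C * ‖Density.evalCLM (1 / 2) b‖, by positivity, fun g hgK M hM hgM => ?_⟩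
  have hsupp : ∀ x, coordFn b g x ≠ 0 → ‖x‖ ≤ r := fun x hx => by
    have h1 : (euclid b).symm x ∈ K := hgK _ fun h0 => hx (by
      rw [coordFn_apply, h0]
      rfl)
    simpa using hr _ h1
  have hbound : ∀ x, ‖coordFn b g x‖ ≤ ‖Density.evalCLM (1 / 2) b‖ * M := fun x =>
    ((Density.evalCLM (1 / 2) b).le_opNorm _).trans (by gcongr; exact hgM _)
  obtain ⟨c, hc, hcθ⟩ := hC' (coordFn b g) (isTest_coordFn b g).1 hsupp _ (by positivity) hbound
  refine ⟨c, hc.trans_eq (mul_assoc _ _ _).symm, fun ℓ hℓ => ?_⟩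
  have hsolve : SolvesSchrodinger (LagGr.pairs hQ b L) (ℓ.comp T) := by
    rintro _ ⟨u, hu, rfl⟩ f hf
    obtain ⟨k, rfl⟩ := exists_coordFn_eq b hf
    have h3 := coordFn_schrodingerTranspose hQ b u k
    change (ℓ.comp T) (fun x => Complex.I * fderiv ℝ (coordFn b k) x (qCoord hQ b u) +
      (inner ℝ (pCoord b u) x : ℝ) * coordFn b k x) = 0
    rw [← h3, LinearMap.comp_apply, hT', hℓ u hu]
  simpa [hT'] using hcθ (ℓ.comp T) hsolve

/-- The continuity required of distributions follows from the equations of `L`. -/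
theorem continuous_of_schrodinger (hn : finrank ℝ V = 2 * n) (hω : ω.IsAlt)
    (hnd : ω.Nondegenerate) (hQ : IsCompl Q.1 L₀.1) (b : Basis (Fin n) ℝ Q.1) (L : LagGr ω)
    (ℓ : TestHalfDensity n Q.1 →ₗ[ℂ] ℂ)
    (hℓ : ∀ u ∈ L.1, ∀ h, ℓ (schrodingerTranspose hQ n u h) = 0) : Continuous ℓ := by
  obtain ⟨g₀, h⟩ := exists_eq_mul_of_schrodinger hn hω hnd hQ b L
  refine TestFunction.continuous_of_norm_le ℓ fun K => ?_
  obtain ⟨C, hC, hK⟩ := h K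
  refine ⟨C * ‖ℓ g₀‖, by positivity, fun g hg M hM hgM => ?_⟩
  obtain ⟨c, hc, hcℓ⟩ := hK g hg M hM hgM
  rw [hcℓ ℓ hℓ, norm_mul, mul_right_comm]
  gcongr

theorem exists_smul_eq_of_pureSpinors (hn : finrank ℝ V = 2 * n) (hω : ω.IsAlt)
    (hnd : ω.Nondegenerate) (hQ : IsCompl Q.1 L₀.1) (b : Basis (Fin n) ℝ Q.1) (L : LagGr ω)
    (θ₁ θ : pureSpinors hQ n L) (h1 : θ₁ ≠ 0) : ∃ c : ℂ, c • θ₁ = θ := by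
  obtain ⟨g₀, h⟩ := exists_eq_mul_of_schrodinger hn hω hnd hQ b L
  have key : ∀ g : TestHalfDensity n Q.1, ∃ c : ℂ, ∀ θ : pureSpinors hQ n L,
      θ.1 g = c * θ.1 g₀ := by
    intro g
    obtain ⟨C, hC, hK⟩ := h ⟨tsupport g, g.hasCompactSupport⟩
    obtain ⟨M, hM⟩ := g.continuous.bounded_above_of_compact_support g.hasCompactSupport
    obtain ⟨c, -, hc⟩ := hK g (fun x hx => subset_tsupport g hx) M
      ((norm_nonneg _).trans (hM 0)) hM
    exact ⟨c, fun θ => hc θ.1.toLinearMap θ.2⟩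
  have h0 : θ₁.1 g₀ ≠ 0 := fun h0 => h1 (Subtype.ext (ContinuousLinearMap.ext fun g => by
    obtain ⟨c, hc⟩ := key g
    rw [hc θ₁, h0, mul_zero]
    rfl))
  refine ⟨θ.1 g₀ / θ₁.1 g₀, Subtype.ext (ContinuousLinearMap.ext fun g => ?_)⟩
  obtain ⟨c, hc⟩ := key g
  change θ.1 g₀ / θ₁.1 g₀ * θ₁.1 g = θ.1 g
  rw [hc θ₁, hc θ]
  field_simp

end

/-! ### Canonical charts and the averaged spinors -/

section

variable {V : Type*} [AddCommGroup V] [Module ℝ V] {ω : LinearMap.BilinForm ℝ V} {n : ℕ}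

/-- The parametrization of `lagChart β A` by the coordinates with respect to `graphVec β A`. -/
noncomputable def frameMap (β : SymplecticBasis ω n) (A : SymMat n) :
    EuclideanSpace ℝ (Fin n) →ₗ[ℝ] V :=
  (Fintype.linearCombination ℝ (graphVec β A)).comp
    (WithLp.linearEquiv 2 ℝ (Fin n → ℝ)).toLinearMap

theorem frameMap_apply (β : SymplecticBasis ω n) (A : SymMat n) (t : EuclideanSpace ℝ (Fin n)) :
    frameMap β A t = ∑ i, t i • graphVec β A i := rfl

theorem range_frameMap (β : SymplecticBasis ω n) (A : SymMat n) :
    LinearMap.range (frameMap β A) = (lagChart β A).1 := by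
  rw [frameMap, LinearMap.range_comp_of_range_eq_top _ (LinearEquiv.range _),
    Fintype.range_linearCombination]
  rfl

theorem frameMap_mem (β : SymplecticBasis ω n) (A : SymMat n) (t : EuclideanSpace ℝ (Fin n)) :
    frameMap β A t ∈ (lagChart β A).1 := by
  rw [← range_frameMap]
  exact ⟨t, rfl⟩

theorem mem_lagChart_iff (β : SymplecticBasis ω n) (A : SymMat n) (u : V) :
    u ∈ (lagChart β A).1 ↔ ∃ t, frameMap β A t = u := by
  rw [← range_frameMap]
  rfl

/-- The part of `frameMap` which is linear in the matrix. -/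
noncomputable def frameMapLin (β : SymplecticBasis ω n) :
    SymMat n →ₗ[ℝ] EuclideanSpace ℝ (Fin n) →ₗ[ℝ] V :=
  LinearMap.mk₂ ℝ (fun A t => ∑ i, t i • ∑ j, A s(i, j) • β.basis (.inr j))
    (fun A B t => by simp [add_smul, Finset.sum_add_distrib])
    (fun c A t => by
      simp only [Pi.smul_apply, smul_eq_mul, mul_smul, ← Finset.smul_sum]
      simp only [Finset.smul_sum, smul_comm c])
    (fun A s t => by simp [add_smul, Finset.sum_add_distrib])
    (fun c A t => by simp [mul_smul, ← Finset.smul_sum])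

theorem frameMap_eq_add (β : SymplecticBasis ω n) (A : SymMat n) :
    frameMap β A = frameMap β 0 + frameMapLin β A := by
  ext t
  simp [frameMap_apply, graphVec, frameMapLin, Finset.sum_add_distrib]

/-- The first half of the coordinates with respect to a canonical basis. -/
noncomputable def fstCoord (β : SymplecticBasis ω n) : V →ₗ[ℝ] EuclideanSpace ℝ (Fin n) :=
  (WithLp.linearEquiv 2 ℝ (Fin n → ℝ)).symm.toLinearMap.comp
    (LinearMap.pi fun i => β.basis.coord (.inl i))

theorem fstCoord_apply (β : SymplecticBasis ω n) (u : V) (i : Fin n) :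
    fstCoord β u i = β.basis.repr u (.inl i) := rfl

theorem fstCoord_frameMap (β : SymplecticBasis ω n) (A : SymMat n)
    (t : EuclideanSpace ℝ (Fin n)) : fstCoord β (frameMap β A t) = t := by
  ext i
  rw [fstCoord_apply, frameMap_apply]
  simp [graphVec, Finsupp.single_apply, Finsupp.finsetSum_apply]

theorem frameMap_injective (β : SymplecticBasis ω n) (A : SymMat n) :
    Function.Injective (frameMap β A) :=
  Function.LeftInverse.injective (fstCoord_frameMap β A)

theorem repr_inr_frameMap (β : SymplecticBasis ω n) (A : SymMat n)
    (t : EuclideanSpace ℝ (Fin n)) (j : Fin n) :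
    β.basis.repr (frameMap β A t) (.inr j) = ∑ i, t i * A s(i, j) := by
  rw [frameMap_apply]
  simp [graphVec, Finsupp.single_apply, Finsupp.finsetSum_apply]

theorem lagChart_injective (β : SymplecticBasis ω n) : Function.Injective (lagChart β) := by
  intro A B h
  ext z
  induction z using Sym2.inductionOn with
  | hf i j =>
    have h1 := frameMap_mem β A (EuclideanSpace.single i 1)
    rw [h, mem_lagChart_iff] at h1
    obtain ⟨t, ht⟩ := h1
    have h2 := congrArg (fstCoord β) ht
    rw [fstCoord_frameMap, fstCoord_frameMap] at h2
    subst h2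
    have h3 := congrArg (fun u => β.basis.repr u (.inr j)) ht
    simp only [repr_inr_frameMap] at h3
    simpa using h3.symm

theorem lagCoord_lagChart (β : SymplecticBasis ω n) (A : SymMat n) :
    lagCoord β (lagChart β A) = A :=
  Function.leftInverse_invFun (lagChart_injective β) A

/-- The linear coordinates of the vectors of `lagChart β A` depend affinely on `A`. -/
theorem exists_comp_frameMap_eq (β : SymplecticBasis ω n)
    (T : V →ₗ[ℝ] EuclideanSpace ℝ (Fin n)) :
    ∃ T₁ : SymMat n →L[ℝ] EuclideanSpace ℝ (Fin n) →L[ℝ] EuclideanSpace ℝ (Fin n), ∀ A,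
      (T.comp (frameMap β A)).toContinuousLinearMap =
        (T.comp (frameMap β 0)).toContinuousLinearMap + T₁ A := by
  refine ⟨LinearMap.toContinuousLinearMap (LinearMap.toContinuousLinearMap.toLinearMap.comp
    ((frameMapLin β).compr₂ T)), fun A => ?_⟩
  rw [frameMap_eq_add]
  ext t : 1
  simp

end

section

variable {V : Type*} [NormedAddCommGroup V] [NormedSpace ℝ V] [FiniteDimensional ℝ V]
  {ω : LinearMap.BilinForm ℝ V} {n : ℕ} {L₀ Q : LagGr ω}

theorem LagGr.finrank_eq (hn : finrank ℝ V = 2 * n) (hnd : ω.Nondegenerate)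
    (L : LagGr ω) : finrank ℝ L.1 = n := by
  have h := LinearMap.BilinForm.finrank_orthogonal hnd L.1
  rw [L.2, hn] at h
  have := Submodule.finrank_le L.1
  omega

/-- Every lagrangian subspace is the centre of a canonical chart. -/
theorem exists_lagChart_zero_eq (hn : finrank ℝ V = 2 * n) (hω : ω.IsAlt) (hnd : ω.Nondegenerate)
    (L : LagGr ω) : ∃ β : SymplecticBasis ω n, lagChart β 0 = L := by
  have hL := L.finrank_eq hn hnd
  let e : Basis (Fin n) ℝ L.1 := finBasisOfFinrankEq ℝ L.1 hL
  have hneg : ∀ u v, ω u v = - ω v u := fun u v => (hω.neg_eq v u).symm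
  let T : V →ₗ[ℝ] (Fin n → ℝ) := LinearMap.pi fun i => ω (e i)
  have hker : LinearMap.ker T = L.1 := by
    ext v
    rw [LinearMap.mem_ker, L.mem_iff]
    constructor
    · intro h u hu
      have h1 : ∀ i, ω (e i) v = 0 := fun i => congrFun h i
      have h2 : (LinearMap.flip ω v).comp L.1.subtype = 0 := e.ext h1
      exact LinearMap.congr_fun h2 ⟨u, hu⟩
    · intro h
      ext i
      exact h _ (e i).2
  have hsurj : Function.Surjective T := by
    rw [← LinearMap.range_eq_top]
    apply Submodule.eq_top_of_finrank_eq
    have h := T.finrank_range_add_finrank_ker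
    rw [hker, hL, hn] at h
    rw [finrank_fin_fun]
    omega
  choose w hw using fun j : Fin n => hsurj (Pi.single j 1)
  have hew : ∀ i j, ω (e i) (w j) = if i = j then 1 else 0 := fun i j => by
    have := congrFun (hw j) i
    rw [Pi.single_apply] at this
    exact this
  have hee : ∀ i j, ω (e i) (e j) = 0 := fun i j => L.isotropic (e i).2 (e j).2
  -- The correction of the `w j` by vectors of `L` makes the pairings of the `f j` vanish.
  let f : Fin n → V := fun j => w j + ∑ k, (-(ω (w j) (w k)) / 2) • (e k : V)
  have hef : ∀ i j, ω (e i) (f j) = if i = j then 1 else 0 := fun i j => by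
    simp [f, hew, hee]
  have hff : ∀ i j, ω (f i) (f j) = 0 := fun i j => by
    have h1 : ω (w i) (f j) = ω (w i) (w j) / 2 := by
      have : ∀ k, ω (w i) (e k) = - if k = i then 1 else 0 := fun k => by rw [hneg, hew]
      simp only [f, map_add, map_sum, map_smul, smul_eq_mul, this]
      simp
      rw [hneg (w j) (w i)]
      ring
    have h2 : ω (f i) = ω (w i) + ∑ k, (-(ω (w i) (w k)) / 2) • ω (e k) := by simp [f]
    rw [h2, LinearMap.add_apply, h1]
    simp [hef]
    ring
  have hli : LinearIndependent ℝ (Sum.elim (fun i => (e i : V)) f) := by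
    rw [Fintype.linearIndependent_iff]
    intro c hc
    rw [Fintype.sum_sum_type] at hc
    simp only [Sum.elim_inl, Sum.elim_inr] at hc
    have h1 : ∀ i, c (.inr i) = 0 := fun i => by
      have := congrArg (ω (e i)) hc
      simpa [hee, hef] using this
    have h2 : ∀ i, c (.inl i) = 0 := fun i => by
      have := congrArg (fun v => ω v (f i)) hc
      simpa [hff, hef] using this
    rintro (i | i)
    · exact h2 i
    · exact h1 i
  let B : Basis (Fin n ⊕ Fin n) ℝ V := basisOfLinearIndependentOfCardEqFinrank' _ hli
    (by rw [hn]; simp [two_mul])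
  have hB1 : ∀ i, B (.inl i) = e i := fun i => by simp [B]
  have hB2 : ∀ i, B (.inr i) = f i := fun i => by simp [B]
  refine ⟨⟨B, ?_, ?_, ?_, ?_⟩, ?_⟩
  · intro i j; rw [hB1, hB1, hee]
  · intro i j; rw [hB2, hB2, hff]
  · intro i j; rw [hB1, hB2, hef]
  · intro i j
    rw [hB1, hB2, hneg, hef]
    simp only [eq_comm (a := j)]
    split_ifs <;> simp
  · apply Subtype.ext
    simp only [lagChart]
    have h1 : ∀ β : SymplecticBasis ω n, graphVec β 0 = fun i => β.basis (.inl i) := fun β => by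
      ext i
      simp [graphVec]
    rw [h1]
    simp only [hB1]
    have h2 : Set.range (fun i => (e i : V)) = L.1.subtype '' Set.range e := by
      rw [← Set.range_comp]
      rfl
    rw [h2, ← Submodule.map_span, e.span_eq, Submodule.map_top, Submodule.range_subtype]

/-- The position coordinates of the vector `frameMap β A t` of `lagChart β A`, as a linear map in
`t`. -/
noncomputable def qMap (hQ : IsCompl Q.1 L₀.1) (b : Basis (Fin n) ℝ Q.1) (β : SymplecticBasis ω n)
    (A : SymMat n) : EuclideanSpace ℝ (Fin n) →L[ℝ] EuclideanSpace ℝ (Fin n) :=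
  ((qCoord hQ b).comp (frameMap β A)).toContinuousLinearMap

/-- The momentum coordinates of the vector `frameMap β A t` of `lagChart β A`, as a linear map in
`t`. -/
noncomputable def pMap (b : Basis (Fin n) ℝ Q.1) (β : SymplecticBasis ω n)
    (A : SymMat n) : EuclideanSpace ℝ (Fin n) →L[ℝ] EuclideanSpace ℝ (Fin n) :=
  ((pCoord b).comp (frameMap β A)).toContinuousLinearMap

theorem qMap_apply (hQ : IsCompl Q.1 L₀.1) (b : Basis (Fin n) ℝ Q.1) (β : SymplecticBasis ω n)
    (A : SymMat n) (t) : qMap hQ b β A t = qCoord hQ b (frameMap β A t) := rfl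

theorem inner_pMap_qMap (hω : ω.IsAlt) (hQ : IsCompl Q.1 L₀.1) (b : Basis (Fin n) ℝ Q.1)
    (β : SymplecticBasis ω n) (A : SymMat n) (s t : EuclideanSpace ℝ (Fin n)) :
    inner ℝ (pMap b β A s) (qMap hQ b β A t) = inner ℝ (pMap b β A t) (qMap hQ b β A s) := by
  have := inner_pCoord_sub hω hQ b (frameMap β A t) (frameMap β A s)
  rw [(lagChart β A).isotropic (frameMap_mem β A t) (frameMap_mem β A s)] at this
  exact sub_eq_zero.1 this

/-- The position and momentum coordinates bound the parameters `t`, uniformly in `A`: the first half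
of the coordinates with respect to `β` recovers `t` from `frameMap β A t`, whatever `A` is. -/
theorem exists_norm_le_qMap_pMap (hω : ω.IsAlt) (hnd : ω.Nondegenerate) (hQ : IsCompl Q.1 L₀.1)
    (b : Basis (Fin n) ℝ Q.1) (β : SymplecticBasis ω n) : ∃ c : ℝ, 0 ≤ c ∧ ∀ A t,
      ‖t‖ ≤ c * (‖qMap hQ b β A t‖ + ‖pMap b β A t‖) := by
  obtain ⟨T, hT⟩ := (phaseCoord hQ b).exists_leftInverse_of_injective
    (LinearMap.ker_eq_bot.2 (phaseCoord_injective hω hnd hQ b))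
  let S := ((fstCoord β).comp T).toContinuousLinearMap
  refine ⟨‖S‖, norm_nonneg _, fun A t => ?_⟩
  have h1 : S (phaseCoord hQ b (frameMap β A t)) = t := by
    have : T (phaseCoord hQ b (frameMap β A t)) = frameMap β A t := LinearMap.congr_fun hT _
    change fstCoord β (T (phaseCoord hQ b (frameMap β A t))) = t
    rw [this, fstCoord_frameMap]
  conv_lhs => rw [← h1]
  refine (S.le_opNorm _).trans ?_
  gcongr
  exact max_le (le_add_of_nonneg_right (norm_nonneg _)) (le_add_of_nonneg_left (norm_nonneg _))

/-- The Gaussian averages form a nowhere vanishing smooth section of `E` over each chart. -/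
theorem exists_averageSpinor (hn : finrank ℝ V = 2 * n) (hω : ω.IsAlt) (hnd : ω.Nondegenerate)
    (hQ : IsCompl Q.1 L₀.1) (b : Basis (Fin n) ℝ Q.1) (β : SymplecticBasis ω n) :
    ∃ e : ∀ A, pureSpinors hQ n (lagChart β A),
      (∀ A g, (e A).1 g = heisenbergAverage (qMap hQ b β A) (pMap b β A) (coordFn b g)) ∧
      (∀ A, e A ≠ 0) ∧ ∀ g, ContDiff ℝ (⊤ : ℕ∞) fun A => (e A).1 g := by
  obtain ⟨c, hc, hb⟩ := exists_norm_le_qMap_pMap hω hnd hQ b β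
  have hex : ∀ A, ∃ θ : pureSpinors hQ n (lagChart β A), ∀ g,
      θ.1 g = heisenbergAverage (qMap hQ b β A) (pMap b β A) (coordFn b g) := by
    intro A
    let ℓ : TestHalfDensity n Q.1 →ₗ[ℂ] ℂ :=
      { toFun := fun g => heisenbergAverage (qMap hQ b β A) (pMap b β A) (coordFn b g)
        map_add' := fun f g => by
          have hf := isTest_coordFn b f
          have hg := isTest_coordFn b g
          rw [map_add]
          simp only [heisenbergAverage]
          rw [← integral_add (hf.integrable_wavePairing hc (hb A))
            (hg.integrable_wavePairing hc (hb A))]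
          congr 1
          ext t
          have hi : ∀ {f : EuclideanSpace ℝ (Fin n) → ℂ}, IsTest f →
              Integrable fun x => f x * gaussWave (qMap hQ b β A t) (pMap b β A t) x :=
            fun {f} hf => (hf.1.continuous.mul (continuous_const.gaussWave continuous_const
              continuous_id)).integrable_of_hasCompactSupport hf.2.mul_right
          simp only [wavePairing, Pi.add_apply, add_mul]
          exact integral_add (hi hf) (hi hg)
        map_smul' := fun a f => by
          rw [map_smul]
          simp only [heisenbergAverage, wavePairing, Pi.smul_apply, smul_eq_mul, mul_assoc,
            integral_const_mul, RingHom.id_apply] }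
    have hℓ : ∀ u ∈ (lagChart β A).1, ∀ h, ℓ (schrodingerTranspose hQ n u h) = 0 := by
      intro u hu h
      obtain ⟨t, rfl⟩ := (mem_lagChart_iff β A u).1 hu
      change heisenbergAverage _ _ (coordFn b (schrodingerTranspose hQ n _ h)) = 0
      rw [coordFn_schrodingerTranspose]
      exact (isTest_coordFn b h).heisenbergAverage_schrodinger hc (hb A)
        (inner_pMap_qMap hω hQ b β A) t
    exact ⟨⟨⟨ℓ, continuous_of_schrodinger hn hω hnd hQ b _ ℓ hℓ⟩, hℓ⟩, fun g => rfl⟩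
  choose e he using hex
  refine ⟨e, he, fun A h0 => ?_, fun g => ?_⟩
  · obtain ⟨f, hf, hf0⟩ := exists_heisenbergAverage_ne_zero hc (hb A)
    obtain ⟨g, rfl⟩ := exists_coordFn_eq b hf
    rw [← he A g, h0] at hf0
    exact hf0 rfl
  · simp_rw [he]
    obtain ⟨q₁, hq₁⟩ := exists_comp_frameMap_eq β (qCoord hQ b)
    obtain ⟨p₁, hp₁⟩ := exists_comp_frameMap_eq β (pCoord b)
    have h1 : ∀ A, qMap hQ b β A = qMap hQ b β 0 + q₁ A := hq₁
    have h2 : ∀ A, pMap b β A = pMap b β 0 + p₁ A := hp₁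
    have h3 : (fun A => heisenbergAverage (qMap hQ b β A) (pMap b β A) (coordFn b g)) = fun A =>
        heisenbergAverage (qMap hQ b β 0 + q₁ A) (pMap b β 0 + p₁ A) (coordFn b g) :=
      funext fun A => by rw [h1 A, h2 A]
    rw [h3]
    refine (isTest_coordFn b g).contDiff_heisenbergAverage _ _ q₁ p₁ hc fun A t => ?_
    rw [← h1, ← h2]
    exact hb A t

end

/-! ### The line bundle of pure symplectic spinors and the evaluation at the origin -/

theorem exists_linearMap_smul_eq {E F : Type*} [AddCommGroup E] [Module ℂ E] [AddCommGroup F]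
    [Module ℂ F] {e : E} (he : e ≠ 0) (v : F) : ∃ φ : E →ₗ[ℂ] F, ∀ c : ℂ, φ (c • e) = c • v := by
  obtain ⟨T, hT⟩ := (LinearMap.toSpanSingleton ℂ E e).exists_leftInverse_of_injective
    (LinearMap.ker_toSpanSingleton ℂ he)
  have hT1 : ∀ c : ℂ, T (c • e) = c := fun c => LinearMap.congr_fun hT c
  exact ⟨T.smulRight v, fun c => by rw [LinearMap.smulRight_apply, hT1]⟩

section

variable {V : Type*} [NormedAddCommGroup V] [NormedSpace ℝ V] [FiniteDimensional ℝ V]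
  {ω : LinearMap.BilinForm ℝ V} {n : ℕ} {L₀ Q : LagGr ω}

/-- The equation of the Maslov cycle in a chart: the determinant of the position coordinates. -/
noncomputable def maslovDet (hQ : IsCompl Q.1 L₀.1) (b : Basis (Fin n) ℝ Q.1)
    (β : SymplecticBasis ω n) (A : SymMat n) : ℝ :=
  LinearMap.det (qMap hQ b β A : EuclideanSpace ℝ (Fin n) →ₗ[ℝ] EuclideanSpace ℝ (Fin n))

theorem maslovDet_ne_zero_iff (hQ : IsCompl Q.1 L₀.1) (b : Basis (Fin n) ℝ Q.1)
    (β : SymplecticBasis ω n) (A : SymMat n) :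
    maslovDet hQ b β A ≠ 0 ↔ lagChart β A ∉ maslovCycle L₀ := by
  have hq : ∀ u, qCoord hQ b u = 0 ↔ u ∈ L₀.1 := fun u => by
    rw [qCoord_apply, map_eq_zero_iff _ (euclid b).injective,
      Submodule.projectionOnto_apply_eq_zero_iff]
  rw [maslovDet, ← isUnit_iff_ne_zero, ← LinearMap.isUnit_iff_isUnit_det,
    LinearMap.isUnit_iff_ker_eq_bot]
  simp only [maslovCycle, Set.mem_ofPred_eq, not_not]
  rw [LinearMap.ker_eq_bot', Submodule.eq_bot_iff]
  constructor
  · rintro h u ⟨hu, hu0⟩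
    obtain ⟨t, rfl⟩ := (mem_lagChart_iff β A u).1 hu
    rw [h t ((hq _).2 hu0), map_zero]
  · intro h t ht
    have := h (frameMap β A t) ⟨frameMap_mem β A t, (hq _).1 ht⟩
    exact (map_eq_zero_iff _ (frameMap_injective β A)).1 this

theorem exists_equiv_of_maslovDet_ne_zero {hQ : IsCompl Q.1 L₀.1} {b : Basis (Fin n) ℝ Q.1}
    {β : SymplecticBasis ω n} {A : SymMat n} (h : maslovDet hQ b β A ≠ 0) :
    ∃ q : EuclideanSpace ℝ (Fin n) ≃L[ℝ] EuclideanSpace ℝ (Fin n),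
      (q : EuclideanSpace ℝ (Fin n) →L[ℝ] EuclideanSpace ℝ (Fin n)) = qMap hQ b β A := by
  let q := (LinearMap.equivOfDetNeZero _ h).toContinuousLinearEquiv
  exact ⟨q, by ext; rfl⟩

/-- The value at `0` of the averaged spinor of `lagChart β A`, off the Maslov cycle. -/
noncomputable def amplitude (hQ : IsCompl Q.1 L₀.1) (b : Basis (Fin n) ℝ Q.1)
    (β : SymplecticBasis ω n) (A : SymMat n) : ℂ :=
  phaseConst (qMap hQ b β A) (pMap b β A)

theorem norm_amplitude_sq (hω : ω.IsAlt) (hQ : IsCompl Q.1 L₀.1) (b : Basis (Fin n) ℝ Q.1)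
    (β : SymplecticBasis ω n) {A : SymMat n} (h : maslovDet hQ b β A ≠ 0) :
    ‖amplitude hQ b β A‖ ^ 2 * |maslovDet hQ b β A| =
      gaussConst (EuclideanSpace ℝ (Fin n)) * gaussMass (qMap hQ b β A) (pMap b β A) := by
  obtain ⟨q, hq⟩ := exists_equiv_of_maslovDet_ne_zero h
  have hsymm : ∀ s t, inner ℝ (pMap b β A s) (q t) = inner ℝ (pMap b β A t) (q s) := fun s t => by
    have := inner_pMap_qMap hω hQ b β A s t
    rwa [← hq] at this
  rw [amplitude, maslovDet, ← hq]
  exact norm_phaseConst_sq q _ hsymm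

theorem addHaar_eq_smul {Q : Submodule ℝ V} [MeasurableSpace V] [BorelSpace V]
    (b b' : Basis (Fin n) ℝ Q) : b.addHaar = ENNReal.ofReal |b.det b'| • b'.addHaar := by
  have h := Measure.addHaarMeasure_unique b.addHaar b'.parallelepiped
  have h2 : b.addHaar (b'.parallelepiped : Set Q) = ENNReal.ofReal |b.det b'| :=
    Measure.addHaar_parallelepiped b b'
  rw [← Basis.addHaar, h2] at h
  exact h

/-- The unit of the value line attached to a basis. -/
noncomputable def valueUnit (hQ : IsCompl Q.1 L₀.1) (b : Basis (Fin n) ℝ Q.1) : ValueLine L₀ n :=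
  toValueLine hQ n (Density.ofBasis (1 / 2) b)

theorem valueUnit_ne_zero (hQ : IsCompl Q.1 L₀.1) (b : Basis (Fin n) ℝ Q.1) :
    valueUnit hQ b ≠ 0 := fun h =>
  Density.ofBasis_ne_zero (α := 1 / 2) b (Density.map_injective _ b (h.trans (map_zero _).symm))

theorem exists_basis (hn : finrank ℝ V = 2 * n) (hnd : ω.Nondegenerate) (L : LagGr ω) :
    Nonempty (Basis (Fin n) ℝ L.1) :=
  ⟨finBasisOfFinrankEq ℝ L.1 (L.finrank_eq hn hnd)⟩

theorem finrank_pureSpinors (hn : finrank ℝ V = 2 * n) (hω : ω.IsAlt) (hnd : ω.Nondegenerate)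
    (hQ : IsCompl Q.1 L₀.1) (L : LagGr ω) : finrank ℂ (pureSpinors hQ n L) = 1 := by
  obtain ⟨b⟩ := exists_basis hn hnd Q
  obtain ⟨β, rfl⟩ := exists_lagChart_zero_eq hn hω hnd L
  obtain ⟨e, -, he0, -⟩ := exists_averageSpinor hn hω hnd hQ b β
  exact finrank_eq_one (e 0) (he0 0) fun θ =>
    exists_smul_eq_of_pureSpinors hn hω hnd hQ b _ _ θ (he0 0)

theorem exists_spinorFrame (hn : finrank ℝ V = 2 * n) (hω : ω.IsAlt) (hnd : ω.Nondegenerate)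
    (hQ : IsCompl Q.1 L₀.1) (L : LagGr ω) :
    ∃ τ : SpinorFrame hQ n, L ∈ lagChart τ.β '' τ.U := by
  obtain ⟨b⟩ := exists_basis hn hnd Q
  obtain ⟨β, rfl⟩ := exists_lagChart_zero_eq hn hω hnd L
  obtain ⟨e, -, he0, hes⟩ := exists_averageSpinor hn hω hnd hQ b β
  exact ⟨⟨β, ⊤, e, fun A _ => he0 A, fun g => (hes g).contDiffOn⟩, 0, trivial, rfl⟩

end

section

variable {V : Type*} [NormedAddCommGroup V] [NormedSpace ℝ V] [FiniteDimensional ℝ V]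
  [MeasurableSpace V] [BorelSpace V]
  {ω : LinearMap.BilinForm ℝ V} {n : ℕ} {L₀ Q : LagGr ω}

/-- The integral of the product of two half-densities does not depend on the basis. -/
theorem integral_density_mul (b b' : Basis (Fin n) ℝ Q.1) (h g : Q.1 → Density n (1 / 2) Q.1) :
    ∫ x, h x b' * g x b' ∂b'.addHaar = ∫ x, h x b * g x b ∂b.addHaar := by
  rw [addHaar_eq_smul b b', integral_smul_measure, ENNReal.toReal_ofReal (abs_nonneg _),
    ← integral_smul]
  congr 1
  ext x
  rw [(h x).apply_basis b b', (g x).apply_basis b b', Complex.real_smul]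
  have : |b.det b'| = |b.det b'| ^ (1 / 2 : ℝ) * |b.det b'| ^ (1 / 2 : ℝ) := by
    rw [← Real.rpow_add_of_nonneg (abs_nonneg _) (by norm_num) (by norm_num)]
    norm_num
  conv_rhs => rw [this]
  push_cast
  ring

theorem integral_addHaar_eq (b : Basis (Fin n) ℝ Q.1) (F : Q.1 → ℂ) :
    ∫ x, F x ∂b.addHaar = ∫ y, F ((euclid b).symm y) := by
  have h1 : Measure.map (euclid b) b.addHaar = volume := by
    have h2 : b.map (euclid b).toLinearEquiv = (EuclideanSpace.basisFun (Fin n) ℝ).toBasis := by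
      ext i j
      simp [euclid_apply, Finsupp.single_apply, eq_comm]
    rw [b.map_addHaar (euclid b), h2, OrthonormalBasis.addHaar_eq_volume]
  rw [← h1]
  have := (euclid b).toHomeomorph.measurableEmbedding.integral_map (μ := b.addHaar)
    (fun y => F ((euclid b).symm y))
  refine Eq.trans ?_ this.symm
  congr 1
  ext x
  change F x = F ((euclid b).symm (euclid b x))
  rw [ContinuousLinearEquiv.symm_apply_apply]

/-- To be represented by a half-density can be tested in one basis. -/
theorem isRepresentedBy_iff (b : Basis (Fin n) ℝ Q.1) (θ : DistHalfDensity n Q.1)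
    (h : Q.1 → Density n (1 / 2) Q.1) : IsRepresentedBy θ h ↔
      ∀ g, θ g = ∫ y, h ((euclid b).symm y) b * coordFn b g y := by
  constructor
  · intro H g
    rw [H b g, integral_addHaar_eq]
    rfl
  · intro H b' g
    rw [H g, integral_density_mul b b', integral_addHaar_eq]
    rfl

/-- A smooth half-density is determined by the distribution it represents. -/
theorem HasValueAtZero.unique {hQ : IsCompl Q.1 L₀.1} (b : Basis (Fin n) ℝ Q.1)
    {θ : DistHalfDensity n Q.1} {v v' : ValueLine L₀ n} (h : HasValueAtZero hQ θ v)
    (h' : HasValueAtZero hQ θ v') : v = v' := by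
  obtain ⟨f, hf, hr, rfl⟩ := h
  obtain ⟨f', hf', hr', rfl⟩ := h'
  rw [isRepresentedBy_iff b] at hr hr'
  congr 1
  refine Density.ext_basis b ?_
  have hc : ∀ {f : Q.1 → Density n (1 / 2) Q.1}, ContDiff ℝ (⊤ : ℕ∞) f →
      Continuous fun y => f ((euclid b).symm y) b := fun {f} hf =>
    (Density.evalCLM (1 / 2) b).continuous.comp (hf.continuous.comp (euclid b).symm.continuous)
  have hae := ae_eq_of_integral_contDiff_smul_eq
    (μ := (volume : Measure (EuclideanSpace ℝ (Fin n))))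
    (hc hf).locallyIntegrable (hc hf').locallyIntegrable fun g hg hgs => by
      obtain ⟨k, hk⟩ := exists_coordFn_eq b (f := fun x => (g x : ℂ))
        ⟨Complex.ofRealCLM.contDiff.comp hg, hgs.comp_left Complex.ofReal_zero⟩
      have := (hr k).symm.trans (hr' k)
      rw [hk] at this
      simpa only [Complex.real_smul, mul_comm] using this
  have heq := (hc hf).ae_eq_iff_eq _ (hc hf') |>.1 hae
  simpa using congrFun heq 0

theorem HasValueAtZero.smul {hQ : IsCompl Q.1 L₀.1} {θ : DistHalfDensity n Q.1}
    {v : ValueLine L₀ n} (h : HasValueAtZero hQ θ v) (c : ℂ) :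
    HasValueAtZero hQ (c • θ) (c • v) := by
  obtain ⟨f, hf, hr, rfl⟩ := h
  refine ⟨fun x => c • f x, hf.const_smul c, fun b g => ?_, map_smul _ _ _⟩
  rw [smul_apply, hr b g, smul_eq_mul, ← integral_const_mul]
  simp only [Density.smul_apply_basis, mul_assoc]

/-- Off the Maslov cycle, the averaged spinor is an oscillating exponential, with value `amplitude`
at `0`. -/
theorem hasValueAtZero_average (hω : ω.IsAlt) (hQ : IsCompl Q.1 L₀.1) (b : Basis (Fin n) ℝ Q.1)
    (β : SymplecticBasis ω n) {A : SymMat n} (hA : lagChart β A ∉ maslovCycle L₀)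
    {θ : DistHalfDensity n Q.1}
    (hθ : ∀ g, θ g = heisenbergAverage (qMap hQ b β A) (pMap b β A) (coordFn b g)) :
    HasValueAtZero hQ θ (amplitude hQ b β A • valueUnit hQ b) := by
  obtain ⟨q, hq⟩ := exists_equiv_of_maslovDet_ne_zero ((maslovDet_ne_zero_iff hQ b β A).2 hA)
  have hsymm : ∀ s t, inner ℝ (pMap b β A s) (q t) = inner ℝ (pMap b β A t) (q s) := fun s t => by
    have := inner_pMap_qMap hω hQ b β A s t
    rwa [← hq] at this
  have hamp : amplitude hQ b β A = phaseConst
      (q : EuclideanSpace ℝ (Fin n) →L[ℝ] EuclideanSpace ℝ (Fin n)) (pMap b β A) := by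
    rw [amplitude, ← hq]
  let S : EuclideanSpace ℝ (Fin n) →L[ℝ] EuclideanSpace ℝ (Fin n) :=
    (pMap b β A).comp (q.symm : EuclideanSpace ℝ (Fin n) →L[ℝ] EuclideanSpace ℝ (Fin n))
  let F : Q.1 → ℂ := fun x => amplitude hQ b β A *
    Complex.exp (-(Complex.I * (inner ℝ (S (euclid b x)) (euclid b x) / 2 : ℝ)))
  refine ⟨fun x => F x • Density.ofBasis (1 / 2) b, ?_, ?_, ?_⟩
  · refine ContDiff.smul (contDiff_const.mul (ContDiff.cexp (ContDiff.neg
      (contDiff_const.mul (Complex.ofRealCLM.contDiff.comp ?_))))) contDiff_const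
    exact ((S.contDiff.comp (euclid b).contDiff).inner ℝ (euclid b).contDiff).div_const 2
  · rw [isRepresentedBy_iff b]
    intro g
    rw [hθ, ← hq, heisenbergAverage_eq q _ hsymm (isTest_coordFn b g).integrable,
      ← integral_const_mul]
    congr 1
    ext y
    rw [Density.smul_apply_basis, Density.ofBasis_self]
    simp only [F, ContinuousLinearEquiv.apply_symm_apply, S, ContinuousLinearMap.comp_apply,
      ContinuousLinearEquiv.coe_coe, hamp]
    ring
  · simp [F, valueUnit]

theorem existsUnique_evaluation (hn : finrank ℝ V = 2 * n) (hω : ω.IsAlt) (hnd : ω.Nondegenerate)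
    (hQ : IsCompl Q.1 L₀.1) (L : LagGr ω) (hL : L ∉ maslovCycle L₀) :
    ∃! φL : pureSpinors hQ n L →ₗ[ℂ] ValueLine L₀ n,
      ∀ θ : pureSpinors hQ n L, HasValueAtZero hQ θ.1 (φL θ) := by
  obtain ⟨b⟩ := exists_basis hn hnd Q
  obtain ⟨β, rfl⟩ := exists_lagChart_zero_eq hn hω hnd L
  obtain ⟨e, he, he0, -⟩ := exists_averageSpinor hn hω hnd hQ b β
  have hv := hasValueAtZero_average hω hQ b β hL (he 0)
  have hspan := fun θ => exists_smul_eq_of_pureSpinors hn hω hnd hQ b _ (e 0) θ (he0 0)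
  obtain ⟨φ₀, hφ₀⟩ := exists_linearMap_smul_eq
    (E := pureSpinors hQ n (lagChart β 0)) (he0 0) (amplitude hQ b β 0 • valueUnit hQ b)
  have key : ∀ θ, HasValueAtZero hQ θ.1 (φ₀ θ) := fun θ => by
    obtain ⟨c, rfl⟩ := hspan θ
    rw [hφ₀]
    exact hv.smul c
  exact ⟨φ₀, key, fun φ hφ => LinearMap.ext fun θ => (hφ θ).unique b (key θ)⟩

/-- In any local frame, the evaluation at `0` is a continuous nonvanishing multiple of the amplitude
of the averages. -/
theorem exists_localRep_eq (hn : finrank ℝ V = 2 * n) (hω : ω.IsAlt) (hnd : ω.Nondegenerate)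
    (hQ : IsCompl Q.1 L₀.1) (b : Basis (Fin n) ℝ Q.1) (τ : SpinorFrame hQ n) :
    ∃ h : SymMat n → ℂ, ContinuousOn h τ.U ∧ (∀ A ∈ τ.U, h A ≠ 0) ∧
      ∀ φ : DualSpinorSection hQ n, IsEvaluationOffMaslov φ → ∀ A ∈ τ.U,
        lagChart τ.β A ∉ maslovCycle L₀ →
          localRep φ τ A = (h A * amplitude hQ b τ.β A) • valueUnit hQ b := by
  obtain ⟨e, he, he0, hes⟩ := exists_averageSpinor hn hω hnd hQ b τ.β
  choose h hh using fun A => exists_smul_eq_of_pureSpinors hn hω hnd hQ b _ _ (τ.e A) (he0 A)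
  refine ⟨h, fun A₀ hA₀ => ?_, fun A hA h0 => ?_, fun φ hφ A hA hA' => ?_⟩
  -- Near `A₀`, the ratio `h` of the two frames is the ratio of their pairings with a half-density
  -- `g` on which `e A₀` does not vanish.
  · obtain ⟨g, hg⟩ : ∃ g, (e A₀).1 g ≠ 0 := by
      by_contra! H
      exact he0 A₀ (Subtype.ext (ContinuousLinearMap.ext H))
    have h1 : ContinuousWithinAt (fun A => (τ.e A).1 g / (e A).1 g) τ.U A₀ :=
      ((τ.smooth g).continuousOn A₀ hA₀).div (hes g).continuous.continuousWithinAt hg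
    refine h1.congr_of_eventuallyEq ?_ ?_
    · filter_upwards [((hes g).continuous.continuousAt.eventually_ne hg).filter_mono
        nhdsWithin_le_nhds] with A hA
      rw [← hh A, eq_div_iff hA]
      rfl
    · rw [← hh A₀, eq_div_iff hg]
      rfl
  · have := hh A
    rw [h0, zero_smul] at this
    exact τ.ne_zero A hA this.symm
  · have h1 := hφ _ hA' (e A)
    have h2 := h1.unique b (hasValueAtZero_average hω hQ b τ.β hA' (he A))
    rw [localRep, ← hh A, map_smul, h2, smul_smul]

end

/-! ### Integrability of the inverse square root of the equation of the Maslov cycle -/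

/-- The constant is uniform in the affine function; for `α = 0` the right-hand side is `⊤`. -/
theorem exists_lintegral_affine_rpow_le {M : ℝ} : ∃ C : ENNReal, C ≠ ⊤ ∧ ∀ α β : ℝ,
    ∫⁻ a in Set.Icc (-M) M, ‖α * a + β‖ₑ ^ (-(1 / 2) : ℝ) ≤ C * ‖α‖ₑ ^ (-(1 / 2) : ℝ) := by
  let F : ℝ → ENNReal := (Metric.ball (0 : ℝ) 1).indicator fun y => ‖y‖ₑ ^ (-(1 / 2) : ℝ)
  have hF : ∫⁻ y, F y ≠ ⊤ := by
    have h1 : IntegrableOn (fun y : ℝ => ‖y‖ ^ (-(1 / 2) : ℝ)) (Metric.ball 0 1) := by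
      refine integrableOn_ball_of_norm_le_rpow (C := 1) (α := 1 / 2) (by simp) (by norm_num)
        (Filter.Eventually.of_forall fun y => ?_) ?_
      · rw [one_mul, Real.norm_of_nonneg (by positivity)]
      · exact (measurable_norm.pow_const _).aestronglyMeasurable
    have h2 := h1.2
    rw [HasFiniteIntegral] at h2
    rw [lintegral_indicator measurableSet_ball]
    refine (lt_of_eq_of_lt (lintegral_congr_ae ?_) h2).ne
    have h3 : ∀ᵐ y : ℝ, y ≠ 0 := by simp [ae_iff]
    filter_upwards [ae_restrict_of_ae h3] with y hy
    rw [← ofReal_norm y, ENNReal.ofReal_rpow_of_pos (norm_pos_iff.2 hy),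
      Real.enorm_of_nonneg (by positivity)]
  refine ⟨volume (Set.Icc (-M) M) + (∫⁻ y, F y) + 1,
    ENNReal.add_ne_top.2 ⟨ENNReal.add_ne_top.2 ⟨by simp, hF⟩, ENNReal.one_ne_top⟩, fun α β => ?_⟩
  rcases eq_or_ne α 0 with rfl | hα
  · rw [enorm_zero, ENNReal.zero_rpow_of_neg (by norm_num), ENNReal.mul_top (by simp)]
    exact le_top
  · have h1 : ∀ a, ‖α * a + β‖ₑ ^ (-(1 / 2) : ℝ) =
        ‖α‖ₑ ^ (-(1 / 2) : ℝ) * ‖a + β / α‖ₑ ^ (-(1 / 2) : ℝ) := fun a => by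
      rw [← ENNReal.mul_rpow_of_ne_top enorm_ne_top enorm_ne_top, ← enorm_mul]
      congr 2
      field_simp
    simp_rw [h1]
    have hm : Measurable fun a : ℝ => ‖a + β / α‖ₑ ^ (-(1 / 2) : ℝ) :=
      (measurable_enorm.comp (measurable_id.add_const _)).pow_const _
    rw [lintegral_const_mul _ hm, mul_comm]
    gcongr
    have h2 : ∀ y : ℝ, ‖y‖ₑ ^ (-(1 / 2) : ℝ) ≤ 1 + F y := fun y => by
      by_cases hy : y ∈ Metric.ball (0 : ℝ) 1
      · rw [show F y = _ from Set.indicator_of_mem hy _]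
        exact le_add_self
      · refine le_add_right (ENNReal.rpow_le_one_of_one_le_of_neg ?_ (by norm_num))
        rw [mem_ball_zero_iff, not_lt] at hy
        rw [← ofReal_norm]
        exact ENNReal.one_le_ofReal.2 hy
    calc ∫⁻ a in Set.Icc (-M) M, ‖a + β / α‖ₑ ^ (-(1 / 2) : ℝ)
        ≤ ∫⁻ a in Set.Icc (-M) M, (1 + F (a + β / α)) := lintegral_mono fun a => h2 _
      _ = volume (Set.Icc (-M) M) + ∫⁻ a in Set.Icc (-M) M, F (a + β / α) := by
          rw [lintegral_add_left measurable_const]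
          simp
      _ ≤ volume (Set.Icc (-M) M) + ∫⁻ a, F (a + β / α) := by
          exact add_le_add_right (setLIntegral_le_lintegral _ _) _
      _ = volume (Set.Icc (-M) M) + ∫⁻ a, F a := by rw [lintegral_add_right_eq_self]
      _ ≤ _ := le_self_add

/-- If `p` is affine in one coordinate, with leading coefficient `α`, then local integrability of
`|α|^{-1/2}` implies that of `|p|^{-1/2}`. -/
theorem lintegral_rpow_ne_top_of_affine {ι : Type*} [Fintype ι] [DecidableEq ι]
    {p α : (ι → ℝ) → ℝ} (hp : Measurable p) (hα : Measurable α) (i : ι)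
    (h : ∀ x a, p (Function.update x i a) = α x * a + p (Function.update x i 0))
    (hαi : ∀ x a, α (Function.update x i a) = α x) {M : ℝ} (hM : 0 < M)
    (hfin : ∫⁻ x, ‖α x‖ₑ ^ (-(1 / 2) : ℝ)
      ∂Measure.pi (fun _ : ι => volume.restrict (Set.Icc (-M) M)) ≠ ⊤) :
    ∫⁻ x, ‖p x‖ₑ ^ (-(1 / 2) : ℝ)
      ∂Measure.pi (fun _ : ι => volume.restrict (Set.Icc (-M) M)) ≠ ⊤ := by
  obtain ⟨C, hC, hC'⟩ := exists_lintegral_affine_rpow_le (M := M)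
  let v : ENNReal := volume (Set.Icc (-M) M)
  have hv0 : v ≠ 0 := by
    simp only [v, Real.volume_Icc, ne_eq, ENNReal.ofReal_eq_zero, not_le]
    linarith
  have hvt : v ≠ ⊤ := by simp [v]
  have hmα : Measurable fun x => ‖α x‖ₑ ^ (-(1 / 2) : ℝ) := hα.enorm.pow_const _
  have key := lintegral_le_of_lmarginal_le
    (μ := fun _ : ι => (volume : Measure ℝ).restrict (Set.Icc (-M) M)) {i}
    (f := fun x => ‖p x‖ₑ ^ (-(1 / 2) : ℝ)) (g := fun x => C / v * ‖α x‖ₑ ^ (-(1 / 2) : ℝ))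
    (hp.enorm.pow_const _) (hmα.const_mul _) (by
      rw [lmarginal_singleton, lmarginal_singleton]
      intro x
      simp only [hαi]
      rw [lintegral_const, Measure.restrict_apply_univ, mul_right_comm]
      change _ ≤ C / v * v * _
      rw [ENNReal.div_mul_cancel hv0 hvt]
      exact (lintegral_congr fun a => by rw [h x a]).trans_le (hC' _ _))
  refine ne_top_of_le_ne_top ?_ key
  rw [lintegral_const_mul _ hmα]
  exact ENNReal.mul_ne_top (ENNReal.div_ne_top hC hv0) hfin

section

variable {X : Type*} [NormedAddCommGroup X] [NormedSpace ℝ X] {n : ℕ}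

/-- The rows `e i + ∑ j, A_ij f j` of a lagrangian matrix, those in `T` being replaced by `f i`. -/
def rowVec (e f : Fin n → X) (T : Finset (Fin n)) (A : SymMat n) (i : Fin n) : X :=
  if i ∈ T then f i else e i + ∑ j, A s(i, j) • f j

theorem continuous_det_rowVec [FiniteDimensional ℝ X] (b : Basis (Fin n) ℝ X) (e f : Fin n → X)
    (T : Finset (Fin n)) : Continuous fun A => b.det (rowVec e f T A) := by
  simp only [Basis.det_apply]
  refine Continuous.matrix_det (continuous_matrix fun i j => ?_)
  have h : Continuous fun A => rowVec e f T A j := by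
    unfold rowVec
    split_ifs
    · exact continuous_const
    · fun_prop
  exact (b.coord i).continuous_of_finiteDimensional.comp h

/-- The determinant is affine in each diagonal entry `A_ii`, which only occurs in the row `i`. -/
theorem det_rowVec_update (b : Basis (Fin n) ℝ X) (e f : Fin n → X) {T : Finset (Fin n)}
    {i : Fin n} (hi : i ∉ T) (A : SymMat n) (a : ℝ) :
    b.det (rowVec e f T (Function.update A s(i, i) a)) =
      b.det (rowVec e f (insert i T) A) * a +
        b.det (rowVec e f T (Function.update A s(i, i) 0)) := by
  have hne : ∀ {j : Fin n}, j ≠ i → ∀ k, s(j, k) ≠ s(i, i) := fun {j} hj k h => by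
    rw [Sym2.eq_iff] at h
    rcases h with h | h
    · exact hj h.1
    · exact hj h.1
  have hoff : ∀ {j : Fin n}, j ≠ i → ∀ a, rowVec e f T (Function.update A s(i, i) a) j =
      rowVec e f T A j := fun {j} hj a => by
    simp only [rowVec, Function.update_of_ne (hne hj _)]
  have hi1 : rowVec e f T (Function.update A s(i, i) a) i =
      rowVec e f T (Function.update A s(i, i) 0) i + a • f i := by
    simp only [rowVec, if_neg hi, add_assoc]
    congr 1
    rw [← Finset.add_sum_erase _ _ (Finset.mem_univ i),
      ← Finset.add_sum_erase Finset.univ (fun j => (Function.update A s(i, i) 0) s(i, j) • f j)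
        (Finset.mem_univ i)]
    simp only [Function.update_self, zero_smul, zero_add]
    rw [add_comm]
    congr 1
    refine Finset.sum_congr rfl fun j hj => ?_
    have : s(i, j) ≠ s(i, i) := by
      rw [Sym2.eq_swap]
      exact hne (Finset.ne_of_mem_erase hj) _
    rw [Function.update_of_ne this, Function.update_of_ne this]
  have e1 : rowVec e f T (Function.update A s(i, i) a) =
      Function.update (rowVec e f T (Function.update A s(i, i) 0)) i
        (rowVec e f T (Function.update A s(i, i) 0) i + a • f i) := by
    ext1 j
    rcases eq_or_ne j i with rfl | hj
    · rw [Function.update_self, hi1]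
    · rw [Function.update_of_ne hj, hoff hj, hoff hj]
  have e2 : Function.update (rowVec e f T (Function.update A s(i, i) 0)) i (f i) =
      rowVec e f (insert i T) A := by
    ext1 j
    rcases eq_or_ne j i with rfl | hj
    · simp [rowVec]
    · rw [Function.update_of_ne hj, hoff hj]
      simp [rowVec, hj]
  rw [e1, AlternatingMap.map_update_add, AlternatingMap.map_update_smul, e2,
    Function.update_eq_self, smul_eq_mul]
  ring

/-- Once the row `i` is replaced by `f i`, the entry `A_ii` does not occur any more. -/
theorem rowVec_insert_update (e f : Fin n → X) (T : Finset (Fin n)) (i : Fin n) (A : SymMat n)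
    (a : ℝ) : rowVec e f (insert i T) (Function.update A s(i, i) a) =
      rowVec e f (insert i T) A := by
  ext1 j
  simp only [rowVec]
  split_ifs with h
  · rfl
  · congr 1
    refine Finset.sum_congr rfl fun k _ => ?_
    rw [Function.update_of_ne]
    intro h'
    rw [Sym2.eq_iff] at h'
    rcases h' with h' | h' <;> exact h (h'.1 ▸ Finset.mem_insert_self _ _)

/-- Integration over the diagonal entries with index in `T`, one at a time. -/
theorem lintegral_det_rowVec_ne_top [FiniteDimensional ℝ X] (b : Basis (Fin n) ℝ X)
    (e f : Fin n → X) {M : ℝ} (hM : 0 < M) (T : Finset (Fin n)) :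
    ∫⁻ A, ‖b.det (rowVec e f T A)‖ₑ ^ (-(1 / 2) : ℝ)
      ∂Measure.pi (fun _ : Sym2 (Fin n) => volume.restrict (Set.Icc (-M) M)) ≠ ⊤ →
    ∫⁻ A, ‖b.det (rowVec e f ∅ A)‖ₑ ^ (-(1 / 2) : ℝ)
      ∂Measure.pi (fun _ : Sym2 (Fin n) => volume.restrict (Set.Icc (-M) M)) ≠ ⊤ := by
  induction T using Finset.induction_on with
  | empty => exact id
  | insert i T hi ih =>
    intro h
    refine ih (lintegral_rpow_ne_top_of_affine (continuous_det_rowVec b e f T).measurable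
      (continuous_det_rowVec b e f (insert i T)).measurable s(i, i)
      (det_rowVec_update b e f hi) (fun A a => ?_) hM h)
    rw [rowVec_insert_update]

end

section

variable {V : Type*} [NormedAddCommGroup V] [NormedSpace ℝ V] [FiniteDimensional ℝ V]
  {ω : LinearMap.BilinForm ℝ V} {n : ℕ} {L₀ Q : LagGr ω}

theorem maslovDet_eq_det_rowVec (hQ : IsCompl Q.1 L₀.1) (b : Basis (Fin n) ℝ Q.1)
    (β : SymplecticBasis ω n) (A : SymMat n) : maslovDet hQ b β A =
      (EuclideanSpace.basisFun (Fin n) ℝ).toBasis.det (rowVec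
        (fun i => qCoord hQ b (β.basis (.inl i)))
        (fun i => qCoord hQ b (β.basis (.inr i))) ∅ A) := by
  have h := (EuclideanSpace.basisFun (Fin n) ℝ).toBasis.det_comp
    (qMap hQ b β A : EuclideanSpace ℝ (Fin n) →ₗ[ℝ] EuclideanSpace ℝ (Fin n))
    (EuclideanSpace.basisFun (Fin n) ℝ).toBasis
  rw [Basis.det_self, mul_one] at h
  rw [maslovDet, ← h]
  congr 1
  ext1 i
  have hf : frameMap β A (EuclideanSpace.single i 1) = graphVec β A i := by
    rw [frameMap_apply, Finset.sum_eq_single i]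
    · simp
    · intro j _ hj
      simp [hj]
    · simp
  simp only [Function.comp_apply, OrthonormalBasis.coe_toBasis, EuclideanSpace.basisFun_apply,
    ContinuousLinearMap.coe_coe, qMap_apply, hf]
  simp [graphVec, rowVec]

theorem continuous_maslovDet (hQ : IsCompl Q.1 L₀.1) (b : Basis (Fin n) ℝ Q.1)
    (β : SymplecticBasis ω n) : Continuous (maslovDet hQ b β) := by
  simp_rw [funext (maslovDet_eq_det_rowVec hQ b β)]
  exact continuous_det_rowVec _ _ _ _

/-- For a suitable set `T` of indices, the vectors `f i`, `i ∈ T`, and `e i`, `i ∉ T`, span a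
lagrangian subspace transversal to `L₀`. -/
theorem exists_det_rowVec_ne_zero (hQ : IsCompl Q.1 L₀.1) (b : Basis (Fin n) ℝ Q.1)
    (β : SymplecticBasis ω n) : ∃ (T : Finset (Fin n)) (γ : ℝ), γ ≠ 0 ∧ ∀ A,
      (EuclideanSpace.basisFun (Fin n) ℝ).toBasis.det (rowVec
        (fun i => qCoord hQ b (β.basis (.inl i)))
        (fun i => qCoord hQ b (β.basis (.inr i))) T A) = γ := by
  classical
  let f : Fin n → EuclideanSpace ℝ (Fin n) := fun i => qCoord hQ b (β.basis (.inr i))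
  let e : Fin n → EuclideanSpace ℝ (Fin n) := fun i => qCoord hQ b (β.basis (.inl i))
  have hq : ∀ u, qCoord hQ b u = 0 → u ∈ L₀.1 := fun u hu => by
    rwa [qCoord_apply, map_eq_zero_iff _ (euclid b).injective,
      Submodule.projectionOnto_apply_eq_zero_iff] at hu
  obtain ⟨S, -, -, hspan, hli⟩ := exists_linearIndepOn_extension
    (linearIndepOn_empty ℝ f) (Set.empty_subset Set.univ)
  let T : Finset (Fin n) := S.toFinset
  have hT : ∀ i, i ∈ T ↔ i ∈ S := fun i => Set.mem_toFinset
  -- The entries of `A` only occur multiplied by vectors in the span of the `f i`, `i ∈ T`.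
  let v : Fin n → EuclideanSpace ℝ (Fin n) := fun i => if i ∈ T then f i else e i
  have hdet : ∀ A, (EuclideanSpace.basisFun (Fin n) ℝ).toBasis.det (rowVec e f T A) =
      (EuclideanSpace.basisFun (Fin n) ℝ).toBasis.det v := by
    intro A
    set D := (EuclideanSpace.basisFun (Fin n) ℝ).toBasis.det
    have hw : ∀ (r : Fin n → EuclideanSpace ℝ (Fin n)) (i : Fin n), i ∉ T →
        (∀ j ∈ T, r j = f j) → D (Function.update r i (e i + ∑ j, A s(i, j) • f j)) =
          D (Function.update r i (e i)) := by
      intro r i hi hr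
      have h1 : Submodule.span ℝ (f '' S) ≤
          LinearMap.ker (D.toMultilinearMap.toLinearMap r i) := by
        rw [Submodule.span_le]
        rintro _ ⟨j, hj, rfl⟩
        have hj' := (hT j).2 hj
        rw [← hr j hj']
        exact D.map_update_self r (fun h => hi (h ▸ hj'))
      have h2 : ∑ j, A s(i, j) • f j ∈ Submodule.span ℝ (f '' S) :=
        Submodule.sum_mem _ fun j _ => Submodule.smul_mem _ _ (hspan ⟨j, trivial, rfl⟩)
      have h3 : D (Function.update r i (∑ j, A s(i, j) • f j)) = 0 := h1 h2
      rw [AlternatingMap.map_update_add, h3, add_zero]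
    have hind : ∀ U : Finset (Fin n), (∀ i ∈ U, i ∉ T) →
        D (fun i => if i ∈ U then e i else rowVec e f T A i) = D (rowVec e f T A) := by
      intro U
      induction U using Finset.induction_on with
      | empty => simp
      | insert i U hi ih =>
        intro hU
        rw [← ih fun j hj => hU j (Finset.mem_insert_of_mem hj)]
        have hiT := hU i (Finset.mem_insert_self _ _)
        have h1 := hw (fun j => if j ∈ U then e j else rowVec e f T A j) i hiT fun j hj => by
          have : j ∉ U := fun h => hU j (Finset.mem_insert_of_mem h) hj
          simp [this, rowVec, hj]
        refine Eq.trans ?_ (h1.symm.trans ?_) <;> congr 1 <;> ext1 j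
        · rcases eq_or_ne j i with rfl | hj
          · simp
          · simp [hj]
        · rcases eq_or_ne j i with rfl | hj
          · simp [hi, rowVec, hiT]
          · simp [hj]
    rw [← hind (Finset.univ.filter fun i => i ∉ T) (by simp)]
    congr 1
    ext1 i
    by_cases hi : i ∈ T <;> simp [v, rowVec, hi]
  refine ⟨T, _, ?_, hdet⟩
  -- A relation between the `v i` gives a vector `u` of `L₀`, a combination of vectors of the
  -- canonical basis `β`. For `j ∉ T`, the `j`-th vector of the second half of `β` differs by a vector
  -- of `L₀` from a combination of those with index in `T`. Pairing `u` with this difference shows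
  -- that the coefficients with index outside `T` vanish.
  have hvli : LinearIndependent ℝ v := by
    rw [Fintype.linearIndependent_iff]
    intro c hc
    let u : V := ∑ i, c i • if i ∈ T then β.basis (.inr i) else β.basis (.inl i)
    have hu : u ∈ L₀.1 := hq u (by
      simp only [u, map_sum, map_smul]
      rw [← hc]
      refine Finset.sum_congr rfl fun i _ => ?_
      simp only [v, e, f]
      split_ifs <;> rfl)
    have huf : ∀ j, ω u (β.basis (.inr j)) = if j ∈ T then 0 else c j := fun j => by
      simp only [u, map_sum, map_smul, LinearMap.sum_apply, LinearMap.smul_apply]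
      rw [Finset.sum_eq_single j]
      · split_ifs <;> simp [β.ff, β.ef]
      · intro i _ hij
        split_ifs <;> simp [β.ff, β.ef, hij]
      · simp
    have h1 : ∀ j ∉ T, c j = 0 := fun j hj => by
      have h2 : f j ∈ Submodule.span ℝ (f '' S) := hspan ⟨j, trivial, rfl⟩
      have h3 : f '' S = qCoord hQ b '' ((fun i => β.basis (.inr i)) '' S) := by
        rw [Set.image_image]
      rw [h3, ← Submodule.map_span] at h2
      obtain ⟨g, hg, hgj⟩ := h2
      have h4 : ω u g = 0 := by
        have h5 : Submodule.span ℝ ((fun i => β.basis (.inr i)) '' S) ≤ LinearMap.ker (ω u) := by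
          rw [Submodule.span_le]
          rintro _ ⟨i, hi, rfl⟩
          change ω u (β.basis (.inr i)) = 0
          rw [huf, if_pos ((hT i).2 hi)]
        exact h5 hg
      have h6 : β.basis (.inr j) - g ∈ L₀.1 := hq _ (by rw [map_sub, hgj, sub_self])
      have h7 := L₀.isotropic hu h6
      rw [map_sub, h4, huf, if_neg hj, sub_zero] at h7
      exact h7
    have h8 : ∑ i ∈ T, c i • f i = 0 := by
      rw [← hc, ← Finset.sum_subset (Finset.subset_univ T) fun i _ hi => by rw [h1 i hi, zero_smul]]
      exact Finset.sum_congr rfl fun i hi => by simp only [v, if_pos hi]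
    intro i
    by_cases hi : i ∈ T
    · have hli' : LinearIndepOn ℝ f (T : Set (Fin n)) := by rwa [Set.coe_toFinset]
      exact linearIndepOn_finset_iff.1 hli' c h8 i hi
    · exact h1 i hi
  have hb : LinearIndependent ℝ v ∧ Submodule.span ℝ (Set.range v) = ⊤ :=
    ⟨hvli, hvli.span_eq_top_of_card_eq_finrank' (by simp)⟩
  exact ((Basis.is_basis_iff_det _).1 hb).ne_zero

/-- The function `|det|^{-1/2}` is locally integrable: the determinant is affine in each diagonal
entry, and the coefficient of a suitable product of diagonal entries is a nonzero constant. -/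
theorem lintegral_maslovDet_rpow_ne_top (hQ : IsCompl Q.1 L₀.1) (b : Basis (Fin n) ℝ Q.1)
    (β : SymplecticBasis ω n) {M : ℝ} (hM : 0 < M) :
    ∫⁻ A in Set.univ.pi fun _ => Set.Icc (-M) M, ‖maslovDet hQ b β A‖ₑ ^ (-(1 / 2) : ℝ) ≠ ⊤ := by
  rw [volume_pi, Measure.restrict_pi_pi]
  simp_rw [maslovDet_eq_det_rowVec]
  obtain ⟨T, γ, hγ, hT⟩ := exists_det_rowVec_ne_zero hQ b β
  refine lintegral_det_rowVec_ne_top _ _ _ hM T ?_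
  simp_rw [hT]
  rw [lintegral_const]
  refine ENNReal.mul_ne_top ?_ (measure_ne_top _ _)
  simp [ENNReal.rpow_eq_top_iff, hγ]

theorem exists_box_superset {K : Set (SymMat n)} (hK : IsCompact K) :
    ∃ M : ℝ, 0 < M ∧ K ⊆ Set.univ.pi fun _ => Set.Icc (-M) M := by
  obtain ⟨M, hM⟩ := hK.isBounded.exists_norm_le
  refine ⟨max M 1, by positivity, fun A hA i _ => ?_⟩
  have := (norm_le_pi_norm A i).trans (hM A hA)
  rw [Real.norm_eq_abs, abs_le] at this
  constructor
  · linarith [le_max_left M 1]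
  · exact this.2.trans (le_max_left M 1)

/-- A function whose power of exponent `-1/2` is locally integrable vanishes almost nowhere. -/
theorem volume_maslovCycle (hQ : IsCompl Q.1 L₀.1) (b : Basis (Fin n) ℝ Q.1)
    (β : SymplecticBasis ω n) : volume (lagChart β ⁻¹' maslovCycle L₀) = 0 := by
  have h0 : lagChart β ⁻¹' maslovCycle L₀ = {A | maslovDet hQ b β A = 0} := by
    ext A
    have := maslovDet_ne_zero_iff hQ b β A
    simp only [Set.mem_preimage, Set.mem_ofPred_eq]
    tauto
  have hm : Measurable fun A => ‖maslovDet hQ b β A‖ₑ ^ (-(1 / 2) : ℝ) :=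
    (continuous_maslovDet hQ b β).measurable.enorm.pow_const _
  have h1 : ∀ k : ℕ, ∀ᵐ A, A ∈ (Set.univ.pi fun _ => Set.Icc (-(k + 1 : ℝ)) (k + 1) :
      Set (SymMat n)) → maslovDet hQ b β A ≠ 0 := fun k => by
    have h2 := ae_lt_top hm (lintegral_maslovDet_rpow_ne_top hQ b β (M := k + 1) (by positivity))
    rw [ae_restrict_iff' (MeasurableSet.univ_pi fun _ => measurableSet_Icc)] at h2
    filter_upwards [h2] with A hA hAk h0
    have := hA hAk
    rw [h0, enorm_zero, ENNReal.zero_rpow_of_neg (by norm_num)] at this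
    exact lt_irrefl _ this
  rw [h0]
  have h2 : ∀ᵐ A, maslovDet hQ b β A ≠ 0 := by
    filter_upwards [ae_all_iff.2 h1] with A hA
    obtain ⟨M, hM, hAM⟩ := exists_box_superset (isCompact_singleton (x := A))
    obtain ⟨k, hk⟩ := exists_nat_ge M
    refine hA k fun i hi => ?_
    have := hAM rfl i hi
    exact ⟨by linarith [this.1], by linarith [this.2]⟩
  simpa [ae_iff] using h2

end

/-! ### Transition maps between canonical charts -/

section

variable {V : Type*} [AddCommGroup V] [Module ℝ V] {ω : LinearMap.BilinForm ℝ V} {n : ℕ}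

/-- The second half of the coordinates with respect to a canonical basis. -/
noncomputable def sndCoord (β : SymplecticBasis ω n) : V →ₗ[ℝ] EuclideanSpace ℝ (Fin n) :=
  (WithLp.linearEquiv 2 ℝ (Fin n → ℝ)).symm.toLinearMap.comp
    (LinearMap.pi fun i => β.basis.coord (.inr i))

theorem sndCoord_apply (β : SymplecticBasis ω n) (u : V) (i : Fin n) :
    sndCoord β u i = β.basis.repr u (.inr i) := rfl

/-- The transition from the chart of `β` to that of `β'` sends `A` to `transR A * (transP A)⁻¹`;
this is the denominator. It is invertible exactly where `lagChart β A` is in the chart of `β'`. -/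
noncomputable def transP (β β' : SymplecticBasis ω n) (A : SymMat n) :
    EuclideanSpace ℝ (Fin n) →L[ℝ] EuclideanSpace ℝ (Fin n) :=
  ((fstCoord β').comp (frameMap β A)).toContinuousLinearMap

/-- The numerator of the transition between two charts. -/
noncomputable def transR (β β' : SymplecticBasis ω n) (A : SymMat n) :
    EuclideanSpace ℝ (Fin n) →L[ℝ] EuclideanSpace ℝ (Fin n) :=
  ((sndCoord β').comp (frameMap β A)).toContinuousLinearMap

theorem transP_apply (β β' : SymplecticBasis ω n) (A : SymMat n) (t) :
    transP β β' A t = fstCoord β' (frameMap β A t) := rfl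

theorem transR_apply (β β' : SymplecticBasis ω n) (A : SymMat n) (t) :
    transR β β' A t = sndCoord β' (frameMap β A t) := rfl

theorem differentiable_transP (β β' : SymplecticBasis ω n) : Differentiable ℝ (transP β β') := by
  obtain ⟨T, hT⟩ := exists_comp_frameMap_eq β (fstCoord β')
  have : transP β β' = fun A => transP β β' 0 + T A := funext hT
  rw [this]
  exact T.differentiable.const_add _

theorem differentiable_transR (β β' : SymplecticBasis ω n) : Differentiable ℝ (transR β β') := by
  obtain ⟨T, hT⟩ := exists_comp_frameMap_eq β (sndCoord β')
  have : transR β β' = fun A => transR β β' 0 + T A := funext hT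
  rw [this]
  exact T.differentiable.const_add _

theorem LagGr.eq_of_le {L L' : LagGr ω} (h : L.1 ≤ L'.1) : L = L' := by
  refine Subtype.ext (le_antisymm h fun u hu => ?_)
  exact (L.mem_iff u).2 fun v hv => L'.isotropic (h hv) hu

theorem isUnit_transP_of_mem_range {β β' : SymplecticBasis ω n} {A A' : SymMat n}
    (h : lagChart β A = lagChart β' A') : IsUnit (transP β β' A) := by
  have hinj : Function.Injective (transP β β' A) := by
    rw [injective_iff_map_eq_zero]
    intro t ht
    have h1 := frameMap_mem β A t
    rw [h, mem_lagChart_iff] at h1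
    obtain ⟨s, hs⟩ := h1
    rw [transP_apply, ← hs, fstCoord_frameMap] at ht
    rw [ht, map_zero] at hs
    exact (map_eq_zero_iff _ (frameMap_injective β A)).1 hs.symm
  let e := LinearEquiv.ofInjectiveEndo _ hinj
  refine ⟨ContinuousLinearEquiv.unitsEquiv ℝ _ |>.symm e.toContinuousLinearEquiv, ?_⟩
  ext t : 1
  rfl

/-- The formula for the transition between two charts. -/
theorem apply_eq_of_lagChart_eq {β β' : SymplecticBasis ω n} {A A' : SymMat n}
    (h : lagChart β A = lagChart β' A') (i j : Fin n) :
    A' s(i, j) = transR β β' A (Ring.inverse (transP β β' A) (EuclideanSpace.single i 1)) j := by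
  obtain ⟨u, hu⟩ := isUnit_transP_of_mem_range h
  set t := Ring.inverse (transP β β' A) (EuclideanSpace.single i 1) with ht
  have hPt : transP β β' A t = EuclideanSpace.single i 1 := by
    have h2 : transP β β' A * Ring.inverse (transP β β' A) = 1 :=
      Ring.mul_inverse_cancel _ ⟨u, hu⟩
    have := congrArg (fun T => T (EuclideanSpace.single i 1)) h2
    simpa using this
  have h1 := frameMap_mem β A t
  rw [h, mem_lagChart_iff] at h1
  obtain ⟨s, hs⟩ := h1
  have hs' : s = EuclideanSpace.single i 1 := by
    rw [← hPt, transP_apply, ← hs, fstCoord_frameMap]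
  rw [transR_apply, ← hs, sndCoord_apply, repr_inr_frameMap, hs']
  simp

theorem exists_lagChart_eq_of_isUnit {β β' : SymplecticBasis ω n} {A : SymMat n}
    (h : IsUnit (transP β β' A)) : ∃ A', lagChart β A = lagChart β' A' := by
  let t : Fin n → EuclideanSpace ℝ (Fin n) := fun i =>
    Ring.inverse (transP β β' A) (EuclideanSpace.single i 1)
  have hPt : ∀ i, transP β β' A (t i) = EuclideanSpace.single i 1 := fun i => by
    have h2 := Ring.mul_inverse_cancel _ h
    have := congrArg (fun T => T (EuclideanSpace.single i 1)) h2
    simpa using this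
  let S : Fin n → Fin n → ℝ := fun i j => β'.basis.repr (frameMap β A (t i)) (.inr j)
  have hrepr : ∀ i, frameMap β A (t i) =
      β'.basis (.inl i) + ∑ j, S i j • β'.basis (.inr j) := fun i => by
    rw [← β'.basis.sum_repr (frameMap β A (t i)), Fintype.sum_sum_type]
    congr 1
    rw [Finset.sum_eq_single i]
    · rw [← fstCoord_apply, ← transP_apply, hPt]
      simp
    · intro j _ hj
      rw [← fstCoord_apply, ← transP_apply, hPt]
      simp [hj]
    · simp
  have hsymm : ∀ i j, S i j = S j i := fun i j => by
    have h1 := (lagChart β A).isotropic (frameMap_mem β A (t i)) (frameMap_mem β A (t j))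
    rw [hrepr i, hrepr j] at h1
    simp [β'.ee, β'.ff, β'.ef, β'.fe] at h1
    linarith
  refine ⟨Sym2.lift ⟨S, hsymm⟩, (LagGr.eq_of_le ?_).symm⟩
  change Submodule.span ℝ (Set.range (graphVec β' _)) ≤ _
  rw [Submodule.span_le]
  rintro _ ⟨i, rfl⟩
  have : graphVec β' (Sym2.lift ⟨S, hsymm⟩) i = frameMap β A (t i) := by
    rw [hrepr]
    rfl
  rw [this]
  exact frameMap_mem β A _

theorem lagChart_lagCoord {β β' : SymplecticBasis ω n} {A : SymMat n}
    (h : IsUnit (transP β β' A)) : lagChart β' (lagCoord β' (lagChart β A)) = lagChart β A := by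
  obtain ⟨A', hA'⟩ := exists_lagChart_eq_of_isUnit h
  rw [hA', lagCoord_lagChart]

theorem isOpen_isUnit_transP (β β' : SymplecticBasis ω n) :
    IsOpen {A | IsUnit (transP β β' A)} :=
  Units.isOpen.preimage (differentiable_transP β β').continuous

theorem differentiableAt_transition {β β' : SymplecticBasis ω n} {A : SymMat n}
    (h : IsUnit (transP β β' A)) :
    DifferentiableAt ℝ (fun A => lagCoord β' (lagChart β A)) A := by
  rw [differentiableAt_pi]
  intro z
  induction z using Sym2.inductionOn with
  | hf i j =>
    have h1 : (fun A => lagCoord β' (lagChart β A) s(i, j)) =ᶠ[nhds A] fun A =>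
        transR β β' A (Ring.inverse (transP β β' A) (EuclideanSpace.single i 1)) j := by
      filter_upwards [(isOpen_isUnit_transP β β').mem_nhds h] with B hB
      exact apply_eq_of_lagChart_eq (lagChart_lagCoord hB).symm i j
    refine DifferentiableAt.congr_of_eventuallyEq ?_ h1
    have h2 : DifferentiableAt ℝ (fun A => Ring.inverse (transP β β' A)) A := by
      exact (differentiableAt_inverse (𝕜 := ℝ) h).comp A (differentiable_transP β β' A)
    have h3 : DifferentiableAt ℝ (fun A =>
        transR β β' A (Ring.inverse (transP β β' A) (EuclideanSpace.single i 1))) A :=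
      (differentiable_transR β β' A).clm_apply (h2.clm_apply (differentiableAt_const _))
    exact (EuclideanSpace.proj j : EuclideanSpace ℝ (Fin n) →L[ℝ] ℝ).differentiableAt.comp A h3

end

/-! ### Bounds for the Gaussian mass of a lagrangian subspace -/

section

variable {X : Type*} [NormedAddCommGroup X] [InnerProductSpace ℝ X] [FiniteDimensional ℝ X]
  [MeasurableSpace X] [BorelSpace X]

theorem exists_gaussMass_le {c : ℝ} (hc : 0 ≤ c) : ∃ C : ℝ, ∀ q p : X →L[ℝ] X,
    (∀ t, ‖t‖ ≤ c * (‖q t‖ + ‖p t‖)) → gaussMass q p ≤ C := by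
  obtain ⟨C, -, h⟩ := exists_gaussKernel_le (X := X) hc (finrank ℝ X + 1)
  have hi := integrable_one_add_norm (E := X) (μ := volume) (r := (finrank ℝ X + 1 : ℕ))
      (by push_cast; linarith)
  refine ⟨_, fun q p hb => integral_mono (integrable_gaussMass hc hb) (hi.const_mul C) fun t => ?_⟩
  have h1 := h t (q t) (p t) 0 (hb t)
  rw [norm_gaussKernel] at h1
  simp only [norm_zero, add_zero, one_pow, mul_one] at h1
  simp only
  rw [Real.rpow_neg (by positivity), Real.rpow_natCast, ← div_eq_mul_inv,
    le_div_iff₀ (by positivity)]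
  exact h1

/-- The mass is bounded below by that of a large multiple of the diagonal. -/
theorem exists_le_gaussMass {c : ℝ} (hc : 0 ≤ c) (K : ℝ) : ∃ m : ℝ, 0 < m ∧ ∀ q p : X →L[ℝ] X,
    (∀ t, ‖t‖ ≤ c * (‖q t‖ + ‖p t‖)) → ‖q‖ ≤ K → ‖p‖ ≤ K → m ≤ gaussMass q p := by
  let k := max K 1
  have hk : 0 < k := lt_of_lt_of_le one_pos (le_max_right _ _)
  let I : X →L[ℝ] X := k • ContinuousLinearMap.id ℝ X
  have hI : ∀ t, ‖I t‖ = k * ‖t‖ := fun t => by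
    simp [I, norm_smul, abs_of_pos hk]
  have hIb : ∀ t, ‖t‖ ≤ 1 * (‖I t‖ + ‖I t‖) := fun t => by
    rw [hI]
    nlinarith [le_max_right K 1, norm_nonneg t]
  refine ⟨gaussMass I I, gaussMass_pos zero_le_one hIb, fun q p hb hq hp => ?_⟩
  refine integral_mono (integrable_gaussMass zero_le_one hIb) (integrable_gaussMass hc hb)
    fun t => ?_
  have h1 : ‖q t‖ ≤ ‖I t‖ := by
    rw [hI]
    exact (q.le_opNorm t).trans (by gcongr; exact hq.trans (le_max_left _ _))
  have h2 : ‖p t‖ ≤ ‖I t‖ := by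
    rw [hI]
    exact (p.le_opNorm t).trans (by gcongr; exact hp.trans (le_max_left _ _))
  simp only
  gcongr

end

/-! ### The distributional section defined by the evaluation, and its singularities -/

section

variable {V : Type*} [NormedAddCommGroup V] [NormedSpace ℝ V] [FiniteDimensional ℝ V]
  {ω : LinearMap.BilinForm ℝ V} {n : ℕ} {L₀ Q : LagGr ω}

theorem continuous_qMap (hQ : IsCompl Q.1 L₀.1) (b : Basis (Fin n) ℝ Q.1)
    (β : SymplecticBasis ω n) : Continuous (qMap hQ b β) := by
  obtain ⟨T, hT⟩ := exists_comp_frameMap_eq β (qCoord hQ b)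
  have : qMap hQ b β = fun A => qMap hQ b β 0 + T A := funext hT
  rw [this]
  exact continuous_const.add T.continuous

theorem continuous_pMap (b : Basis (Fin n) ℝ Q.1) (β : SymplecticBasis ω n) :
    Continuous (pMap b β) := by
  obtain ⟨T, hT⟩ := exists_comp_frameMap_eq β (pCoord b)
  have : pMap b β = fun A => pMap b β 0 + T A := funext hT
  rw [this]
  exact continuous_const.add T.continuous

theorem stronglyMeasurable_amplitude (hQ : IsCompl Q.1 L₀.1) (b : Basis (Fin n) ℝ Q.1)
    (β : SymplecticBasis ω n) : StronglyMeasurable (amplitude hQ b β) := by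
  have hq : Continuous fun z : SymMat n × EuclideanSpace ℝ (Fin n) => qMap hQ b β z.1 z.2 :=
    ((continuous_qMap hQ b β).comp continuous_fst).clm_apply continuous_snd
  have hp : Continuous fun z : SymMat n × EuclideanSpace ℝ (Fin n) => pMap b β z.1 z.2 :=
    ((continuous_pMap b β).comp continuous_fst).clm_apply continuous_snd
  have h : Continuous fun z : SymMat n × EuclideanSpace ℝ (Fin n) =>
      Complex.exp (Complex.I * (inner ℝ (pMap b β z.1 z.2) (qMap hQ b β z.1 z.2) / 2 : ℝ) -
        (‖qMap hQ b β z.1 z.2‖ ^ 2 / 2 : ℝ)) := by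
    fun_prop
  exact h.stronglyMeasurable.integral_prod_right

/-- The amplitude blows up at most like the inverse square root of the equation of the Maslov
cycle. -/
theorem exists_norm_amplitude_le (hω : ω.IsAlt) (hnd : ω.Nondegenerate) (hQ : IsCompl Q.1 L₀.1)
    (b : Basis (Fin n) ℝ Q.1) (β : SymplecticBasis ω n) : ∃ C : ℝ, 0 ≤ C ∧ ∀ A,
      maslovDet hQ b β A ≠ 0 →
        ‖amplitude hQ b β A‖ ≤ C * |maslovDet hQ b β A| ^ (-(1 / 2) : ℝ) := by
  obtain ⟨c, hc, hb⟩ := exists_norm_le_qMap_pMap hω hnd hQ b β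
  obtain ⟨C, hC⟩ := exists_gaussMass_le (X := EuclideanSpace ℝ (Fin n)) hc
  refine ⟨Real.sqrt (gaussConst (EuclideanSpace ℝ (Fin n)) * C), Real.sqrt_nonneg _,
    fun A hA => ?_⟩
  have h1 := norm_amplitude_sq hω hQ b β hA
  have hpos : 0 < |maslovDet hQ b β A| := abs_pos.2 hA
  have h2 : ‖amplitude hQ b β A‖ ^ 2 ≤
      gaussConst (EuclideanSpace ℝ (Fin n)) * C / |maslovDet hQ b β A| := by
    rw [le_div_iff₀ hpos, h1]
    exact mul_le_mul_of_nonneg_left (hC _ _ (hb A)) gaussConst_pos.le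
  have h3 := Real.le_sqrt_of_sq_le h2
  rwa [Real.sqrt_div' _ hpos.le, Real.sqrt_eq_rpow (|maslovDet hQ b β A|), div_eq_mul_inv,
    ← Real.rpow_neg hpos.le] at h3

/-- The amplitude blows up at least like the inverse square root of the equation of the Maslov
cycle. -/
theorem exists_le_norm_amplitude (hω : ω.IsAlt) (hnd : ω.Nondegenerate) (hQ : IsCompl Q.1 L₀.1)
    (b : Basis (Fin n) ℝ Q.1) (β : SymplecticBasis ω n) (A₀ : SymMat n) :
    ∃ m : ℝ, 0 < m ∧ ∀ᶠ A in nhds A₀, maslovDet hQ b β A ≠ 0 →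
      m ≤ ‖amplitude hQ b β A‖ ^ 2 * |maslovDet hQ b β A| := by
  obtain ⟨c, hc, hb⟩ := exists_norm_le_qMap_pMap hω hnd hQ b β
  obtain ⟨m, hm, hm'⟩ := exists_le_gaussMass (X := EuclideanSpace ℝ (Fin n)) hc
    (max (‖qMap hQ b β A₀‖ + 1) (‖pMap b β A₀‖ + 1))
  refine ⟨gaussConst (EuclideanSpace ℝ (Fin n)) * m, mul_pos gaussConst_pos hm, ?_⟩
  filter_upwards [(continuous_qMap hQ b β).norm.continuousAt.eventually_lt_const (lt_add_one _),
    (continuous_pMap b β).norm.continuousAt.eventually_lt_const (lt_add_one _)] with A hq hp hA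
  rw [norm_amplitude_sq hω hQ b β hA]
  exact mul_le_mul_of_nonneg_left (hm' _ _ (hb A) (hq.le.trans (le_max_left _ _))
    (hp.le.trans (le_max_right _ _))) gaussConst_pos.le

theorem ae_notMem_maslovCycle (hQ : IsCompl Q.1 L₀.1) (b : Basis (Fin n) ℝ Q.1)
    (β : SymplecticBasis ω n) : ∀ᵐ A, lagChart β A ∉ maslovCycle L₀ := by
  simp only [ae_iff, not_not]
  exact volume_maslovCycle hQ b β

/-- Equal multiples of two spinors have equal evaluations. The equality `L = L'` is only
propositional, so that the two spinors belong to different types. -/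
theorem smul_apply_eq_of_smul_eq {hQ : IsCompl Q.1 L₀.1} (φ : DualSpinorSection hQ n)
    {L L' : LagGr ω} (hL : L = L') (θ : pureSpinors hQ n L) (θ' : pureSpinors hQ n L') {a a' : ℂ}
    (h : a • (θ : DistHalfDensity n Q.1) = a' • (θ' : DistHalfDensity n Q.1)) :
    a • φ L θ = a' • φ L' θ' := by
  subst hL
  have h1 : a • θ = a' • θ' := Subtype.ext h
  rw [← map_smul, ← map_smul, h1]

/-- The pairings of a section with test sections do not depend on the local frames, by the formula
for the change of variables in integrals. -/
theorem integral_localRep_eq {hQ : IsCompl Q.1 L₀.1} (φ : DualSpinorSection hQ n)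
    (τ τ' : SpinorFrame hQ n) (f : 𝓓(τ.U, ℂ)) (f' : 𝓓(τ'.U, ℂ)) (h : SameTestSection τ τ' f f') :
    ∫ A in τ.U, f A • localRep φ τ A = ∫ A in τ'.U, f' A • localRep φ τ' A := by
  obtain ⟨hf, hf', heq⟩ := h
  -- `κ` is the transition map, and `D` the part of the first domain which it maps to the second.
  let κ : SymMat n → SymMat n := fun A => lagCoord τ'.β (lagChart τ.β A)
  let O : Set (SymMat n) := {A | IsUnit (transP τ.β τ'.β A)}
  let D : Set (SymMat n) := (τ.U : Set (SymMat n)) ∩ O ∩ κ ⁻¹' τ'.U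
  have hO : IsOpen O := isOpen_isUnit_transP _ _
  have hD : IsOpen D := by
    refine ContinuousOn.isOpen_inter_preimage (fun A hA => ?_) (τ.U.isOpen.inter hO) τ'.U.isOpen
    exact (differentiableAt_transition hA.2).continuousAt.continuousWithinAt
  have hκ : ∀ A ∈ D, lagChart τ'.β (κ A) = lagChart τ.β A := fun A hA => lagChart_lagCoord hA.1.2
  have hDmem : ∀ A ∈ τ.U, ∀ A' ∈ τ'.U, lagChart τ.β A = lagChart τ'.β A' → A ∈ D ∧ κ A = A' := by
    intro A hA A' hA' h
    have h1 : κ A = A' := by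
      simp only [κ]
      rw [h, lagCoord_lagChart]
    refine ⟨⟨⟨hA, isUnit_transP_of_mem_range h⟩, ?_⟩, h1⟩
    rw [Set.mem_preimage, h1]
    exact hA'
  have hinj : Set.InjOn κ D := fun A hA B hB hAB => by
    have h1 := hκ A hA
    rw [hAB, hκ B hB] at h1
    exact (lagChart_injective τ.β h1).symm
  have hsub : D ⊆ τ.U := fun A hA => hA.1.1
  have hsub' : κ '' D ⊆ τ'.U := by
    rintro _ ⟨A, hA, rfl⟩
    exact hA.2
  have e1 : ∫ A in τ.U, f A • localRep φ τ A = ∫ A in D, f A • localRep φ τ A := by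
    refine setIntegral_eq_of_subset_of_forall_sdiff_eq_zero τ.U.isOpen.measurableSet hsub
      fun A hA => ?_
    by_cases hAf : A ∈ tsupport f
    · obtain ⟨A', hA', h'⟩ := hf hAf
      exact absurd (hDmem A hA.1 A' hA' h'.symm).1 hA.2
    · rw [image_eq_zero_of_notMem_tsupport hAf, zero_smul]
  have e2 : ∫ A in τ'.U, f' A • localRep φ τ' A = ∫ A in κ '' D, f' A • localRep φ τ' A := by
    refine setIntegral_eq_of_subset_of_forall_sdiff_eq_zero τ'.U.isOpen.measurableSet hsub'
      fun A' hA' => ?_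
    by_cases hAf : A' ∈ tsupport f'
    · obtain ⟨A, hA, h'⟩ := hf' hAf
      obtain ⟨h1, h2⟩ := hDmem A hA A' hA'.1 h'
      exact absurd ⟨A, h1, h2⟩ hA'.2
    · rw [image_eq_zero_of_notMem_tsupport hAf, zero_smul]
  rw [e1, e2, integral_image_eq_integral_abs_det_fderiv_smul volume hD.measurableSet
    (fun A hA => (differentiableAt_transition hA.1.2).hasFDerivAt.hasFDerivWithinAt) hinj]
  refine setIntegral_congr_fun hD.measurableSet fun A hA => ?_
  have h1 := smul_apply_eq_of_smul_eq φ (hκ A hA).symm (τ.e A) (τ'.e (κ A))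
    (heq A hA.1.1 (κ A) hA.2 (hκ A hA).symm)
  simp only [localRep]
  rw [h1, mul_smul]
  exact (RCLike.real_smul_eq_coe_smul (K := ℂ) (lagJacobian τ.β τ'.β A)
    (f' (κ A) • φ (lagChart τ'.β (κ A)) (τ'.e (κ A)))).symm

/-- A locally integrable section defines a distributional section. -/
theorem IsLocallyL1.exists_distSection {hQ : IsCompl Q.1 L₀.1} {φ : DualSpinorSection hQ n}
    (hφ : IsLocallyL1 φ) : ∃ Φ : DistSection hQ n, Φ.IsGivenBy φ := by
  let B : ℂ →L[ℂ] ValueLine L₀ n →L[ℂ] ValueLine L₀ n := ContinuousLinearMap.lsmul ℂ ℂ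
  have hval : ∀ (τ : SpinorFrame hQ n) (f : 𝓓(τ.U, ℂ)),
      (TestFunction.integralAgainstBilinCLM B volume (localRep φ τ) :
        𝓓(τ.U, ℂ) →L[ℂ] ValueLine L₀ n) f = ∫ A in τ.U, f A • localRep φ τ A := by
    intro τ f
    rw [TestFunction.integralAgainstBilinCLM_eq_integral (hφ τ)]
    refine (setIntegral_eq_integral_of_forall_compl_eq_zero fun A hA => ?_).symm
    have h0 : f A = 0 := image_eq_zero_of_notMem_tsupport fun h => hA (f.tsupport_subset h)
    change f A • localRep φ τ A = 0
    rw [h0, zero_smul]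
  refine ⟨⟨fun τ => TestFunction.integralAgainstBilinCLM B volume (localRep φ τ),
    fun τ τ' f f' h => ?_⟩, fun τ f => ⟨?_, hval τ f⟩⟩
  · rw [hval, hval, integral_localRep_eq φ τ τ' f f' h]
  · exact (f.integrable_bilin B (hφ τ)).integrableOn

end

section

variable {V : Type*} [NormedAddCommGroup V] [NormedSpace ℝ V] [FiniteDimensional ℝ V]
  [MeasurableSpace V] [BorelSpace V]
  {ω : LinearMap.BilinForm ℝ V} {n : ℕ} {L₀ Q : LagGr ω}

/-- In a local frame the section is a continuous multiple of the amplitude, hence is dominated by a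
locally integrable function. -/
theorem isLocallyL1_of_isEvaluation (hn : finrank ℝ V = 2 * n) (hω : ω.IsAlt)
    (hnd : ω.Nondegenerate) {hQ : IsCompl Q.1 L₀.1} {φ : DualSpinorSection hQ n}
    (hφ : IsEvaluationOffMaslov φ) : IsLocallyL1 φ := by
  intro τ
  obtain ⟨b⟩ := exists_basis hn hnd Q
  obtain ⟨h, hh, -, hrep⟩ := exists_localRep_eq hn hω hnd hQ b τ
  rw [locallyIntegrableOn_iff τ.U.isOpen.isLocallyClosed]
  intro K hKU hK
  have hrep' : ∀ᵐ A ∂volume.restrict K,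
      (h A * amplitude hQ b τ.β A) • valueUnit hQ b = localRep φ τ A := by
    filter_upwards [ae_restrict_mem hK.measurableSet,
      ae_restrict_of_ae (ae_notMem_maslovCycle hQ b τ.β)] with A hAK hA
    exact (hrep φ hφ A (hKU hAK) hA).symm
  have hmeas : AEStronglyMeasurable (fun A => (h A * amplitude hQ b τ.β A) • valueUnit hQ b)
      (volume.restrict K) :=
    (((hh.mono hKU).aestronglyMeasurable hK.measurableSet).mul
      (stronglyMeasurable_amplitude hQ b τ.β).aestronglyMeasurable).smul_const _
  refine ⟨hmeas.congr hrep', ?_⟩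
  obtain ⟨B, hB⟩ := hK.exists_bound_of_continuousOn (hh.mono hKU)
  obtain ⟨C, hC, hamp⟩ := exists_norm_amplitude_le hω hnd hQ b τ.β
  obtain ⟨M, hM, hKM⟩ := exists_box_superset hK
  have hbound : ∀ᵐ A ∂volume.restrict K, ‖localRep φ τ A‖ₑ ≤
      ENNReal.ofReal (|B| * C * ‖valueUnit hQ b‖) * ‖maslovDet hQ b τ.β A‖ₑ ^ (-(1 / 2) : ℝ) := by
    filter_upwards [hrep', ae_restrict_mem hK.measurableSet,
      ae_restrict_of_ae (ae_notMem_maslovCycle hQ b τ.β)] with A hA hAK hA'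
    have hd := (maslovDet_ne_zero_iff hQ b τ.β A).2 hA'
    rw [← hA, ← ofReal_norm, ← ofReal_norm (maslovDet hQ b τ.β A),
      ENNReal.ofReal_rpow_of_pos (norm_pos_iff.2 hd), ← ENNReal.ofReal_mul (by positivity)]
    refine ENNReal.ofReal_le_ofReal ?_
    rw [norm_smul, norm_mul]
    calc ‖h A‖ * ‖amplitude hQ b τ.β A‖ * ‖valueUnit hQ b‖
        ≤ |B| * (C * |maslovDet hQ b τ.β A| ^ (-(1 / 2) : ℝ)) * ‖valueUnit hQ b‖ := by
          gcongr
          · exact (hB A hAK).trans (le_abs_self B)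
          · exact hamp A hd
      _ = _ := by
          rw [Real.norm_eq_abs]
          ring
  rw [HasFiniteIntegral]
  refine (lintegral_mono_ae hbound).trans_lt ?_
  rw [lintegral_const_mul' _ _ ENNReal.ofReal_ne_top]
  refine ENNReal.mul_lt_top ENNReal.ofReal_lt_top ?_
  exact (lintegral_mono_set hKM).trans_lt
    (lintegral_maslovDet_rpow_ne_top hQ b τ.β hM).lt_top

/-- Near the Maslov cycle the evaluation at `0` is unbounded, hence is not almost everywhere equal
to a continuous function. -/
theorem not_ae_eq_continuousOn (hn : finrank ℝ V = 2 * n) (hω : ω.IsAlt)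
    (hnd : ω.Nondegenerate) {hQ : IsCompl Q.1 L₀.1} {φ : DualSpinorSection hQ n}
    (hφ : IsEvaluationOffMaslov φ) (τ : SpinorFrame hQ n) {A₀ : SymMat n} (hA₀ : A₀ ∈ τ.U)
    (hA₀' : lagChart τ.β A₀ ∈ maslovCycle L₀) {k : SymMat n → ValueLine L₀ n}
    (hk : ContinuousOn k τ.U) (hae : ∀ᵐ A, A ∈ τ.U → localRep φ τ A = k A) : False := by
  obtain ⟨b⟩ := exists_basis hn hnd Q
  obtain ⟨h, hh, hh0, hrep⟩ := exists_localRep_eq hn hω hnd hQ b τ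
  obtain ⟨m, hm, hamp⟩ := exists_le_norm_amplitude hω hnd hQ b τ.β A₀
  have hU : (τ.U : Set (SymMat n)) ∈ nhds A₀ := τ.U.isOpen.mem_nhds hA₀
  have hd0 : maslovDet hQ b τ.β A₀ = 0 := by
    by_contra hne
    exact (maslovDet_ne_zero_iff hQ b τ.β A₀).1 hne hA₀'
  have hw := norm_pos_iff.2 (valueUnit_ne_zero hQ b)
  -- The continuous function `|k|² |det| - |h|² |w|² m` is negative at `A₀`, but nonnegative almost
  -- everywhere near `A₀`.
  let G : SymMat n → ℝ := fun A =>
    ‖k A‖ ^ 2 * |maslovDet hQ b τ.β A| - ‖h A‖ ^ 2 * ‖valueUnit hQ b‖ ^ 2 * m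
  have hG : ContinuousAt G A₀ := by
    have h1 := (hk A₀ hA₀).continuousAt hU
    have h2 := (hh A₀ hA₀).continuousAt hU
    have h3 := (continuous_maslovDet hQ b τ.β).continuousAt (x := A₀)
    exact ((h1.norm.pow 2).mul h3.abs).sub (((h2.norm.pow 2).mul continuousAt_const).mul
      continuousAt_const)
  have hG0 : G A₀ < 0 := by
    have h1 := norm_pos_iff.2 (hh0 A₀ hA₀)
    simp only [G, hd0, abs_zero, mul_zero, zero_sub, neg_lt_zero]
    positivity
  have hev := (hG.eventually_lt_const hG0).and (hamp.and hU)
  obtain ⟨A, hA, hAG, hAamp, hAU⟩ :=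
    (Measure.dense_of_ae (hae.and (ae_notMem_maslovCycle hQ b τ.β))).inter_nhds_nonempty hev
  have hrepA := hrep φ hφ A hAU hA.2
  rw [hA.1 hAU] at hrepA
  have h1 := hAamp ((maslovDet_ne_zero_iff hQ b τ.β A).2 hA.2)
  simp only [G, hrepA, norm_smul, norm_mul] at hAG
  have h2 : ‖h A‖ ^ 2 * ‖valueUnit hQ b‖ ^ 2 * m ≤ ‖h A‖ ^ 2 * ‖valueUnit hQ b‖ ^ 2 *
      (‖amplitude hQ b τ.β A‖ ^ 2 * |maslovDet hQ b τ.β A|) := by gcongr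
  nlinarith [h2, hAG]

theorem maslovCycle_subset_singularSupport (hn : finrank ℝ V = 2 * n) (hω : ω.IsAlt)
    (hnd : ω.Nondegenerate) {hQ : IsCompl Q.1 L₀.1} {φ : DualSpinorSection hQ n}
    (hφ : IsEvaluationOffMaslov φ) {Φ : DistSection hQ n} (hΦ : Φ.IsGivenBy φ) :
    maslovCycle L₀ ⊆ Φ.singularSupport := by
  rintro L hL ⟨τ, ⟨A₀, hA₀, rfl⟩, k, hk, hkΦ⟩
  refine not_ae_eq_continuousOn hn hω hnd hφ τ hA₀ hL hk.continuousOn ?_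
  have : FiniteDimensional ℂ (ValueLine L₀ n) :=
    Module.Finite.of_injective _ Density.evalSome_injective
  have : CompleteSpace (ValueLine L₀ n) := FiniteDimensional.complete ℂ _
  have hloc := isLocallyL1_of_isEvaluation hn hω hnd hφ τ
  have hkloc : LocallyIntegrableOn k τ.U :=
    hk.continuousOn.locallyIntegrableOn τ.U.isOpen.measurableSet
  have hae := τ.U.isOpen.ae_eq_zero_of_integral_contDiff_smul_eq_zero (hloc.sub hkloc)
    fun g hg hgc hgU => by
      let f : 𝓓(τ.U, ℂ) :=
        { toFun := fun A => (g A : ℂ)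
          contDiff' := Complex.ofRealCLM.contDiff.comp hg
          hasCompactSupport' := hgc.comp_left Complex.ofReal_zero
          tsupport_subset' := (tsupport_comp_subset Complex.ofReal_zero g).trans hgU }
      have hint1 := (hΦ τ f).1
      have hint2 : IntegrableOn (fun A => f A • k A) τ.U volume :=
        (f.integrable_bilin (ContinuousLinearMap.lsmul ℂ ℂ) hkloc).integrableOn
      have h1 := (hΦ τ f).2.symm.trans (hkΦ f)
      rw [← sub_eq_zero, ← integral_sub hint1 hint2] at h1
      rw [← h1]
      refine Eq.trans ?_ (setIntegral_eq_integral_of_forall_compl_eq_zero fun A hA => ?_).symm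
      · congr 1
        ext A
        change g A • (localRep φ τ A - k A) =
          (g A : ℂ) • localRep φ τ A - (g A : ℂ) • k A
        rw [← smul_sub]
        exact RCLike.real_smul_eq_coe_smul (K := ℂ) (g A) _
      · have h2 : f A = 0 := image_eq_zero_of_notMem_tsupport fun h => hA (f.tsupport_subset h)
        rw [h2, zero_smul, zero_smul, sub_zero]
  filter_upwards [hae] with A hA hAU
  exact sub_eq_zero.1 (hA hAU)

end

theorem mainTheorem2
    {V : Type*} [NormedAddCommGroup V] [NormedSpace ℝ V] [FiniteDimensional ℝ V]
    [MeasurableSpace V] [BorelSpace V]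
    (n : ℕ) (hn : Module.finrank ℝ V = 2 * n)
    (ω : LinearMap.BilinForm ℝ V) (hω_alt : ω.IsAlt) (hω_nondeg : ω.Nondegenerate)
    (L₀ Q : LagGr ω) (hQ : IsCompl Q.1 L₀.1) :
    -- `E` is a complex line bundle over `Λ`
    (∀ L : LagGr ω, Module.finrank ℂ (pureSpinors hQ n L) = 1) ∧
    (∀ L : LagGr ω, ∃ τ : SpinorFrame hQ n, L ∈ lagChart τ.β '' τ.U) ∧
    -- the evaluation at `0` is well defined and linear on the fibres off the Maslov cycle
    (∀ L ∉ maslovCycle L₀, ∃! φL : pureSpinors hQ n L →ₗ[ℂ] ValueLine L₀ n,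
      ∀ θ : pureSpinors hQ n L, HasValueAtZero hQ θ.1 (φL θ)) ∧
    -- the Maslov cycle has measure zero
    (∀ β : SymplecticBasis ω n, MeasureTheory.volume (lagChart β ⁻¹' maslovCycle L₀) = 0) ∧
    -- every extension of the evaluation across the Maslov cycle is locally integrable, hence is a
    -- distributional section, and this one is singular everywhere on the Maslov cycle
    (∀ φ : DualSpinorSection hQ n, IsEvaluationOffMaslov φ →
      IsLocallyL1 φ ∧
      ∃ Φ : DistSection hQ n, Φ.IsGivenBy φ ∧ maslovCycle L₀ ⊆ Φ.singularSupport) := by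
  obtain ⟨b⟩ := exists_basis hn hω_nondeg Q
  refine ⟨finrank_pureSpinors hn hω_alt hω_nondeg hQ, exists_spinorFrame hn hω_alt hω_nondeg hQ,
    existsUnique_evaluation hn hω_alt hω_nondeg hQ, volume_maslovCycle hQ b, fun φ hφ => ?_⟩
  have h := isLocallyL1_of_isEvaluation hn hω_alt hω_nondeg hφ
  obtain ⟨Φ, hΦ⟩ := h.exists_distSection
  exact ⟨h, Φ, hΦ, maslovCycle_subset_singularSupport hn hω_alt hω_nondeg hφ hΦ⟩
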